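/- Let $n,m\ge 0$ be integers. An $(n,m)$-graph is a finite graph with $n$ types of arcs and $m$ types of edges whose underlying graph is simple (no loops, and any two vertices are joined by at most one arc or edge). A homomorphism $f\colon G\to H$ of $(n,m)$-graphs is a map $V(G)\to V(H)$ that sends each arc $uv$ of $G$ to an arc $f(u)f(v)$ of $H$ of the same type and direction, and each edge $uv$ of $G$ to an edge $f(u)f(v)$ of $H$ of the same type. A set $R\subseteq V(G)$ is an $(n,m)$-relative clique of $G$ if $|f(R)|=|R|$ for every homomorphism $f$ of $G$ to any $(n,m)$-graph $H$, and $\omega_{r(n,m)}(G)$ denotes the maximum size of an $(n,m)$-relative clique of $G$. Let $\mathcal P_4$ be the family of triangle-free planar graphs, and let $$\omega_{r(n,m)}(\mathcal P_4)=\max\{\omega_{r(n,m)}(G) : G \text{ an } (n,m)\text{-graph whose underlying graph is in } \mathcal P_4\}.$$ Theorem. If $2n+m\ge 3$, then this maximum exists and $$\omega_{r(n,m)}(\mathcal P_4)=2(2n+m)^2+2 .$$ That is, every triangle-free planar $(n,m)$-graph $G$ satisfies $\omega_{r(n,m)}(G)\le 2(2n+m)^2+2$, and equality holds for some such $G$.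 -/

import Mathlib

universe u

/-- An `(n,m)`-graph on the vertex set `V`: `n` types of arcs and `m` types of edges,
such that the underlying graph is simple (no loops, and between two vertices there is at most
one arc or edge, of a single type and, for an arc, in a single direction). -/
structure NMGraph (n m : ℕ) (V : Type u) where
  /-- `arc i u v`: there is an arc of type `i` from `u` to `v`. -/
  arc : Fin n → V → V → Prop
  /-- `edge j u v`: there is an edge of type `j` between `u` and `v`. -/
  edge : Fin m → V → V → Prop
  edge_symm : ∀ j u v, edge j u v → edge j v u
  arc_irrefl : ∀ i v, ¬ arc i v v
  edge_irrefl : ∀ j v, ¬ edge j v v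
  arc_unique : ∀ i i' u v, arc i u v → arc i' u v → i = i'
  arc_asymm : ∀ i i' u v, arc i u v → ¬ arc i' v u
  edge_unique : ∀ j j' u v, edge j u v → edge j' u v → j = j'
  arc_not_edge : ∀ i j u v, arc i u v → ¬ edge j u v

namespace NMGraph

variable {n m : ℕ} {V W : Type u}

/-- The underlying simple graph. -/
def und (G : NMGraph n m V) : SimpleGraph V where
  Adj u v := (∃ i, G.arc i u v ∨ G.arc i v u) ∨ ∃ j, G.edge j u v
  symm := ⟨by
    rintro u v (⟨i, h⟩ | ⟨j, h⟩)
    · exact Or.inl ⟨i, h.symm⟩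
    · exact Or.inr ⟨j, G.edge_symm j u v h⟩⟩
  loopless := ⟨by
    rintro v (⟨i, h | h⟩ | ⟨j, h⟩)
    · exact G.arc_irrefl i v h
    · exact G.arc_irrefl i v h
    · exact G.edge_irrefl j v h⟩

/-- Homomorphisms of `(n,m)`-graphs: vertex maps preserving arcs and edges with their types and
directions. -/
def IsHom (G : NMGraph n m V) (H : NMGraph n m W) (f : V → W) : Prop :=
  (∀ i u v, G.arc i u v → H.arc i (f u) (f v)) ∧
    ∀ j u v, G.edge j u v → H.edge j (f u) (f v)

/-- `R` is an `(n,m)`-relative clique of `G`: `|f(R)| = |R|` for every homomorphism `f` of `G`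
to any `(n,m)`-graph. -/
def IsRelativeClique (G : NMGraph n m V) (R : Set V) : Prop :=
  ∀ (W : Type u) (H : NMGraph n m W) (f : V → W), G.IsHom H f → (f '' R).ncard = R.ncard

/-- The `(n,m)`-relative clique number of a finite `(n,m)`-graph: the maximum size of a relative
clique. (For finite `V` the set is nonempty and bounded by the number of vertices.) -/
noncomputable def relativeCliqueNumber (G : NMGraph n m V) : ℕ :=
  sSup {k : ℕ | ∃ R : Set V, G.IsRelativeClique R ∧ R.ncard = k}

end NMGraph

/-- `A` is a simple polygonal curve in the plane with ends `a` and `b`, with successive corners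
`p 0 = a, p 1, …, p k = b`: successive segments meet only in their common corner, and any two
other segments are disjoint. -/
def IsPolygonalArc (a b : ℝ × ℝ) (A : Set (ℝ × ℝ)) : Prop :=
  ∃ (k : ℕ) (p : ℕ → ℝ × ℝ), p 0 = a ∧ p k = b ∧
    (∀ i < k, p i ≠ p (i + 1)) ∧
    (∀ i j, i < j → j < k → ∀ z ∈ segment ℝ (p i) (p (i + 1)),
      z ∈ segment ℝ (p j) (p (j + 1)) → j = i + 1 ∧ z = p j) ∧
    A = ⋃ i ∈ Set.Iio k, segment ℝ (p i) (p (i + 1))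

/-- A drawing of a graph in the plane without crossings: vertices are distinct points, edges are
simple polygonal curves joining their ends, an edge contains no vertex other than its ends, and
two edges meet only in common ends. (`arc e` is irrelevant if `e` is not an edge.) -/
structure PlaneDrawing {V : Type u} (G : SimpleGraph V) where
  pos : V → ℝ × ℝ
  pos_injective : Function.Injective pos
  arc : Sym2 V → Set (ℝ × ℝ)
  isPolygonalArc : ∀ u v, G.Adj u v → IsPolygonalArc (pos u) (pos v) (arc s(u, v))
  mem_of_pos_mem : ∀ e ∈ G.edgeSet, ∀ w, pos w ∈ arc e → w ∈ e
  inter_subset : ∀ e ∈ G.edgeSet, ∀ e' ∈ G.edgeSet, e ≠ e' →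
    ∀ z ∈ arc e, z ∈ arc e' → ∃ w, w ∈ e ∧ w ∈ e' ∧ z = pos w

/-- A graph is planar if it can be drawn in the plane without crossings. -/
def IsPlanar {V : Type u} (G : SimpleGraph V) : Prop := Nonempty (PlaneDrawing G)

/-- The values `ω_{r(n,m)}(G)` for finite `(n,m)`-graphs `G` whose underlying graph lies in the
family `F` of simple graphs; the relative clique number of `F` is the maximum of this set. -/
def relativeCliqueNumbers (n m : ℕ) (F : ∀ V : Type u, SimpleGraph V → Prop) : Set ℕ :=
  {k | ∃ (V : Type u) (_ : Finite V) (G : NMGraph n m V),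
    F V G.und ∧ G.relativeCliqueNumber = k}

/-- The family `P₄` of triangle-free planar graphs. -/
def TriangleFreePlanar (V : Type u) (G : SimpleGraph V) : Prop :=
  G.CliqueFree 3 ∧ IsPlanar G

/-! Let `p = 2n + m` be the number of colours in which a vertex can see a neighbour (along or
against an arc of some type, or along an edge of some type). Two vertices of a relative clique `R`
must be adjacent or be seen in different colours by a common neighbour, since otherwise identifying
them is a homomorphism. So the upper bound is a statement about coloured cliques in triangle-free
planar graphs, `IsColoredClique.card_le`.

Planarity enters only through minors: `K₃,₃` and `K₅` are excluded, and Euler's inequality bounds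
the number of edges. Both follow from linear algebra instead of the Jordan curve theorem. In a
straight drawing the winding numbers of a flow are a potential on the faces, so the flows are
exactly the tensions of a dual graph. This property passes to minors, and comparing dimensions gives
Euler's inequality (`HasAbstractDual.euler`).

The combinatorial core is this. If `w` sees at least four vertices of `R` in one colour, these have
a second common neighbour `h` (`exists_hub`); and among four or more common neighbours of `w` and
`h` at most two have the same colour at `w` and the same colour at `h` (`fiber_le_two`). So `w` sees
at most `2p` vertices of `R` in each colour, hence at most `2p²`.

If no two vertices have three common neighbours in `R`, then `R` has at most `max 20 (3p + 6)`
elements. Otherwise let `w`, `h` be poles with a set `X` of at least three common neighbours in `R`.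
Every other vertex of `R` is a pole or a private neighbour of one pole; let `A`, `B` be the private
neighbours of `w`, `h`. If `A` or `B` is empty, the bound for one star plus the two poles gives `2p²
+ 2`. If both are nonempty and use `s` and `t` colours at their poles, then these colours are nearly
lost for `X`, which gives `|X| ≤ 2(p - s)(p - t) + 2` (`card_common_le`). Bounds on `A` and `B`
finish the count.

Equality holds for two poles joined to `p²` pairs of leaves, one for each pair of colours at the
poles, where a middle vertex tells the two leaves of a pair apart. -/

open Finset

/-! ### Flows, abstract duals and Euler's inequality. -/

namespace SimpleGraph

variable {V : Type*} {W : Type*}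

/-- `S` is connected in `G`: any two of its vertices are joined by a walk inside `S`. -/
def ConnOn (G : SimpleGraph V) (S : Set V) : Prop :=
  ∀ u ∈ S, ∀ v ∈ S, Relation.ReflTransGen (fun a b => G.Adj a b ∧ a ∈ S ∧ b ∈ S) u v

/-- `Q` is a minor of `G`, by way of disjoint connected branch sets. -/
def IsMinorOf (Q : SimpleGraph W) (G : SimpleGraph V) : Prop :=
  ∃ B : W → Set V, (∀ w w', w ≠ w' → Disjoint (B w) (B w')) ∧ (∀ w, G.ConnOn (B w)) ∧
    ∀ w x, Q.Adj w x → ∃ a ∈ B w, ∃ b ∈ B x, G.Adj a b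

/-- Real flows on a graph: antisymmetric functions on darts without divergence. -/
structure IsFlow [Fintype V] (G : SimpleGraph V) (c : V → V → ℝ) : Prop where
  antisymm : ∀ u v, c v u = -c u v
  supp : ∀ u v, ¬ G.Adj u v → c u v = 0
  div : ∀ u, ∑ v, c u v = 0

open Classical in
/-- A graph has an abstract dual if its flows are the tensions of some graph with vertex set
`Fin N`, where `left u v` is the dual vertex to the left of the dart from `u` to `v`. -/
def HasAbstractDual [Fintype V] (G : SimpleGraph V) : Prop :=
  ∃ (N : ℕ) (left : V → V → Fin N),
    (∀ c, G.IsFlow c → ∃ φ : Fin N → ℝ, ∀ u v, G.Adj u v →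
      c u v = φ (left u v) - φ (left v u)) ∧
    ∀ (φ : Fin N → ℝ) (u : V),
      ∑ v, (if G.Adj u v then φ (left u v) - φ (left v u) else 0) = 0

section Euler

variable [LinearOrder W] (Q : SimpleGraph W)

/-- The edges of `Q`, oriented upwards. -/
abbrev UpEdge := {d : W × W // Q.Adj d.1 d.2 ∧ d.1 < d.2}

open Classical in
/-- The antisymmetric function on darts with given values on the upward edges. -/
noncomputable def extendUp : (Q.UpEdge → ℝ) →ₗ[ℝ] (W → W → ℝ) where
  toFun x u v := (if h : Q.Adj u v ∧ u < v then x ⟨(u, v), h⟩ else 0) -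
    (if h : Q.Adj v u ∧ v < u then x ⟨(v, u), h⟩ else 0)
  map_add' x y := by
    funext u v
    simp only [Pi.add_apply]
    split_ifs <;> ring
  map_smul' r x := by
    funext u v
    simp only [Pi.smul_apply, smul_eq_mul, RingHom.id_apply]
    split_ifs <;> ring

theorem extendUp_antisymm (x : Q.UpEdge → ℝ) (u v : W) :
    Q.extendUp x v u = -Q.extendUp x u v := by
  simp [extendUp]

theorem extendUp_supp (x : Q.UpEdge → ℝ) (u v : W) (h : ¬ Q.Adj u v) :
    Q.extendUp x u v = 0 := by
  have h' : ¬ Q.Adj v u := fun h' => h h'.symm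
  simp [extendUp, h, h']

theorem extendUp_apply (x : Q.UpEdge → ℝ) (e : Q.UpEdge) :
    Q.extendUp x e.1.1 e.1.2 = x e := by
  obtain ⟨⟨u, v⟩, h⟩ := e
  have h2 : ¬ (v < u) := not_lt.mpr h.2.le
  simp [extendUp, h.1, h.2, h2]

variable [Fintype W]

/-- The divergence of a function on the upward edges. -/
noncomputable def divUp : (Q.UpEdge → ℝ) →ₗ[ℝ] (W → ℝ) where
  toFun x u := ∑ v, Q.extendUp x u v
  map_add' x y := by
    funext u
    simp [map_add, Finset.sum_add_distrib]
  map_smul' r x := by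
    funext u
    simp [map_smul, Finset.mul_sum]

theorem isFlow_extendUp (x : Q.UpEdge → ℝ) (hx : Q.divUp x = 0) : Q.IsFlow (Q.extendUp x) :=
  ⟨Q.extendUp_antisymm x, Q.extendUp_supp x, fun u => congrFun hx u⟩

theorem sum_divUp (x : Q.UpEdge → ℝ) : ∑ u, Q.divUp x u = 0 := by
  have h : ∑ u, ∑ v, Q.extendUp x u v = ∑ u, ∑ v, -Q.extendUp x u v := by
    rw [Finset.sum_comm]
    refine Finset.sum_congr rfl fun u _ => Finset.sum_congr rfl fun v _ => ?_
    exact Q.extendUp_antisymm x u v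
  simp only [Finset.sum_neg_distrib] at h
  change ∑ u, ∑ v, Q.extendUp x u v = 0
  linarith

-- Divergences have total zero, so they lie in a space of dimension `|W| - 1`; rank-nullity then
-- bounds the space of flows from below, whether or not the graph is connected.
open Classical in
theorem finrank_ker_divUp [Nonempty W] :
    Nat.card Q.UpEdge + 1 ≤ Module.finrank ℝ (LinearMap.ker Q.divUp) + Fintype.card W := by
  have h1 := LinearMap.finrank_range_add_finrank_ker Q.divUp
  rw [Module.finrank_fintype_fun_eq_card, ← Nat.card_eq_fintype_card] at h1
  let s : (W → ℝ) →ₗ[ℝ] ℝ := ∑ w, LinearMap.proj w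
  have hs : ∀ f, s f = ∑ w, f w := fun f => by simp [s]
  have h2 := LinearMap.finrank_range_add_finrank_ker s
  rw [Module.finrank_fintype_fun_eq_card] at h2
  have h3 : LinearMap.range s = ⊤ := by
    rw [LinearMap.range_eq_top]
    intro r
    obtain ⟨w⟩ := ‹Nonempty W›
    exact ⟨Pi.single w r, by simp [hs]⟩
  rw [h3, finrank_top, Module.finrank_self] at h2
  have h4 : LinearMap.range Q.divUp ≤ LinearMap.ker s := by
    rintro _ ⟨x, rfl⟩
    rw [LinearMap.mem_ker, hs, sum_divUp]
  have h5 := Submodule.finrank_mono h4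
  omega

theorem card_darts :
    Nat.card {d : W × W // Q.Adj d.1 d.2} = 2 * Nat.card Q.UpEdge := by
  classical
  rw [Nat.card_eq_fintype_card, Fintype.card_subtype]
  have h1 : #{d : W × W | Q.Adj d.1 d.2 ∧ d.1 < d.2} = Nat.card Q.UpEdge := by
    rw [Nat.card_eq_fintype_card, Fintype.card_subtype]
  have h2 : #{d : W × W | Q.Adj d.1 d.2 ∧ d.2 < d.1} = Nat.card Q.UpEdge := by
    rw [← h1]
    refine Finset.card_bij (fun d _ => d.swap) ?_ ?_ ?_
    · rintro ⟨a, b⟩ h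
      simp only [mem_filter, mem_univ, true_and, Prod.swap_prod_mk] at h ⊢
      exact ⟨h.1.symm, h.2⟩
    · rintro ⟨a, b⟩ _ ⟨a', b'⟩ _ h
      simpa [and_comm] using h
    · rintro ⟨a, b⟩ h
      simp only [mem_filter, mem_univ, true_and] at h
      exact ⟨(b, a), by simpa using ⟨h.1.symm, h.2⟩, rfl⟩
  have h3 : ({d : W × W | Q.Adj d.1 d.2} : Finset (W × W)) =
      ({d : W × W | Q.Adj d.1 d.2 ∧ d.1 < d.2} : Finset (W × W)) ∪
      ({d : W × W | Q.Adj d.1 d.2 ∧ d.2 < d.1} : Finset (W × W)) := by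
    ext ⟨a, b⟩
    simp only [mem_filter, mem_univ, true_and, mem_union]
    constructor
    · intro h
      rcases lt_trichotomy a b with h' | h' | h'
      · exact Or.inl ⟨h, h'⟩
      · exact absurd h' h.ne
      · exact Or.inr ⟨h, h'⟩
    · rintro (h | h) <;> exact h.1
  rw [h3, Finset.card_union_of_disjoint, h1, h2, two_mul]
  rw [Finset.disjoint_left]
  rintro ⟨a, b⟩ hab hba
  simp only [mem_filter, mem_univ, true_and] at hab hba
  exact lt_asymm hab.2 hba.2

/-- Euler's inequality for a graph with an abstract dual in which every nonzero flow uses at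
least `g` edges. -/
theorem HasAbstractDual.euler [Nonempty W] (hQ : Q.HasAbstractDual) (g : ℕ)
    (hg : ∀ c, Q.IsFlow c → c ≠ 0 → 2 * g ≤ #{d : W × W | c d.1 d.2 ≠ 0}) :
    Nat.card Q.UpEdge + 1 ≤ Fintype.card W ∨
      g * (Nat.card Q.UpEdge + 2) ≤ 2 * Nat.card Q.UpEdge + g * Fintype.card W := by
  classical
  obtain ⟨N, left, ha, hb⟩ := hQ
  have hker := Q.finrank_ker_divUp
  set E := Nat.card Q.UpEdge with hE
  -- The darts that carry some flow, that is, the darts of edges that are not bridges. If there are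
  -- none, the graph is a forest and the first alternative holds.
  let D1 : Finset (W × W) := {d | ∃ c, Q.IsFlow c ∧ c d.1 d.2 ≠ 0}
  let L1 : Finset (Fin N) := D1.image fun d => left d.1 d.2
  have hD1 : ∀ {d : W × W}, d ∈ D1 ↔ ∃ c, Q.IsFlow c ∧ c d.1 d.2 ≠ 0 := by simp [D1]
  have hadj : ∀ {c}, Q.IsFlow c → ∀ {u v}, c u v ≠ 0 → Q.Adj u v := by
    intro c hc u v h
    by_contra h'
    exact h (hc.supp u v h')
  by_cases hD : D1.Nonempty
  swap
  · left
    have : LinearMap.ker Q.divUp = ⊥ := by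
      rw [LinearMap.ker_eq_bot']
      intro x hx
      funext e
      by_contra hne
      refine hD ⟨e.1, hD1.mpr ⟨_, Q.isFlow_extendUp x hx, ?_⟩⟩
      rwa [Q.extendUp_apply]
    rw [this, finrank_bot] at hker
    omega
  right
  have hL1 : L1.Nonempty := hD.image _
  -- the flow space has dimension less than the number of dual vertices
  let T : (L1 → ℝ) →ₗ[ℝ] (Q.UpEdge → ℝ) :=
    { toFun := fun φ e =>
        if h : e.1 ∈ D1 ∧ e.1.swap ∈ D1 then
          φ ⟨left e.1.1 e.1.2, mem_image_of_mem (fun d : W × W => left d.1 d.2) h.1⟩ -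
            φ ⟨left e.1.2 e.1.1, mem_image_of_mem (fun d : W × W => left d.1 d.2) h.2⟩
        else 0
      map_add' := fun φ ψ => by
        funext e
        simp only [Pi.add_apply]
        split_ifs <;> ring
      map_smul' := fun r φ => by
        funext e
        simp only [Pi.smul_apply, smul_eq_mul, RingHom.id_apply]
        split_ifs <;> ring }
  have hswap : ∀ {d : W × W}, d ∈ D1 → d.swap ∈ D1 := by
    intro d hd
    obtain ⟨c, hc, hne⟩ := hD1.mp hd
    refine hD1.mpr ⟨c, hc, ?_⟩
    rw [Prod.fst_swap, Prod.snd_swap, hc.antisymm]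
    exact neg_ne_zero.mpr hne
  have hT : LinearMap.ker Q.divUp ≤ LinearMap.range T := by
    intro x hx
    have hx' := Q.isFlow_extendUp x hx
    obtain ⟨φ, hφ⟩ := ha _ hx'
    refine ⟨fun l => φ l.1, ?_⟩
    funext e
    by_cases he : e.1 ∈ D1
    · have : e.1 ∈ D1 ∧ e.1.swap ∈ D1 := ⟨he, hswap he⟩
      change dite _ _ _ = _
      rw [dif_pos this, ← Q.extendUp_apply x e, hφ _ _ e.2.1]
    · have : ¬ (e.1 ∈ D1 ∧ e.1.swap ∈ D1) := fun h => he h.1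
      change dite _ _ _ = _
      rw [dif_neg this, ← Q.extendUp_apply x e]
      by_contra hne
      exact he (hD1.mpr ⟨_, hx', fun h => hne h.symm⟩)
  have hrank := LinearMap.finrank_range_add_finrank_ker T
  rw [Module.finrank_fintype_fun_eq_card, Fintype.card_coe] at hrank
  -- Constant potentials have no tension, which costs one dimension.
  have hkerT : 1 ≤ Module.finrank ℝ (LinearMap.ker T) := by
    have : Nontrivial (LinearMap.ker T) := by
      refine ⟨⟨⟨fun _ => 1, ?_⟩, 0, ?_⟩⟩
      · rw [LinearMap.mem_ker]
        funext e
        change dite _ _ _ = _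
        split_ifs <;> simp
      · intro h
        obtain ⟨l, hl⟩ := hL1
        have := congrFun (congrArg Subtype.val h) ⟨l, hl⟩
        simp at this
    exact Module.finrank_pos
  have hle := Submodule.finrank_mono hT
  -- every dual vertex meets at least `g` edges
  have hclass : ∀ l ∈ L1, g ≤ #{d ∈ D1 | left d.1 d.2 = l} := by
    intro l hl
    obtain ⟨⟨u, v⟩, hd, rfl⟩ := mem_image.mp hl
    simp only
    -- The tension of the indicator of one dual vertex is the boundary of that face. It is a flow,
    -- and it is nonzero because an edge that carries flow has different dual vertices on its two
    -- sides.
    let φ : Fin N → ℝ := fun k => if k = left u v then 1 else 0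
    let b : W → W → ℝ := fun u v => if Q.Adj u v then φ (left u v) - φ (left v u) else 0
    have hbf : Q.IsFlow b :=
      ⟨fun u v => by simp only [b, Q.adj_comm v u]; split_ifs <;> ring,
        fun u v h => by simp [b, h], fun u => by
          rw [← hb φ u]⟩
    obtain ⟨c, hc, hne⟩ := hD1.mp hd
    have huv := hadj hc hne
    have hlr : left v u ≠ left u v := by
      intro h
      obtain ⟨ψ, hψ⟩ := ha c hc
      apply hne
      simp only
      rw [hψ u v huv, h, sub_self]
    have hb0 : b ≠ 0 := by
      intro h
      have := congrFun (congrFun h u) v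
      simp [b, huv, φ, hlr] at this
    have h1 := hg b hbf hb0
    let F : Finset (W × W) := {d ∈ D1 | left d.1 d.2 = left u v}
    -- Each dart of the boundary, or its reverse, has the chosen dual vertex on its left, so the
    -- `2g` darts give at least `g` elements of `F`.
    have h2 : ({d : W × W | b d.1 d.2 ≠ 0} : Finset (W × W)) ⊆ F ∪ F.image Prod.swap := by
      rintro ⟨a, a'⟩ h
      simp only [mem_filter, mem_univ, true_and] at h
      have hmem : (a, a') ∈ D1 := hD1.mpr ⟨b, hbf, h⟩
      rw [mem_union]
      by_cases h1 : left a a' = left u v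
      · exact Or.inl (mem_filter.mpr ⟨hmem, h1⟩)
      · right
        refine mem_image.mpr ⟨(a', a), mem_filter.mpr ⟨hswap hmem, ?_⟩, rfl⟩
        by_contra h2
        apply h
        simp only at h2
        simp [b, φ, h1, h2]
    have h3 := (Finset.card_le_card h2).trans (Finset.card_union_le _ _)
    have h4 : #(F.image Prod.swap) ≤ #F := Finset.card_image_le
    change g ≤ #F
    omega
  have hsum : #L1 * g ≤ #D1 := by
    rw [Finset.card_eq_sum_card_fiberwise (f := fun d : W × W => left d.1 d.2) (t := L1)
      (fun d hd => mem_image_of_mem (fun d : W × W => left d.1 d.2) hd)]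
    simpa using Finset.card_nsmul_le_sum L1 _ g hclass
  have hDE : #D1 ≤ 2 * E := by
    rw [hE, ← Q.card_darts, Nat.card_eq_fintype_card, Fintype.card_subtype]
    refine Finset.card_le_card fun d hd => ?_
    obtain ⟨c, hc, hne⟩ := hD1.mp hd
    simpa using hadj hc hne
  -- The flow space has dimension at least `E + 1 - |W|` and at most `#L1 - 1`.
  have hfin : E + 2 ≤ #L1 + Fintype.card W := by omega
  calc g * (E + 2) ≤ g * (#L1 + Fintype.card W) := Nat.mul_le_mul_left _ hfin
    _ = #L1 * g + g * Fintype.card W := by ring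
    _ ≤ _ := by omega

end Euler

end SimpleGraph

/-! ### Edge bounds, and abstract duals of minors. -/

namespace SimpleGraph

variable {V : Type*} {W : Type*}

theorem IsFlow.exists_ne [Fintype V] {G : SimpleGraph V} {c : V → V → ℝ} (hc : G.IsFlow c)
    {v u : V} (h : c v u ≠ 0) : ∃ x, x ≠ u ∧ c v x ≠ 0 := by
  by_contra! hcon
  apply h
  rw [← hc.div v, Finset.sum_eq_single u (fun x _ hx => hcon x hx) (by simp)]

theorem IsFlow.swap_ne_zero [Fintype V] {G : SimpleGraph V} {c : V → V → ℝ} (hc : G.IsFlow c)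
    {v u : V} (h : c v u ≠ 0) : c u v ≠ 0 := by
  rw [hc.antisymm v u]
  exact neg_ne_zero.mpr h

theorem IsFlow.adj [Fintype V] {G : SimpleGraph V} {c : V → V → ℝ} (hc : G.IsFlow c)
    {v u : V} (h : c v u ≠ 0) : G.Adj v u := by
  by_contra h'
  exact h (hc.supp v u h')

/-- By conservation a flow cannot stop at a vertex: an edge `uv` of it continues beyond `u` and
beyond `v`. These three edges are distinct even if the outer ends coincide, and each counts for two
darts. -/
theorem IsFlow.six_le_card [Fintype V] {G : SimpleGraph V} {c : V → V → ℝ} (hc : G.IsFlow c)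
    (h0 : c ≠ 0) : 2 * 3 ≤ #{d : V × V | c d.1 d.2 ≠ 0} := by
  classical
  obtain ⟨u, v, huv⟩ : ∃ u v, c u v ≠ 0 := by
    by_contra! h
    exact h0 (funext fun u => funext fun v => h u v)
  have hvu := hc.swap_ne_zero huv
  obtain ⟨x, hxu, hvx⟩ := hc.exists_ne hvu
  obtain ⟨y, hyv, huy⟩ := hc.exists_ne huv
  have h1 := (hc.adj huv).ne
  have h2 := (hc.adj hvx).ne
  have h3 := (hc.adj huy).ne
  have hsub : ({(u, v), (v, u), (v, x), (x, v), (u, y), (y, u)} : Finset (V × V)) ⊆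
      ({d : V × V | c d.1 d.2 ≠ 0} : Finset (V × V)) := by
    intro d hd
    simp only [mem_insert, mem_singleton] at hd
    rw [mem_filter]
    refine ⟨mem_univ _, ?_⟩
    rcases hd with rfl | rfl | rfl | rfl | rfl | rfl
    exacts [huv, hvu, hvx, hc.swap_ne_zero hvx, huy, hc.swap_ne_zero huy]
  refine le_trans (le_of_eq ?_) (card_le_card hsub)
  rw [card_insert_of_notMem, card_insert_of_notMem, card_insert_of_notMem, card_insert_of_notMem,
    card_insert_of_notMem, card_singleton]
  all_goals simp [Prod.ext_iff]
  all_goals grind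

/-- Without triangles the two outer ends `x` and `y` differ, and the continuation beyond `x` is a
fourth edge, which cannot return to `u`. -/
theorem IsFlow.eight_le_card [Fintype V] {G : SimpleGraph V} {c : V → V → ℝ} (hc : G.IsFlow c)
    (htri : ∀ a b d, G.Adj a b → G.Adj b d → ¬ G.Adj a d)
    (h0 : c ≠ 0) : 2 * 4 ≤ #{d : V × V | c d.1 d.2 ≠ 0} := by
  classical
  obtain ⟨u, v, huv⟩ : ∃ u v, c u v ≠ 0 := by
    by_contra! h
    exact h0 (funext fun u => funext fun v => h u v)
  have hvu := hc.swap_ne_zero huv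
  obtain ⟨x, hxu, hvx⟩ := hc.exists_ne hvu
  obtain ⟨y, hyv, huy⟩ := hc.exists_ne huv
  obtain ⟨z, hzv, hxz⟩ := hc.exists_ne (hc.swap_ne_zero hvx)
  have h1 := (hc.adj huv).ne
  have h2 := (hc.adj hvx).ne
  have h3 := (hc.adj huy).ne
  have h4 := (hc.adj hxz).ne
  have hxy : x ≠ y := by
    rintro rfl
    exact htri _ _ _ (hc.adj huv) (hc.adj hvx) (hc.adj huy)
  have hzu : z ≠ u := by
    rintro rfl
    exact htri _ _ _ (hc.adj huv) (hc.adj hvx) (hc.adj hxz).symm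
  have hsub : ({(u, v), (v, u), (v, x), (x, v), (u, y), (y, u), (x, z), (z, x)} :
      Finset (V × V)) ⊆ ({d : V × V | c d.1 d.2 ≠ 0} : Finset (V × V)) := by
    intro d hd
    simp only [mem_insert, mem_singleton] at hd
    rw [mem_filter]
    refine ⟨mem_univ _, ?_⟩
    rcases hd with rfl | rfl | rfl | rfl | rfl | rfl | rfl | rfl
    exacts [huv, hvu, hvx, hc.swap_ne_zero hvx, huy, hc.swap_ne_zero huy, hxz,
      hc.swap_ne_zero hxz]
  refine le_trans (le_of_eq ?_) (card_le_card hsub)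
  rw [card_insert_of_notMem, card_insert_of_notMem, card_insert_of_notMem, card_insert_of_notMem,
    card_insert_of_notMem, card_insert_of_notMem, card_insert_of_notMem, card_singleton]
  all_goals simp [Prod.ext_iff]
  all_goals grind

theorem HasAbstractDual.card_darts_le [Fintype W] {Q : SimpleGraph W} (hQ : Q.HasAbstractDual)
    (hW : 3 ≤ Fintype.card W) :
    Nat.card {d : W × W // Q.Adj d.1 d.2} + 12 ≤ 6 * Fintype.card W := by
  classical
  let _ : LinearOrder W := LinearOrder.lift' (Fintype.equivFin W) (Fintype.equivFin W).injective
  have : Nonempty W := Fintype.card_pos_iff.mp (by omega)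
  rw [card_darts]
  rcases hQ.euler Q 3 (fun c hc h0 => hc.six_le_card h0) with h | h <;> omega

theorem HasAbstractDual.card_darts_le_of_triangleFree [Fintype W] {Q : SimpleGraph W}
    (hQ : Q.HasAbstractDual) (hW : 3 ≤ Fintype.card W)
    (htri : ∀ a b d, Q.Adj a b → Q.Adj b d → ¬ Q.Adj a d) :
    Nat.card {d : W × W // Q.Adj d.1 d.2} + 8 ≤ 4 * Fintype.card W := by
  classical
  let _ : LinearOrder W := LinearOrder.lift' (Fintype.equivFin W) (Fintype.equivFin W).injective
  have : Nonempty W := Fintype.card_pos_iff.mp (by omega)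
  rw [card_darts]
  rcases hQ.euler Q 4 (fun c hc h0 => hc.eight_le_card htri h0) with h | h <;> omega

section Demand

variable [Fintype V]

-- Each step of the walk contributes one unit from its start to its end; repeated steps add up and
-- backtracking cancels.
open Classical in
theorem exists_path_flow {G : SimpleGraph V} {S : Set V} {u v : V}
    (h : Relation.ReflTransGen (fun a b => G.Adj a b ∧ a ∈ S ∧ b ∈ S) u v) :
    ∃ c : V → V → ℝ, (∀ a b, c b a = -c a b) ∧
      (∀ a b, c a b ≠ 0 → G.Adj a b ∧ a ∈ S ∧ b ∈ S) ∧
      ∀ x, ∑ y, c x y = (if x = u then 1 else 0) - (if x = v then 1 else 0) := by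
  induction h with
  | refl => exact ⟨fun _ _ => 0, by simp, by simp, by simp⟩
  | @tail b b' _ hbb' ih =>
    obtain ⟨c, h1, h2, h3⟩ := ih
    have hne : b ≠ b' := hbb'.1.ne
    refine ⟨fun x y => c x y + ((if x = b ∧ y = b' then 1 else 0) -
      (if x = b' ∧ y = b then 1 else 0)), ?_, ?_, ?_⟩
    · intro x y
      simp only
      simp only [h1 x y, and_comm (a := y = b), and_comm (a := y = b')]
      ring
    · intro x y hxy
      by_cases hc : c x y ≠ 0
      · exact h2 x y hc
      · rw [not_not] at hc
        by_cases hx : x = b ∧ y = b'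
        · rw [hx.1, hx.2]; exact hbb'
        · by_cases hx' : x = b' ∧ y = b
          · rw [hx'.1, hx'.2]; exact ⟨hbb'.1.symm, hbb'.2.2, hbb'.2.1⟩
          · simp [hc, hx, hx'] at hxy
    · intro x
      rw [Finset.sum_add_distrib, h3, Finset.sum_sub_distrib]
      have e1 : ∀ p q : V, ∑ y, (if x = p ∧ y = q then (1 : ℝ) else 0) =
          if x = p then 1 else 0 := by
        intro p q
        by_cases hp : x = p <;> simp [hp]
      rw [e1, e1]
      ring

/-- The demand of each vertex is sent along a walk to one fixed vertex `s`, where everything cancels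
because the demands have sum zero. -/
theorem ConnOn.exists_flow {G : SimpleGraph V} {S : Set V} (hS : G.ConnOn S) (d : V → ℝ)
    (hd : ∀ v, v ∉ S → d v = 0) (hsum : ∑ v, d v = 0) :
    ∃ c : V → V → ℝ, (∀ a b, c b a = -c a b) ∧
      (∀ a b, c a b ≠ 0 → G.Adj a b ∧ a ∈ S ∧ b ∈ S) ∧ ∀ x, ∑ y, c x y = d x := by
  classical
  rcases S.eq_empty_or_nonempty with rfl | ⟨s, hs⟩
  · exact ⟨fun _ _ => 0, by simp, by simp, fun x => by simp [hd x]⟩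
  have key : ∀ v, ∃ c : V → V → ℝ, (∀ a b, c b a = -c a b) ∧
      (∀ a b, c a b ≠ 0 → G.Adj a b ∧ a ∈ S ∧ b ∈ S) ∧ (v ∈ S → ∀ x, ∑ y, c x y =
        (if x = v then 1 else 0) - (if x = s then 1 else 0)) := by
    intro v
    by_cases hv : v ∈ S
    · obtain ⟨c, h1, h2, h3⟩ := exists_path_flow (hS v hv s hs)
      exact ⟨c, h1, h2, fun _ => h3⟩
    · exact ⟨fun _ _ => 0, by simp, by simp, fun h => absurd h hv⟩
  choose c h1 h2 h3 using key
  refine ⟨fun a b => ∑ v, d v * c v a b, ?_, ?_, ?_⟩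
  · intro a b
    simp only
    rw [← Finset.sum_neg_distrib]
    refine Finset.sum_congr rfl fun v _ => ?_
    rw [h1 v a b]; ring
  · intro a b hab
    obtain ⟨v, _, hv⟩ := Finset.exists_ne_zero_of_sum_ne_zero hab
    exact h2 v a b (right_ne_zero_of_mul hv)
  · intro x
    simp only
    rw [Finset.sum_comm]
    have : ∀ v, ∑ y, d v * c v x y =
        d v * (if x = v then 1 else 0) - d v * (if x = s then 1 else 0) := by
      intro v
      rw [← Finset.mul_sum]
      by_cases hv : v ∈ S
      · rw [h3 v hv]; ring
      · simp [hd v hv]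
    simp only [this, Finset.sum_sub_distrib, ← Finset.sum_mul, hsum]
    simp

end Demand

theorem sum_sum_eq_zero_of_antisymm [DecidableEq V] (S : Finset V) (c : V → V → ℝ)
    (hc : ∀ a b, c b a = -c a b) : ∑ a ∈ S, ∑ b ∈ S, c a b = 0 := by
  have h : ∑ a ∈ S, ∑ b ∈ S, c a b = ∑ a ∈ S, ∑ b ∈ S, -c a b := by
    rw [Finset.sum_comm]
    exact Finset.sum_congr rfl fun u _ => Finset.sum_congr rfl fun v _ => hc u v
  simp only [Finset.sum_neg_distrib] at h
  linarith

/-- If all subgraphs of `G` have an abstract dual, then so have its minors. -/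
theorem HasAbstractDual.of_isMinorOf [Fintype V] [Fintype W] {G : SimpleGraph V}
    (hG : ∀ H ≤ G, H.HasAbstractDual) {Q : SimpleGraph W} (hQ : Q.IsMinorOf G) :
    Q.HasAbstractDual := by
  classical
  obtain ⟨B, hdisj, hconn, hadj⟩ := hQ
  let _ : LinearOrder W := LinearOrder.lift' (Fintype.equivFin W) (Fintype.equivFin W).injective
  rcases isEmpty_or_nonempty V with hV | hV
  · have hno : ∀ w w', ¬ Q.Adj w w' := fun w w' h => hV.elim (hadj w w' h).choose
    exact ⟨1, fun _ _ => 0, fun c _ => ⟨0, fun u v h => absurd h (hno u v)⟩, fun _ _ => by simp⟩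
  -- One edge of `G` represents each edge of `Q`. The order on `W` decides which choice is used, so
  -- that both directions get the same edge.
  obtain ⟨rep, hrep, hrepadj⟩ : ∃ rep : W → W → V, (∀ w w', Q.Adj w w' → rep w w' ∈ B w) ∧
      ∀ w w', Q.Adj w w' → G.Adj (rep w w') (rep w' w) := by
    choose! f hf g hg hfg using hadj
    refine ⟨fun w w' => if w < w' then f w w' else g w' w, ?_, ?_⟩
    · intro w w' h
      simp only
      split_ifs
      · exact hf w w' h
      · exact hg w' w h.symm
    · intro w w' h
      rcases lt_or_gt_of_ne h.ne with h' | h'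
      · simp only [h', not_lt.mpr h'.le, if_true, if_false]
        exact hfg w w' h
      · simp only [h', not_lt.mpr h'.le, if_true, if_false]
        exact (hfg w' w h.symm).symm
  have hBuniq : ∀ {w w' x}, x ∈ B w → x ∈ B w' → w = w' := by
    intro w w' x h h'
    by_contra hne
    exact Set.disjoint_left.mp (hdisj w w' hne) h h'
  -- Only edges inside branch sets and representing edges are kept. Other edges between branch sets
  -- would carry flow invisible in `Q`; this is why all subgraphs of `G` are assumed to have duals.
  let H : SimpleGraph V :=
    { Adj := fun a b => G.Adj a b ∧ ((∃ w, a ∈ B w ∧ b ∈ B w) ∨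
        ∃ w w', Q.Adj w w' ∧ a = rep w w' ∧ b = rep w' w)
      symm := ⟨by
        rintro a b ⟨h, ⟨w, h1, h2⟩ | ⟨w, w', h1, h2, h3⟩⟩
        · exact ⟨h.symm, Or.inl ⟨w, h2, h1⟩⟩
        · exact ⟨h.symm, Or.inr ⟨w', w, h1.symm, h3, h2⟩⟩⟩
      loopless := ⟨fun a h => G.loopless.irrefl a h.1⟩ }
  have hHrep : ∀ {w w'}, Q.Adj w w' → H.Adj (rep w w') (rep w' w) := fun h =>
    ⟨hrepadj _ _ h, Or.inr ⟨_, _, h, rfl, rfl⟩⟩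
  obtain ⟨N, left, ha, hb⟩ := hG H fun a b h => h.1
  let BF : W → Finset V := fun w => {v | v ∈ B w}
  have hBF : ∀ {w v}, v ∈ BF w ↔ v ∈ B w := by simp [BF]
  -- the flow leaving a branch set
  have hout : ∀ (c : V → V → ℝ), (∀ a b, c b a = -c a b) → (∀ a b, ¬ H.Adj a b → c a b = 0) →
      ∀ w, ∑ a ∈ BF w, ∑ b, c a b =
        ∑ w', if Q.Adj w w' then c (rep w w') (rep w' w) else 0 := by
    intro c hc1 hc2 w
    have e1 : ∑ a ∈ BF w, ∑ b, c a b = ∑ a ∈ BF w, ∑ b ∈ (BF w)ᶜ, c a b := by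
      have h0 := sum_sum_eq_zero_of_antisymm (BF w) c hc1
      have : ∀ a, ∑ b, c a b = ∑ b ∈ BF w, c a b + ∑ b ∈ (BF w)ᶜ, c a b := fun a =>
        (Finset.sum_add_sum_compl _ _).symm
      simp only [this, Finset.sum_add_distrib, h0, zero_add]
    rw [e1, ← Finset.sum_product', ← Finset.sum_filter]
    symm
    refine Finset.sum_of_injOn (fun w' => (rep w w', rep w' w)) ?_ ?_ ?_ ?_
    · intro w1 h1 w2 h2 h12
      simp only [coe_filter, mem_univ, true_and, Set.mem_ofPred_eq] at h1 h2
      have e := (Prod.ext_iff.mp h12).2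
      simp only at e
      exact hBuniq (hrep _ _ h1.symm) (e ▸ hrep _ _ h2.symm)
    · intro w1 h1
      simp only [coe_filter, mem_univ, true_and, Set.mem_ofPred_eq] at h1
      rw [Finset.mem_coe, mem_product, mem_compl, hBF, hBF]
      exact ⟨hrep _ _ h1, fun h => h1.ne (hBuniq h (hrep _ _ h1.symm))⟩
    · rintro ⟨a, b⟩ hab hnot
      rw [mem_product, mem_compl, hBF, hBF] at hab
      apply hc2
      rintro ⟨_, ⟨w1, h1, h2⟩ | ⟨w1, w2, h1, h2, h3⟩⟩
      · have := hBuniq hab.1 h1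
        subst this
        exact hab.2 h2
      · simp only at h2 h3 hab
        have : w = w1 := hBuniq hab.1 (h2 ▸ hrep _ _ h1)
        subst this
        apply hnot
        refine ⟨w2, by simpa using h1, ?_⟩
        simp only
        rw [h2, h3]
    · intro w' _
      rfl
  refine ⟨N, fun w w' => left (rep w w') (rep w' w), ?_, ?_⟩
  · intro c hc
    -- lift the flow to `H`
    let c0 : V → V → ℝ := fun a b => ∑ w, ∑ w',
      if Q.Adj w w' ∧ a = rep w w' ∧ b = rep w' w then c w w' else 0
    have hc0rep : ∀ {w w'}, Q.Adj w w' → c0 (rep w w') (rep w' w) = c w w' := by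
      intro w w' h
      simp only [c0]
      rw [Finset.sum_eq_single w, Finset.sum_eq_single w']
      · simp [h]
      · intro w1 _ h1
        rw [if_neg]
        rintro ⟨h2, _, h3⟩
        exact h1 (hBuniq (hrep _ _ h2.symm) (h3 ▸ hrep _ _ h.symm))
      · simp
      · intro w1 _ h1
        refine Finset.sum_eq_zero fun w2 _ => ?_
        rw [if_neg]
        rintro ⟨h2, h3, _⟩
        exact h1 (hBuniq (hrep _ _ h2) (h3 ▸ hrep _ _ h))
      · simp
    have hc0anti : ∀ a b, c0 b a = -c0 a b := by
      intro a b
      simp only [c0]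
      rw [Finset.sum_comm, ← Finset.sum_neg_distrib]
      refine Finset.sum_congr rfl fun w _ => ?_
      rw [← Finset.sum_neg_distrib]
      refine Finset.sum_congr rfl fun w' _ => ?_
      by_cases h : Q.Adj w w' ∧ a = rep w w' ∧ b = rep w' w
      · rw [if_pos h, if_pos ⟨h.1.symm, h.2.2, h.2.1⟩, hc.antisymm]
      · rw [if_neg h, if_neg fun h' => h ⟨h'.1.symm, h'.2.2, h'.2.1⟩, neg_zero]
    have hc0supp : ∀ a b, c0 a b ≠ 0 → ∃ w w', Q.Adj w w' ∧ a = rep w w' ∧ b = rep w' w := by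
      intro a b h
      obtain ⟨w, _, h⟩ := Finset.exists_ne_zero_of_sum_ne_zero h
      obtain ⟨w', _, h⟩ := Finset.exists_ne_zero_of_sum_ne_zero h
      exact ⟨w, w', by by_contra h'; exact h (if_neg h')⟩
    have hc0H : ∀ a b, ¬ H.Adj a b → c0 a b = 0 := by
      intro a b h
      by_contra h'
      obtain ⟨w, w', h1, rfl, rfl⟩ := hc0supp a b h'
      exact h (hHrep h1)
    have hHS : ∀ w, H.ConnOn (B w) := by
      intro w u hu v hv
      exact Relation.ReflTransGen.mono (fun a b h => ⟨⟨h.1, Or.inl ⟨w, h.2⟩⟩, h.2⟩) _ _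
        (hconn w u hu v hv)
    -- The lifted flow is balanced on each branch set as a whole but not at its vertices.
    -- Connectedness allows the imbalance to be evened out inside the set, without touching
    -- representing edges.
    have hfl : ∀ w, ∃ f : V → V → ℝ, (∀ a b, f b a = -f a b) ∧
        (∀ a b, f a b ≠ 0 → H.Adj a b ∧ a ∈ B w ∧ b ∈ B w) ∧
        ∀ x, ∑ y, f x y = if x ∈ B w then -∑ y, c0 x y else 0 := by
      intro w
      refine (hHS w).exists_flow _ (fun v hv => if_neg hv) ?_
      rw [← Finset.sum_filter, Finset.sum_neg_distrib]
      change -∑ a ∈ BF w, ∑ y, c0 a y = 0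
      rw [hout c0 hc0anti hc0H, neg_eq_zero]
      refine Eq.trans ?_ (hc.div w)
      refine Finset.sum_congr rfl fun w' _ => ?_
      split_ifs with h
      · exact hc0rep h
      · exact (hc.supp _ _ h).symm
    choose f hf1 hf2 hf3 using hfl
    have hflow : H.IsFlow fun a b => c0 a b + ∑ w, f w a b := by
      refine ⟨?_, ?_, ?_⟩
      · intro a b
        rw [hc0anti a b, Finset.sum_congr rfl fun w _ => hf1 w a b, Finset.sum_neg_distrib]
        ring
      · intro a b h
        rw [hc0H a b h, zero_add]
        refine Finset.sum_eq_zero fun w _ => ?_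
        by_contra h'
        exact h (hf2 w a b h').1
      · intro a
        rw [Finset.sum_add_distrib, Finset.sum_comm (f := fun b w => f w a b),
          Finset.sum_congr rfl fun w _ => hf3 w a]
        by_cases hex : ∃ w, a ∈ B w
        · obtain ⟨w, hw⟩ := hex
          rw [Finset.sum_eq_single w]
          · simp [hw]
          · intro w' _ h'
            rw [if_neg fun h => h' (hBuniq h hw)]
          · simp
        · have h1 : ∑ y, c0 a y = 0 := by
            refine Finset.sum_eq_zero fun b _ => ?_
            by_contra h'
            obtain ⟨w, w', h1, rfl, rfl⟩ := hc0supp a b h'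
            exact hex ⟨w, hrep _ _ h1⟩
          rw [h1, zero_add]
          refine Finset.sum_eq_zero fun w _ => if_neg fun h => hex ⟨w, h⟩
    obtain ⟨φ, hφ⟩ := ha _ hflow
    refine ⟨φ, fun w w' h => ?_⟩
    rw [← hφ _ _ (hHrep h), hc0rep h]
    rw [Finset.sum_eq_zero, add_zero]
    intro w1 _
    by_contra h'
    obtain ⟨_, h2, h3⟩ := hf2 _ _ _ h'
    exact h.ne ((hBuniq (hrep _ _ h) h2).trans (hBuniq h3 (hrep _ _ h.symm)))
  -- Conversely, the tension on `H` is a flow, so its total outflow from a branch set is zero, and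
  -- only representing edges leave the set.
  · intro φ w
    let c : V → V → ℝ := fun a b => if H.Adj a b then φ (left a b) - φ (left b a) else 0
    have h1 := hout c
      (fun a b => by simp only [c, H.adj_comm b a]; split_ifs <;> ring)
      (fun a b h => if_neg h) w
    have h0 : ∑ a ∈ BF w, ∑ b, c a b = 0 := Finset.sum_eq_zero fun a _ => by
      convert hb φ a
    refine Eq.trans ?_ (h1.symm.trans h0)
    refine Finset.sum_congr rfl fun w' _ => ?_
    split_ifs with h
    · simp only [c, if_pos (hHrep h)]
    · rfl

theorem ConnOn.iUnion_of {G : SimpleGraph V} {G' : SimpleGraph W} {S : Set V} (hS : G.ConnOn S)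
    {B : V → Set W} (hB : ∀ v, G'.ConnOn (B v))
    (hadj : ∀ u v, G.Adj u v → ∃ a ∈ B u, ∃ b ∈ B v, G'.Adj a b) :
    G'.ConnOn (⋃ v ∈ S, B v) := by
  have key : ∀ u v, Relation.ReflTransGen (fun a b => G.Adj a b ∧ a ∈ S ∧ b ∈ S) u v →
      u ∈ S → ∀ x ∈ B u, ∀ y ∈ B v, Relation.ReflTransGen
        (fun a b => G'.Adj a b ∧ a ∈ (⋃ v ∈ S, B v) ∧ b ∈ (⋃ v ∈ S, B v)) x y := by
    have hin : ∀ v ∈ S, ∀ x ∈ B v, ∀ y ∈ B v, Relation.ReflTransGen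
        (fun a b => G'.Adj a b ∧ a ∈ (⋃ v ∈ S, B v) ∧ b ∈ (⋃ v ∈ S, B v)) x y := by
      intro v hv x hx y hy
      refine Relation.ReflTransGen.mono (fun a b h => ?_) _ _ (hB v x hx y hy)
      exact ⟨h.1, Set.mem_biUnion hv h.2.1, Set.mem_biUnion hv h.2.2⟩
    intro u v huv hu x hx
    induction huv with
    | refl => exact fun y hy => hin u hu x hx y hy
    | @tail b b' _ hbb' ih =>
      intro y hy
      obtain ⟨a, ha, a', ha', haa'⟩ := hadj _ _ hbb'.1
      refine ((ih a ha).tail ⟨haa', ?_, ?_⟩).trans (hin b' hbb'.2.2 a' ha' y hy)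
      · exact Set.mem_biUnion hbb'.2.1 ha
      · exact Set.mem_biUnion hbb'.2.2 ha'
  intro x hx y hy
  obtain ⟨u, hu, hx⟩ := Set.mem_iUnion₂.mp hx
  obtain ⟨v, hv, hy⟩ := Set.mem_iUnion₂.mp hy
  exact key u v (hS u hu v hv) hu x hx y hy

theorem IsMinorOf.trans {U : Type*} {Q : SimpleGraph U} {G : SimpleGraph V} {G' : SimpleGraph W}
    (h1 : Q.IsMinorOf G) (h2 : G.IsMinorOf G') : Q.IsMinorOf G' := by
  obtain ⟨B, hB1, hB2, hB3⟩ := h1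
  obtain ⟨C, hC1, hC2, hC3⟩ := h2
  refine ⟨fun u => ⋃ v ∈ B u, C v, ?_, ?_, ?_⟩
  · intro u u' hne
    rw [Set.disjoint_left]
    intro x hx hx'
    obtain ⟨v, hv, hx⟩ := Set.mem_iUnion₂.mp hx
    obtain ⟨v', hv', hx'⟩ := Set.mem_iUnion₂.mp hx'
    by_cases h : v = v'
    · subst h
      exact Set.disjoint_left.mp (hB1 u u' hne) hv hv'
    · exact Set.disjoint_left.mp (hC1 v v' h) hx hx'
  · exact fun u => (hB2 u).iUnion_of hC2 hC3
  · intro u u' h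
    obtain ⟨v, hv, v', hv', hvv'⟩ := hB3 u u' h
    obtain ⟨a, ha, a', ha', haa'⟩ := hC3 v v' hvv'
    exact ⟨a, Set.mem_biUnion hv ha, a', Set.mem_biUnion hv' ha', haa'⟩

end SimpleGraph

/-! ### The angle under which a segment is seen. -/

section Winding

open Complex Filter Topology

/-- The angle under which the segment from `a` to `b` is seen from `q`. -/
noncomputable def viewAngle (q a b : ℂ) : ℝ := arg ((b - q) / (a - q))

theorem coe_viewAngle {q a b : ℂ} (ha : a ≠ q) (hb : b ≠ q) :
    ((viewAngle q a b : ℝ) : Real.Angle) = (arg (b - q) : Real.Angle) - (arg (a - q) : ℝ) :=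
  arg_div_coe_angle (sub_ne_zero.mpr hb) (sub_ne_zero.mpr ha)

theorem coe_viewAngle_eq {q q₀ a b : ℂ} (ha : a ≠ q) (hb : b ≠ q) (ha₀ : a ≠ q₀) (hb₀ : b ≠ q₀) :
    ((viewAngle q a b : ℝ) : Real.Angle) =
      ((viewAngle q₀ a b + (arg ((b - q) / (b - q₀)) - arg ((a - q) / (a - q₀))) : ℝ) :
        Real.Angle) := by
  rw [Real.Angle.coe_add, Real.Angle.coe_sub, coe_viewAngle ha hb, coe_viewAngle ha₀ hb₀,
    arg_div_coe_angle (sub_ne_zero.mpr hb) (sub_ne_zero.mpr hb₀),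
    arg_div_coe_angle (sub_ne_zero.mpr ha) (sub_ne_zero.mpr ha₀)]
  abel

theorem tendsto_arg_div {q₀ b : ℂ} (hb : b ≠ q₀) :
    Tendsto (fun q => arg ((b - q) / (b - q₀))) (𝓝 q₀) (𝓝 0) := by
  have h0 : b - q₀ ≠ 0 := sub_ne_zero.mpr hb
  have h1 : Tendsto (fun q : ℂ => (b - q) / (b - q₀)) (𝓝 q₀) (𝓝 1) := by
    have : ContinuousAt (fun q : ℂ => (b - q) / (b - q₀)) q₀ := by fun_prop
    have h2 := this.tendsto
    simp only [div_self h0] at h2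
    exact h2
  rw [← arg_one]
  exact (continuousAt_arg (x := 1) (by simp)).tendsto.comp h1

theorem viewAngle_eq_pi_iff {q a b : ℂ} (ha : a ≠ q) (hb : b ≠ q) :
    viewAngle q a b = Real.pi ↔ q ∈ segment ℝ a b := by
  have ha' := sub_ne_zero.mpr ha
  have hb' := sub_ne_zero.mpr hb
  rw [viewAngle, arg_eq_pi_iff]
  constructor
  · rintro ⟨h1, h2⟩
    set z := (b - q) / (a - q) with hz
    have hzr : z = (z.re : ℂ) := by
      apply Complex.ext <;> simp [h2]
    have hb2 : b - q = (z.re : ℂ) * (a - q) := by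
      rw [← hzr, hz, div_mul_cancel₀ _ ha']
    set r := z.re
    have hr : (1 - r) ≠ 0 := by linarith
    have hrc : (1 - (r : ℂ)) ≠ 0 := by exact_mod_cast hr
    refine ⟨-r / (1 - r), 1 / (1 - r), div_nonneg (by linarith) (by linarith),
      div_nonneg zero_le_one (by linarith), by field_simp; ring, ?_⟩
    simp only [real_smul]
    push_cast
    field_simp
    linear_combination hb2
  · rintro ⟨s, t, hs, ht, hst, h⟩
    simp only [real_smul] at h
    have hs' : s = 1 - t := by linarith
    subst hs'
    push_cast at h
    have ht0 : t ≠ 0 := by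
      rintro rfl
      apply ha; rw [← h]; simp
    have ht1 : t ≠ 1 := by
      rintro rfl
      apply hb; rw [← h]; simp
    have htc : (t : ℂ) ≠ 0 := by exact_mod_cast ht0
    have hz : (b - q) / (a - q) = ((-(1 - t) / t : ℝ) : ℂ) := by
      rw [div_eq_iff ha']
      push_cast
      field_simp
      linear_combination h
    rw [hz]
    refine ⟨?_, ofReal_im _⟩
    rw [ofReal_re]
    have h1 : 0 < t := lt_of_le_of_ne ht (Ne.symm ht0)
    have h2 : t < 1 := lt_of_le_of_ne (by linarith) ht1
    exact div_neg_of_neg_of_pos (by linarith) h1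

/-- Modulo `2π` this always holds. Off the segment the angle at `q₀` is strictly between `-π` and
`π`, so nearby both sides stay in the range of `arg` and no multiple of `2π` can appear. -/
theorem viewAngle_eventually_eq {q₀ a b : ℂ} (h : q₀ ∉ segment ℝ a b) :
    ∀ᶠ q in 𝓝 q₀, viewAngle q a b =
      viewAngle q₀ a b + (arg ((b - q) / (b - q₀)) - arg ((a - q) / (a - q₀))) := by
  have ha : a ≠ q₀ := by rintro rfl; exact h (left_mem_segment ℝ _ _)
  have hb : b ≠ q₀ := by rintro rfl; exact h (right_mem_segment ℝ _ _)
  have hlt : viewAngle q₀ a b < Real.pi :=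
    lt_of_le_of_ne (arg_le_pi _) fun h' => h ((viewAngle_eq_pi_iff ha hb).mp h')
  have hgt : -Real.pi < viewAngle q₀ a b := neg_pi_lt_arg _
  have htend : Tendsto (fun q => viewAngle q₀ a b +
      (arg ((b - q) / (b - q₀)) - arg ((a - q) / (a - q₀)))) (𝓝 q₀) (𝓝 (viewAngle q₀ a b)) := by
    simpa using ((tendsto_arg_div hb).sub (tendsto_arg_div ha)).const_add (viewAngle q₀ a b)
  filter_upwards [htend.eventually (lt_mem_nhds hgt), htend.eventually (gt_mem_nhds hlt),
    isOpen_ne.mem_nhds ha.symm, isOpen_ne.mem_nhds hb.symm] with q h1 h2 h3 h4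
  have h5 := coe_viewAngle_eq (Ne.symm h3) (Ne.symm h4) ha hb
  rw [← Real.Angle.toReal_coe_eq_self_iff.mpr ⟨h1, h2.le⟩, ← h5,
    Real.Angle.toReal_coe_eq_self_iff (θ := viewAngle q a b).mpr ⟨neg_pi_lt_arg _, arg_le_pi _⟩]

theorem viewAngle_swap {q a b : ℂ} (h : viewAngle q a b ≠ Real.pi) :
    viewAngle q b a = -viewAngle q a b := by
  have : viewAngle q b a = arg ((b - q) / (a - q))⁻¹ := by rw [viewAngle, inv_div]
  rw [this, arg_inv]
  exact if_neg h

theorem viewAngle_pos_of_left {q u v : ℂ} (huv : u ≠ v) (h : 0 < ((q - u) / (v - u)).im) :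
    0 < viewAngle q u v ∧ viewAngle q u v < Real.pi := by
  set s := (q - u) / (v - u) with hs
  have hvu : v - u ≠ 0 := sub_ne_zero.mpr huv.symm
  have hs0 : s ≠ 0 := by
    intro h0
    rw [h0] at h
    simp at h
  have hq : q = u + s * (v - u) := by
    rw [hs, div_mul_cancel₀ _ hvu]; ring
  have hratio : (v - q) / (u - q) = 1 - s⁻¹ := by
    have : u - q ≠ 0 := by
      rw [hq]
      simpa using ⟨hs0, hvu⟩
    rw [div_eq_iff this, hq]
    field_simp
    ring
  have him : 0 < ((v - q) / (u - q)).im := by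
    rw [hratio, sub_im, one_im, inv_im, zero_sub, neg_div, neg_neg]
    exact div_pos h (normSq_pos.mpr hs0)
  constructor
  · refine lt_of_le_of_ne (arg_nonneg_iff.mpr him.le) fun h0 => ?_
    have := (arg_eq_zero_iff.mp h0.symm).2
    exact him.ne' this
  · exact arg_lt_pi_iff.mpr (Or.inr him.ne')

/-- A point of the segment sees it under the angle `π`, on the branch cut of `arg`. To the left of
the segment the angle lies in `(0, π)`, so there it continues the value `π` instead of `-π`. -/
theorem viewAngle_eventually_eq_left {m u v : ℂ} (hm : m ∈ segment ℝ u v) (hu : u ≠ m)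
    (hv : v ≠ m) :
    ∀ᶠ q in 𝓝 m, 0 < ((q - u) / (v - u)).im → viewAngle q u v =
      Real.pi + (arg ((v - q) / (v - m)) - arg ((u - q) / (u - m))) := by
  have huv : u ≠ v := by
    rintro rfl
    rw [segment_same] at hm
    exact hu hm.symm
  have hpi : viewAngle m u v = Real.pi := (viewAngle_eq_pi_iff hu hv).mpr hm
  have htend : Tendsto (fun q => Real.pi + (arg ((v - q) / (v - m)) - arg ((u - q) / (u - m))))
      (𝓝 m) (𝓝 Real.pi) := by
    simpa using ((tendsto_arg_div hv).sub (tendsto_arg_div hu)).const_add Real.pi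
  filter_upwards [htend.eventually (lt_mem_nhds Real.pi_pos),
    htend.eventually (gt_mem_nhds (show Real.pi < 2 * Real.pi by linarith [Real.pi_pos])),
    isOpen_ne.mem_nhds hu.symm, isOpen_ne.mem_nhds hv.symm] with q h1 h2 h3 h4 hq
  have h5 := coe_viewAngle_eq (Ne.symm h3) (Ne.symm h4) hu hv
  rw [hpi, Real.Angle.angle_eq_iff_two_pi_dvd_sub] at h5
  obtain ⟨k, hk⟩ := h5
  obtain ⟨h6, h7⟩ := viewAngle_pos_of_left huv hq
  have hk1 : (-1 : ℝ) < k := by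
    by_contra hcon
    nlinarith [Real.pi_pos]
  have hk2 : (k : ℝ) < 1 := by
    by_contra hcon
    nlinarith [Real.pi_pos]
  have hk0 : k = 0 := by
    have h1 : (-1 : ℤ) < k := by exact_mod_cast hk1
    have h2 : k < (1 : ℤ) := by exact_mod_cast hk2
    omega
  rw [hk0] at hk
  push_cast at hk
  linarith

end Winding

/-! ### Winding numbers of flows in a straight drawing. -/

namespace SimpleGraph

variable {V : Type*}

/-- A drawing of `G` with straight edges. -/
structure IsStraightDrawing (G : SimpleGraph V) (pos : V → ℂ) : Prop where
  inj : Function.Injective pos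
  mem : ∀ u v w, G.Adj u v → pos w ∈ segment ℝ (pos u) (pos v) → w = u ∨ w = v
  inter : ∀ u v u' v', G.Adj u v → G.Adj u' v' → s(u, v) ≠ s(u', v') →
    ∀ z ∈ segment ℝ (pos u) (pos v), z ∈ segment ℝ (pos u') (pos v') →
      ∃ w, (w = u ∨ w = v) ∧ (w = u' ∨ w = v') ∧ z = pos w

theorem IsStraightDrawing.mono {G H : SimpleGraph V} {pos : V → ℂ} (h : G.IsStraightDrawing pos)
    (hH : H ≤ G) : H.IsStraightDrawing pos :=
  ⟨h.inj, fun u v w huv => h.mem u v w (hH huv),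
    fun u v u' v' h1 h2 => h.inter u v u' v' (hH h1) (hH h2)⟩

section

open Complex Filter Topology

variable {G : SimpleGraph V} {pos : V → ℂ} {c : V → V → ℝ}

theorem IsStraightDrawing.eq_of_mem_segment (hG : G.IsStraightDrawing pos) {u v a b : V}
    (huv : G.Adj u v) (hab : G.Adj a b) {m : ℂ} (hm : m ∈ segment ℝ (pos u) (pos v))
    (hmu : pos u ≠ m) (hmv : pos v ≠ m) (h : m ∈ segment ℝ (pos a) (pos b)) :
    (a = u ∧ b = v) ∨ (a = v ∧ b = u) := by
  by_contra hcon
  have hne : s(u, v) ≠ s(a, b) := by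
    intro h
    rw [Sym2.eq_iff] at h
    exact hcon (h.imp (fun h => ⟨h.1.symm, h.2.symm⟩) fun h => ⟨h.2.symm, h.1.symm⟩)
  obtain ⟨w, rfl | rfl, _, rfl⟩ := hG.inter u v a b huv hab hne m hm h
  · exact hmu rfl
  · exact hmv rfl

variable [Fintype V]

/-- The winding number (up to a factor `4π`) of a flow around the point `q`. -/
noncomputable def winding (pos : V → ℂ) (c : V → V → ℝ) (q : ℂ) : ℝ :=
  ∑ a, ∑ b, c a b * viewAngle q (pos a) (pos b)

/-- Flows are orthogonal to differences of vertex potentials. Hence the continuous changes of angle,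
which are such differences, do not affect winding numbers. -/
theorem IsFlow.sum_mul_sub (hc : G.IsFlow c) (β : V → ℝ) :
    ∑ a, ∑ b, c a b * (β b - β a) = 0 := by
  have h1 : ∑ a, ∑ b, c a b * β a = 0 := by
    refine Finset.sum_eq_zero fun a _ => ?_
    rw [← Finset.sum_mul, hc.div, zero_mul]
  have h2 : ∑ a, ∑ b, c a b * β b = 0 := by
    rw [Finset.sum_comm]
    refine Finset.sum_eq_zero fun b _ => ?_
    rw [← Finset.sum_mul]
    have : ∑ a, c a b = -∑ a, c b a := by
      rw [← Finset.sum_neg_distrib]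
      exact Finset.sum_congr rfl fun a _ => hc.antisymm b a
    rw [this, hc.div, neg_zero, zero_mul]
  simp only [mul_sub, Finset.sum_sub_distrib, h1, h2, sub_zero]

/-- Here `d` records the jumps of the angles; all the rest is the difference of a vertex potential
and sums to zero. -/
theorem IsFlow.winding_eq (hc : G.IsFlow c) {q q₀ : ℂ} (d : V → V → ℝ)
    (h : ∀ a b, G.Adj a b → viewAngle q (pos a) (pos b) = viewAngle q₀ (pos a) (pos b) +
      (arg ((pos b - q) / (pos b - q₀)) - arg ((pos a - q) / (pos a - q₀))) + d a b) :
    winding pos c q = winding pos c q₀ + ∑ a, ∑ b, c a b * d a b := by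
  have h0 := hc.sum_mul_sub fun v => arg ((pos v - q) / (pos v - q₀))
  have h1 : ∀ a b, c a b * viewAngle q (pos a) (pos b) =
      c a b * viewAngle q₀ (pos a) (pos b) +
        c a b * (arg ((pos b - q) / (pos b - q₀)) - arg ((pos a - q) / (pos a - q₀))) +
        c a b * d a b := by
    intro a b
    by_cases hab : G.Adj a b
    · rw [h a b hab]; ring
    · simp [hc.supp a b hab]
  simp only [winding, h1, Finset.sum_add_distrib, h0, add_zero]

/-- The winding number is locally constant off the drawing. -/
theorem IsFlow.winding_eventually_eq (hc : G.IsFlow c) {q₀ : ℂ}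
    (h : ∀ a b, G.Adj a b → q₀ ∉ segment ℝ (pos a) (pos b)) :
    ∀ᶠ q in 𝓝 q₀, winding pos c q = winding pos c q₀ := by
  have h1 : ∀ᶠ q in 𝓝 q₀, ∀ a b, G.Adj a b → viewAngle q (pos a) (pos b) =
      viewAngle q₀ (pos a) (pos b) +
        (arg ((pos b - q) / (pos b - q₀)) - arg ((pos a - q) / (pos a - q₀))) := by
    rw [Filter.eventually_all]
    intro a
    rw [Filter.eventually_all]
    intro b
    by_cases hab : G.Adj a b
    · filter_upwards [viewAngle_eventually_eq (h a b hab)] with q hq _ using hq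
    · exact Eventually.of_forall fun q h' => absurd h' hab
  filter_upwards [h1] with q hq
  rw [hc.winding_eq (q₀ := q₀) (fun _ _ => 0) fun a b hab => by rw [hq a b hab, add_zero]]
  simp

/-- Next to an inner point of an edge, the angles of all other edges change continuously. -/
theorem IsStraightDrawing.eventually_of_ne (hG : G.IsStraightDrawing pos) {u v : V}
    (huv : G.Adj u v) {m : ℂ} (hm : m ∈ segment ℝ (pos u) (pos v))
    (hmu : pos u ≠ m) (hmv : pos v ≠ m) :
    ∀ᶠ q in 𝓝 m, ∀ a b, G.Adj a b → ¬ ((a = u ∧ b = v) ∨ (a = v ∧ b = u)) →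
      viewAngle q (pos a) (pos b) = viewAngle m (pos a) (pos b) +
        (arg ((pos b - q) / (pos b - m)) - arg ((pos a - q) / (pos a - m))) := by
  rw [Filter.eventually_all]
  intro a
  rw [Filter.eventually_all]
  intro b
  by_cases hab : G.Adj a b ∧ ¬ ((a = u ∧ b = v) ∨ (a = v ∧ b = u))
  · have : m ∉ segment ℝ (pos a) (pos b) := fun h =>
      hab.2 (hG.eq_of_mem_segment huv hab.1 hm hmu hmv h)
    filter_upwards [viewAngle_eventually_eq this] with q hq _ _ using hq
  · exact Eventually.of_forall fun q h1 h2 => absurd ⟨h1, h2⟩ hab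

/-- The winding number to the left of an edge. -/
theorem IsStraightDrawing.winding_left (hG : G.IsStraightDrawing pos) (hc : G.IsFlow c) {u v : V}
    (huv : G.Adj u v) {m : ℂ} (hm : m ∈ segment ℝ (pos u) (pos v))
    (hmu : pos u ≠ m) (hmv : pos v ≠ m) :
    ∀ᶠ q in 𝓝 m, 0 < ((q - pos u) / (pos v - pos u)).im →
      winding pos c q = winding pos c m + 2 * Real.pi * c u v := by
  classical
  filter_upwards [hG.eventually_of_ne huv hm hmu hmv,
    viewAngle_eventually_eq_left hm hmu hmv] with q hq1 hq2 hq
  specialize hq2 hq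
  have hne : pos u ≠ pos v := fun h => huv.ne (hG.inj h)
  have hlt := (viewAngle_pos_of_left hne hq).2
  have hpi := (viewAngle_eq_pi_iff hmu hmv).mpr hm
  have hpi' : viewAngle m (pos v) (pos u) = Real.pi :=
    (viewAngle_eq_pi_iff hmv hmu).mpr (segment_symm ℝ (pos u) (pos v) ▸ hm)
  -- At `m` both darts of the edge are seen under the angle `π`. To the left, the dart `(u, v)`
  -- continues this value, while `(v, u)` jumps to values near `-π`, that is, by `-2π`.
  rw [hc.winding_eq (q₀ := m) (fun a b => if a = v ∧ b = u then -2 * Real.pi else 0)]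
  · rw [Finset.sum_eq_single v, Finset.sum_eq_single u]
    · simp only [and_self, if_true]
      rw [hc.antisymm u v]
      ring
    · intro b _ hb
      simp [hb]
    · simp
    · intro a _ ha
      simp [ha]
    · simp
  · intro a b hab
    by_cases h1 : a = v ∧ b = u
    · obtain ⟨rfl, rfl⟩ := h1
      rw [viewAngle_swap hlt.ne, hq2, hpi']
      simp
      ring
    · rw [if_neg h1, add_zero]
      by_cases h2 : a = u ∧ b = v
      · obtain ⟨rfl, rfl⟩ := h2
        rw [hq2, hpi]
      · exact hq1 a b hab (by tauto)

theorem arg_div_eq_zero_of_mem_segment {u v : ℂ} (huv : u ≠ v) {s t : ℝ} (hs : s < 1)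
    (ht : t < 1) :
    arg ((v - (u + s * (v - u))) / (v - (u + t * (v - u)))) = 0 := by
  have hvu : v - u ≠ 0 := sub_ne_zero.mpr huv.symm
  have ht' : (1 - (t : ℂ)) ≠ 0 := by
    have : 1 - t ≠ 0 := by linarith
    exact_mod_cast this
  have h1 : (v - (u + s * (v - u))) / (v - (u + t * (v - u))) = (((1 - s) / (1 - t) : ℝ) : ℂ) := by
    have e1 : v - (u + s * (v - u)) = (1 - s) * (v - u) := by ring
    have e2 : v - (u + t * (v - u)) = (1 - t) * (v - u) := by ring
    rw [e1, e2, mul_div_mul_right _ _ hvu]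
    push_cast
    rfl
  rw [h1]
  exact arg_ofReal_of_nonneg (div_nonneg (by linarith) (by linarith))

theorem lineMap_mem_openSegment_aux {u v : ℂ} (huv : u ≠ v) {t : ℝ} (ht : t ∈ Set.Ioo (0 : ℝ) 1) :
    u + t * (v - u) ∈ segment ℝ u v ∧ u ≠ u + t * (v - u) ∧ v ≠ u + t * (v - u) := by
  have hvu : v - u ≠ 0 := sub_ne_zero.mpr huv.symm
  refine ⟨⟨1 - t, t, by linarith [ht.2], ht.1.le, by ring, ?_⟩, ?_, ?_⟩
  · simp only [real_smul]
    push_cast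
    ring
  · intro h
    have : (t : ℂ) * (v - u) = 0 := by linear_combination -h
    rcases mul_eq_zero.mp this with h' | h'
    · exact ht.1.ne' (by exact_mod_cast h')
    · exact hvu h'
  · intro h
    have : ((1 - t : ℝ) : ℂ) * (v - u) = 0 := by push_cast; linear_combination h
    rcases mul_eq_zero.mp this with h0 | h0
    · have h2 : 1 - t = 0 := by exact_mod_cast h0
      linarith [ht.2]
    · exact hvu h0

/-- The winding number is constant along the interior of an edge. -/
theorem IsStraightDrawing.winding_const (hG : G.IsStraightDrawing pos) (hc : G.IsFlow c) {u v : V}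
    (huv : G.Adj u v) {s t : ℝ} (hs : s ∈ Set.Ioo (0 : ℝ) 1) (ht : t ∈ Set.Ioo (0 : ℝ) 1) :
    winding pos c (pos u + s * (pos v - pos u)) = winding pos c (pos u + t * (pos v - pos u)) := by
  have hne : pos u ≠ pos v := fun h => huv.ne (hG.inj h)
  refine isPreconnected_Ioo.induction₂ (fun s t : ℝ =>
    winding pos c (pos u + s * (pos v - pos u)) = winding pos c (pos u + t * (pos v - pos u)))
    ?_ (fun x y z _ _ _ h1 h2 => h1.trans h2) (fun x y _ _ h => h.symm) hs ht
  intro s hs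
  obtain ⟨hm, hmu, hmv⟩ := lineMap_mem_openSegment_aux hne hs
  have hcont : Tendsto (fun t : ℝ => pos u + t * (pos v - pos u)) (𝓝[Set.Ioo 0 1] s)
      (𝓝 (pos u + s * (pos v - pos u))) := by
    have : Continuous fun t : ℝ => pos u + t * (pos v - pos u) := by fun_prop
    exact (this.tendsto s).mono_left nhdsWithin_le_nhds
  filter_upwards [hcont.eventually (hG.eventually_of_ne huv hm hmu hmv), self_mem_nhdsWithin]
    with t ht1 ht
  obtain ⟨hn, hnu, hnv⟩ := lineMap_mem_openSegment_aux hne ht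
  symm
  rw [hc.winding_eq (q₀ := pos u + s * (pos v - pos u)) (fun _ _ => 0)]
  · simp
  · intro a b hab
    rw [add_zero]
    by_cases h : (a = u ∧ b = v) ∨ (a = v ∧ b = u)
    · have e1 : arg ((pos v - (pos u + t * (pos v - pos u))) /
          (pos v - (pos u + s * (pos v - pos u)))) = 0 :=
        arg_div_eq_zero_of_mem_segment hne ht.2 hs.2
      have e2 : arg ((pos u - (pos u + t * (pos v - pos u))) /
          (pos u - (pos u + s * (pos v - pos u)))) = 0 := by
        have := arg_div_eq_zero_of_mem_segment hne.symm (s := 1 - t) (t := 1 - s)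
          (by linarith [ht.1]) (by linarith [hs.1])
        convert this using 4 <;> push_cast <;> ring
      have e3 := (viewAngle_eq_pi_iff hmu hmv).mpr hm
      have e4 := (viewAngle_eq_pi_iff hnu hnv).mpr hn
      have e5 := (viewAngle_eq_pi_iff hmv hmu).mpr (segment_symm ℝ (pos u) (pos v) ▸ hm)
      have e6 := (viewAngle_eq_pi_iff hnv hnu).mpr (segment_symm ℝ (pos u) (pos v) ▸ hn)
      rcases h with ⟨rfl, rfl⟩ | ⟨rfl, rfl⟩
      · rw [e1, e2, e3, e4]; ring
      · rw [e1, e2, e5, e6]; ring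
    · exact ht1 a b hab h

end

end SimpleGraph

/-- In a finite set of directions every direction has a next one counterclockwise. -/
theorem exists_next_direction {V : Type*} (S : Finset V) (θ : V → ℝ)
    (hθ : ∀ v ∈ S, ∀ x ∈ S, ∀ k : ℤ, θ v = θ x + k * (2 * Real.pi) → v = x) :
    ∃ σ : V → V, Set.MapsTo σ S S ∧ Set.InjOn σ S ∧ ∀ v ∈ S, ∃ g ∈ Set.Ioc 0 (2 * Real.pi),
      (∃ k : ℤ, θ (σ v) = θ v + g + k * (2 * Real.pi)) ∧
      ∀ x ∈ S, ∀ δ ∈ Set.Ioo 0 g, ∀ k : ℤ, θ x ≠ θ v + δ + k * (2 * Real.pi) := by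
  have hp : (0 : ℝ) < 2 * Real.pi := by positivity
  let gap : V → V → ℝ := fun v x => toIocMod hp 0 (θ x - θ v)
  have hmem : ∀ v x, gap v x ∈ Set.Ioc 0 (2 * Real.pi) := fun v x => by
    simpa using toIocMod_mem_Ioc hp 0 (θ x - θ v)
  have hgap : ∀ v x, ∃ k : ℤ, θ x = θ v + gap v x + k * (2 * Real.pi) := by
    intro v x
    refine ⟨toIocDiv hp 0 (θ x - θ v), ?_⟩
    have := toIocMod_add_toIocDiv_zsmul hp 0 (θ x - θ v)
    rw [zsmul_eq_mul] at this
    change _ = _ + toIocMod hp 0 (θ x - θ v) + _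
    linarith
  have huniq : ∀ v x δ, δ ∈ Set.Ioc 0 (2 * Real.pi) →
      (∃ k : ℤ, θ x = θ v + δ + k * (2 * Real.pi)) → gap v x = δ := by
    rintro v x δ hδ ⟨k, hk⟩
    refine (toIocMod_eq_iff hp).mpr ⟨by simpa using hδ, k, ?_⟩
    rw [zsmul_eq_mul]
    linarith
  have hmin : ∀ v ∈ S, ∃ x ∈ S, ∀ y ∈ S, gap v x ≤ gap v y := fun v hv =>
    S.exists_min_image (gap v) ⟨v, hv⟩
  choose! σ hσ1 hσ2 using hmin
  refine ⟨σ, hσ1, ?_, ?_⟩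
  · have key : ∀ v ∈ S, ∀ x ∈ S, σ v = σ x → gap v (σ v) ≤ gap x (σ x) → v = x := by
      intro v hv x hx h hle
      obtain ⟨k, hk⟩ := hgap v (σ v)
      obtain ⟨l, hl⟩ := hgap x (σ x)
      rw [h] at hk hle
      rcases hle.eq_or_lt with heq | hlt
      · rw [heq] at hk
        refine hθ v hv x hx (l - k) ?_
        push_cast
        linarith
      · exfalso
        -- If `v` and `x` have the same successor and `v` is closer to it, then `v` lies between `x`
        -- and the successor of `x`.
        have h1 : gap x v = gap x (σ x) - gap v (σ x) := by
          refine huniq _ _ _ ⟨by linarith, by linarith [(hmem x (σ x)).2, (hmem v (σ x)).1]⟩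
            ⟨l - k, ?_⟩
          push_cast
          linarith
        linarith [hσ2 x hx v hv, (hmem v (σ x)).1]
    intro v hv x hx h
    rcases le_total (gap v (σ v)) (gap x (σ x)) with h' | h'
    · exact key v hv x hx h h'
    · exact (key x hx v hv h.symm h').symm
  · intro v hv
    refine ⟨gap v (σ v), hmem _ _, hgap _ _, ?_⟩
    intro x hx δ hδ k hk
    have := huniq v x δ ⟨hδ.1, (hδ.2.le).trans (hmem _ _).2⟩ ⟨k, hk⟩
    linarith [hσ2 v hv x hx, hδ.2]

/-! ### Faces of a straight drawing and the abstract dual. -/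

namespace SimpleGraph

open Complex Filter Topology

variable {V : Type*} {G : SimpleGraph V} {pos : V → ℂ} {c : V → V → ℝ}

/-- Of two neighbours in the same direction the nearer one would lie on the edge to the other. -/
theorem IsStraightDrawing.eq_of_arg_eq (hG : G.IsStraightDrawing pos) {u v x : V}
    (hv : G.Adj u v) (hx : G.Adj u x) (h : arg (pos v - pos u) = arg (pos x - pos u)) : v = x := by
  have key : ∀ v x, G.Adj u v → G.Adj u x → arg (pos v - pos u) = arg (pos x - pos u) →
      ‖pos v - pos u‖ ≤ ‖pos x - pos u‖ → v = x := by
    intro v x hv hx h hle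
    have hx0 : pos x - pos u ≠ 0 := sub_ne_zero.mpr fun h => hx.ne' (hG.inj h)
    have hxn : ‖pos x - pos u‖ ≠ 0 := norm_ne_zero_iff.mpr hx0
    have e1 := norm_mul_exp_arg_mul_I (pos v - pos u)
    have e2 := norm_mul_exp_arg_mul_I (pos x - pos u)
    rw [h] at e1
    set r : ℝ := ‖pos v - pos u‖ / ‖pos x - pos u‖ with hr
    have hr0 : 0 ≤ r := by positivity
    have hr1 : r ≤ 1 := div_le_one_of_le₀ hle (norm_nonneg _)
    have e3 : pos v - pos u = r * (pos x - pos u) := by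
      have hxc : (‖pos x - pos u‖ : ℂ) ≠ 0 := by exact_mod_cast hxn
      calc pos v - pos u = ‖pos v - pos u‖ * exp (arg (pos x - pos u) * I) := e1.symm
        _ = r * (‖pos x - pos u‖ * exp (arg (pos x - pos u) * I)) := by
          rw [hr]
          push_cast
          field_simp
        _ = r * (pos x - pos u) := by rw [e2]
    have hmem : pos v ∈ segment ℝ (pos u) (pos x) := by
      refine ⟨1 - r, r, by linarith, hr0, by ring, ?_⟩
      simp only [real_smul]
      push_cast
      linear_combination -e3
    rcases hG.mem u x v hx hmem with h' | h'
    · exact absurd h' hv.ne'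
    · exact h'
  rcases le_total ‖pos v - pos u‖ ‖pos x - pos u‖ with h' | h'
  · exact key v x hv hx h h'
  · exact (key x v hx hv h.symm h').symm

theorem isClosed_segment_complex (a b : ℂ) : IsClosed (segment ℝ a b) := by
  rw [segment_eq_image']
  refine (IsCompact.image isCompact_Icc ?_).isClosed
  fun_prop

variable [Fintype V]

/-- The value of the winding number to the left of the edge from `u` to `v`. -/
noncomputable def sideWinding (pos : V → ℂ) (c : V → V → ℝ) (u v : V) : ℝ :=
  winding pos c (pos u + ((1 / 2 : ℝ) : ℂ) * (pos v - pos u)) + 2 * Real.pi * c u v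

theorem IsFlow.sideWinding_sub (hc : G.IsFlow c) (u v : V) :
    sideWinding pos c u v - sideWinding pos c v u = 4 * Real.pi * c u v := by
  have : pos v + ((1 / 2 : ℝ) : ℂ) * (pos u - pos v) =
      pos u + ((1 / 2 : ℝ) : ℂ) * (pos v - pos u) := by
    push_cast
    ring
  rw [sideWinding, sideWinding, this, hc.antisymm u v]
  ring

theorem IsStraightDrawing.exists_radius (hG : G.IsStraightDrawing pos) (u : V) :
    ∃ ρ : ℝ, 0 < ρ ∧ (∀ x, G.Adj u x → ρ < ‖pos x - pos u‖) ∧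
      ∀ a b, G.Adj a b → a ≠ u → b ≠ u → ∀ q, ‖q - pos u‖ = ρ → q ∉ segment ℝ (pos a) (pos b) := by
  have h1 : ∀ᶠ q in 𝓝 (pos u), ∀ a b, G.Adj a b → a ≠ u → b ≠ u →
      q ∉ segment ℝ (pos a) (pos b) := by
    rw [Filter.eventually_all]
    intro a
    rw [Filter.eventually_all]
    intro b
    by_cases h : G.Adj a b ∧ a ≠ u ∧ b ≠ u
    · have hnot : pos u ∉ segment ℝ (pos a) (pos b) := by
        intro h'
        rcases hG.mem a b u h.1 h' with h' | h'
        · exact h.2.1 h'.symm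
        · exact h.2.2 h'.symm
      filter_upwards [(isClosed_segment_complex _ _).isOpen_compl.mem_nhds hnot]
        with q hq _ _ _ using hq
    · exact Eventually.of_forall fun q h1 h2 h3 => absurd ⟨h1, h2, h3⟩ h
  obtain ⟨ε, hε, hball⟩ := Metric.eventually_nhds_iff.mp h1
  have h2 : ∀ᶠ ρ : ℝ in 𝓝[>] 0, ∀ x, G.Adj u x → ρ < ‖pos x - pos u‖ := by
    rw [Filter.eventually_all]
    intro x
    by_cases hx : G.Adj u x
    · have hx0 : 0 < ‖pos x - pos u‖ :=
        norm_pos_iff.mpr (sub_ne_zero.mpr fun h => hx.ne' (hG.inj h))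
      filter_upwards [nhdsWithin_le_nhds (gt_mem_nhds hx0)] with ρ h _ using h
    · exact Eventually.of_forall fun ρ h => absurd h hx
  have h3 : ∀ᶠ ρ : ℝ in 𝓝[>] 0, ρ < ε := nhdsWithin_le_nhds (gt_mem_nhds hε)
  obtain ⟨ρ, hρ1, hρ2, hρ3⟩ := (h2.and (h3.and self_mem_nhdsWithin)).exists
  refine ⟨ρ, hρ3, hρ1, fun a b hab ha hb q hq => hball ?_ a b hab ha hb⟩
  rw [dist_eq_norm, hq]
  exact hρ2

/-- The winding number does not change in the corner between two consecutive edges. -/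
theorem IsStraightDrawing.sideWinding_corner (hG : G.IsStraightDrawing pos) (hc : G.IsFlow c)
    {u v v' : V} (hv : G.Adj u v) (hv' : G.Adj u v') {g : ℝ} (hg : g ∈ Set.Ioc 0 (2 * Real.pi))
    {k : ℤ} (hk : arg (pos v' - pos u) = arg (pos v - pos u) + g + k * (2 * Real.pi))
    (hfree : ∀ x, G.Adj u x → ∀ δ ∈ Set.Ioo 0 g, ∀ k : ℤ,
      arg (pos x - pos u) ≠ arg (pos v - pos u) + δ + k * (2 * Real.pi)) :
    sideWinding pos c u v = sideWinding pos c v' u := by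
  obtain ⟨ρ, hρ0, hρ1, hρ2⟩ := hG.exists_radius u
  set θ := arg (pos v - pos u) with hθ
  -- A circle around `u` so small that it meets only the edges at `u`. Its arc from the direction of
  -- `v` to that of `v'` avoids the drawing, so the winding number is constant there; it starts on
  -- the left of `uv` and ends on the left of `v'u`. For a vertex `u` of degree one the arc is the
  -- full circle.
  let γ : ℝ → ℂ := fun t => pos u + ρ * exp (t * I)
  have hγcont : Continuous γ := by fun_prop
  have hpos : ∀ x, G.Adj u x → pos x - pos u ≠ 0 := fun x hx =>
    sub_ne_zero.mpr fun h => hx.ne' (hG.inj h)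
  have hexp : ∀ x, G.Adj u x → exp (arg (pos x - pos u) * I) =
      (pos x - pos u) / ‖pos x - pos u‖ := by
    intro x hx
    have h1 : (‖pos x - pos u‖ : ℂ) ≠ 0 := by
      exact_mod_cast norm_ne_zero_iff.mpr (hpos x hx)
    rw [eq_div_iff h1, mul_comm]
    exact norm_mul_exp_arg_mul_I _
  have hs : ∀ x, G.Adj u x → ρ / ‖pos x - pos u‖ ∈ Set.Ioo (0 : ℝ) 1 := by
    intro x hx
    have h1 : 0 < ‖pos x - pos u‖ := norm_pos_iff.mpr (hpos x hx)
    exact ⟨by positivity, (div_lt_one h1).mpr (hρ1 x hx)⟩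
  have hpt : ∀ x, G.Adj u x → pos u + ρ * exp (arg (pos x - pos u) * I) =
      pos u + ((ρ / ‖pos x - pos u‖ : ℝ) : ℂ) * (pos x - pos u) := by
    intro x hx
    rw [hexp x hx]
    push_cast
    ring
  have hexpk : exp ((θ + g : ℝ) * I) = exp (arg (pos v' - pos u) * I) := by
    rw [exp_eq_exp_iff_exists_int]
    refine ⟨-k, ?_⟩
    rw [hk]
    push_cast
    ring
  have hdiv : ∀ x, G.Adj u x → ∀ t : ℝ, (γ t - pos u) / (pos x - pos u) =
      ((ρ / ‖pos x - pos u‖ : ℝ) : ℂ) * exp ((t - arg (pos x - pos u) : ℝ) * I) := by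
    intro x hx t
    have h1 : (‖pos x - pos u‖ : ℂ) ≠ 0 := by
      exact_mod_cast norm_ne_zero_iff.mpr (hpos x hx)
    have h2 := hpos x hx
    push_cast
    rw [sub_mul, exp_sub, hexp x hx]
    simp only [γ]
    field_simp
    ring
  have him : ∀ x, G.Adj u x → ∀ t : ℝ, ((γ t - pos u) / (pos x - pos u)).im =
      ρ / ‖pos x - pos u‖ * Real.sin (t - arg (pos x - pos u)) := by
    intro x hx t
    rw [hdiv x hx t, im_ofReal_mul, exp_ofReal_mul_I_im]
  have hmiss : ∀ b, G.Adj u b → ∀ t ∈ Set.Ioo θ (θ + g), γ t ∉ segment ℝ (pos u) (pos b) := by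
    intro b hb t ht hmem
    rw [segment_eq_image'] at hmem
    obtain ⟨r, hr, hrt⟩ := hmem
    simp only [real_smul] at hrt
    have h1 : (γ t - pos u) / (pos b - pos u) = r := by
      rw [div_eq_iff (hpos b hb), ← hrt]
      ring
    rw [hdiv b hb t] at h1
    have hs0 := (hs b hb).1
    set s := ρ / ‖pos b - pos u‖
    have h2 := congrArg norm h1
    rw [norm_mul, norm_exp_ofReal_mul_I, mul_one, norm_real, norm_real, Real.norm_of_nonneg hs0.le,
      Real.norm_of_nonneg hr.1] at h2
    rw [← h2] at h1
    have hsc : (s : ℂ) ≠ 0 := by exact_mod_cast hs0.ne'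
    have h3 : exp ((t - arg (pos b - pos u) : ℝ) * I) = 1 := by
      apply mul_left_cancel₀ hsc
      rw [h1, mul_one]
    rw [exp_eq_one_iff] at h3
    obtain ⟨n, hn⟩ := h3
    have h4 : t - arg (pos b - pos u) = n * (2 * Real.pi) := by
      have h5 : ((t - arg (pos b - pos u) : ℝ) : ℂ) = ((n * (2 * Real.pi) : ℝ) : ℂ) := by
        apply mul_right_cancel₀ I_ne_zero
        rw [hn]
        push_cast
        ring
      exact_mod_cast h5
    refine hfree b hb (t - θ) ⟨by linarith [ht.1], by linarith [ht.2]⟩ (-n) ?_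
    push_cast
    linarith
  have hoff : ∀ t ∈ Set.Ioo θ (θ + g), ∀ a b, G.Adj a b → γ t ∉ segment ℝ (pos a) (pos b) := by
    intro t ht a b hab
    by_cases ha : a = u
    · subst ha
      exact hmiss b hab t ht
    by_cases hb : b = u
    · subst hb
      rw [segment_symm]
      exact hmiss a hab.symm t ht
    refine hρ2 a b hab ha hb _ ?_
    simp only [γ, add_sub_cancel_left, norm_mul, norm_real, norm_exp_ofReal_mul_I, mul_one]
    exact Real.norm_of_nonneg hρ0.le
  have hconst : ∀ t ∈ Set.Ioo θ (θ + g), ∀ t' ∈ Set.Ioo θ (θ + g),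
      winding pos c (γ t) = winding pos c (γ t') := by
    intro t ht t' ht'
    refine isPreconnected_Ioo.induction₂ (fun t t' : ℝ =>
      winding pos c (γ t) = winding pos c (γ t')) ?_
      (fun x y z _ _ _ h1 h2 => h1.trans h2) (fun x y _ _ h => h.symm) ht ht'
    intro x hx
    have := (hγcont.tendsto x).eventually (hc.winding_eventually_eq (hoff x hx))
    filter_upwards [nhdsWithin_le_nhds this] with y hy using hy.symm
  have hgpos := hg.1
  have hθlt : θ < θ + g := by linarith
  -- the first edge
  have hne : ∀ x, G.Adj u x → pos u ≠ pos x := fun x hx h => hx.ne (hG.inj h)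
  have hfirst : ∀ᶠ t in 𝓝[>] θ, winding pos c (γ t) = sideWinding pos c u v := by
    obtain ⟨hm, hmu, hmv⟩ := lineMap_mem_openSegment_aux (hne v hv) (hs v hv)
    have h1 := hG.winding_left hc hv hm hmu hmv
    rw [← hpt v hv] at h1
    have h2 := nhdsWithin_le_nhds (s := Set.Ioi θ) ((hγcont.tendsto θ).eventually h1)
    filter_upwards [h2, Ioo_mem_nhdsGT (show θ < θ + Real.pi by linarith [Real.pi_pos])]
      with t ht1 ht2
    rw [ht1, sideWinding, hpt v hv,
      hG.winding_const hc hv (hs v hv) (t := 1 / 2) (by constructor <;> norm_num)]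
    rw [him v hv]
    refine mul_pos (hs v hv).1 (Real.sin_pos_of_pos_of_lt_pi ?_ ?_)
    · linarith [ht2.1]
    · linarith [ht2.2]
  -- the second edge
  have hsecond : ∀ᶠ t in 𝓝[<] (θ + g), winding pos c (γ t) = sideWinding pos c v' u := by
    obtain ⟨hm, hmu, hmv⟩ := lineMap_mem_openSegment_aux (hne v' hv') (hs v' hv')
    have h1 := hG.winding_left hc hv'.symm (segment_symm ℝ (pos u) (pos v') ▸ hm) hmv hmu
    rw [← hpt v' hv', ← hexpk] at h1
    have h2 := nhdsWithin_le_nhds (s := Set.Iio (θ + g)) ((hγcont.tendsto (θ + g)).eventually h1)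
    filter_upwards [h2, Ioo_mem_nhdsLT (show θ + g - Real.pi < θ + g by linarith [Real.pi_pos])]
      with t ht1 ht2
    have hmid : pos v' + ((1 / 2 : ℝ) : ℂ) * (pos u - pos v') =
        pos u + ((1 / 2 : ℝ) : ℂ) * (pos v' - pos u) := by
      push_cast
      ring
    rw [ht1, sideWinding, hexpk, hpt v' hv', hmid,
      hG.winding_const hc hv' (hs v' hv') (t := 1 / 2) (by constructor <;> norm_num)]
    have h3 : (γ t - pos v') / (pos u - pos v') = 1 - (γ t - pos u) / (pos v' - pos u) := by
      have e1 := hpos v' hv'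
      have e2 : pos u - pos v' ≠ 0 := by rw [← neg_sub]; exact neg_ne_zero.mpr e1
      field_simp
      ring
    rw [h3, sub_im, one_im, him v' hv', zero_sub, ← mul_neg, ← Real.sin_neg]
    refine mul_pos (hs v' hv').1 ?_
    have h4 : Real.sin (-(t - arg (pos v' - pos u))) = Real.sin (θ + g - t) := by
      rw [hk]
      have : -(t - (θ + g + k * (2 * Real.pi))) = θ + g - t + k * (2 * Real.pi) := by ring
      rw [this, Real.sin_add_int_mul_two_pi]
    rw [h4]
    refine Real.sin_pos_of_pos_of_lt_pi ?_ ?_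
    · linarith [ht2.2]
    · linarith [ht2.1]
  obtain ⟨t, ht1, ht2⟩ := (hfirst.and (Ioo_mem_nhdsGT hθlt)).exists
  obtain ⟨t', ht1', ht2'⟩ := (hsecond.and (Ioo_mem_nhdsLT hθlt)).exists
  rw [← ht1, ← ht1']
  exact hconst t ht2 t' ht2'

/-- The dual vertices are the classes of darts generated by turning at corners: `(u, v)` has the
same face on its left as `(σ v, u)`, where `σ v` follows `v` around `u`. The winding number divided
by `4π` is a well-defined potential on classes, and it jumps by `c u v` across `uv`. Conversely, `σ`
permutes the neighbours of `u`, so the divergence of every tension cancels. A face with several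
boundary walks may become several classes, which does no harm. -/
theorem IsStraightDrawing.hasAbstractDual (hG : G.IsStraightDrawing pos) :
    G.HasAbstractDual := by
  classical
  have hnext : ∀ u, ∃ σ : V → V, Set.MapsTo σ (G.neighborFinset u) (G.neighborFinset u) ∧
      Set.InjOn σ (G.neighborFinset u) ∧
      ∀ c, G.IsFlow c → ∀ v, G.Adj u v → sideWinding pos c u v = sideWinding pos c (σ v) u := by
    intro u
    obtain ⟨σ, h1, h2, h3⟩ := exists_next_direction (G.neighborFinset u)
      (fun x => arg (pos x - pos u)) (by
        intro v hv x hx k hk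
        rw [mem_neighborFinset] at hv hx
        refine hG.eq_of_arg_eq hv hx ?_
        have e : ((arg (pos v - pos u) : ℝ) : Real.Angle) = (arg (pos x - pos u) : ℝ) :=
          Real.Angle.angle_eq_iff_two_pi_dvd_sub.mpr ⟨k, by rw [hk]; ring⟩
        exact arg_coe_angle_eq_iff.mp e)
    refine ⟨σ, h1, h2, ?_⟩
    intro c hc v hv
    obtain ⟨g, hg, ⟨k, hk⟩, hfree⟩ := h3 v (by simpa using hv)
    refine hG.sideWinding_corner hc hv ?_ hg hk fun x hx => hfree x (by simpa using hx)
    have := h1 (show v ∈ (G.neighborFinset u : Set V) by simpa using hv)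
    simpa using this
  choose σ hσ1 hσ2 hσ3 using hnext
  let r : V × V → V × V → Prop := fun d d' => G.Adj d.1 d.2 ∧ d' = (σ d.1 d.2, d.1)
  obtain ⟨N, ⟨e⟩⟩ := Finite.exists_equiv_fin (Quot r)
  refine ⟨N, fun u v => e (Quot.mk r (u, v)), ?_, ?_⟩
  · intro c hc
    refine ⟨fun l => Quot.lift (fun d : V × V => sideWinding pos c d.1 d.2) ?_ (e.symm l) /
      (4 * Real.pi), ?_⟩
    · rintro ⟨u, v⟩ _ ⟨h, rfl⟩
      exact hσ3 u c hc v h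
    · intro u v _
      simp only [Equiv.symm_apply_apply]
      rw [← sub_div, hc.sideWinding_sub]
      field_simp
  · intro φ u
    rw [← Finset.sum_filter, Finset.sum_sub_distrib, sub_eq_zero]
    have hS : ({v | G.Adj u v} : Finset V) = G.neighborFinset u := by
      ext v
      simp
    rw [hS]
    refine Finset.sum_nbij (σ u) (fun v hv => hσ1 u hv) (hσ2 u)
      (Finset.surjOn_of_injOn_of_card_le _ (hσ1 u) (hσ2 u) le_rfl) ?_
    intro v hv
    have : Quot.mk r (u, v) = Quot.mk r (σ u v, u) :=
      Quot.sound ⟨by simpa using hv, rfl⟩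
    simp only [this]

end SimpleGraph

/-! ### From polygonal drawings to straight drawings. -/

section PolygonalArc

variable {k : ℕ} {p : ℕ → ℝ × ℝ}

theorem polygonal_corner_mem (hp1 : ∀ i < k, p i ≠ p (i + 1))
    (hp2 : ∀ i j, i < j → j < k → ∀ z ∈ segment ℝ (p i) (p (i + 1)),
      z ∈ segment ℝ (p j) (p (j + 1)) → j = i + 1 ∧ z = p j)
    {i j : ℕ} (hi : i < k) (hj : j ≤ k) (h : p j ∈ segment ℝ (p i) (p (i + 1))) :
    p j = p i ∨ p j = p (i + 1) := by
  rcases hj.lt_or_eq with hjk | rfl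
  · rcases lt_trichotomy i j with hij | rfl | hij
    · obtain ⟨rfl, _⟩ := hp2 i j hij hjk _ h (left_mem_segment ℝ _ _)
      exact Or.inr rfl
    · exact Or.inl rfl
    · exact Or.inl (hp2 j i hij hi _ (left_mem_segment ℝ _ _) h).2
  · obtain ⟨l, rfl⟩ : ∃ l, j = l + 1 := ⟨j - 1, by omega⟩
    rcases (Nat.lt_succ_iff.mp hi).lt_or_eq with hil | rfl
    · have := (hp2 i l hil (by omega) _ h (right_mem_segment ℝ _ _)).2
      exact absurd this.symm (hp1 l (by omega))
    · exact Or.inr rfl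

theorem polygonal_corner_ne_last (hp1 : ∀ i < k, p i ≠ p (i + 1))
    (hp2 : ∀ i j, i < j → j < k → ∀ z ∈ segment ℝ (p i) (p (i + 1)),
      z ∈ segment ℝ (p j) (p (j + 1)) → j = i + 1 ∧ z = p j)
    {i : ℕ} (hi : i < k) : p i ≠ p k := by
  intro h
  obtain ⟨l, rfl⟩ : ∃ l, k = l + 1 := ⟨k - 1, by omega⟩
  rcases (Nat.lt_succ_iff.mp hi).lt_or_eq with hil | rfl
  · have := (hp2 i l hil (by omega) _ (left_mem_segment ℝ _ _) (h ▸ right_mem_segment ℝ _ _)).2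
    exact hp1 l (by omega) (this.symm.trans h)
  · exact hp1 _ hi h

end PolygonalArc

namespace SimpleGraph

theorem ConnOn.of_center {V : Type*} {G : SimpleGraph V} {S : Set V} (s : V)
    (h : ∀ x ∈ S, Relation.ReflTransGen (fun a b => G.Adj a b ∧ a ∈ S ∧ b ∈ S) s x) :
    G.ConnOn S := by
  have hsymm : Std.Symm fun a b => G.Adj a b ∧ a ∈ S ∧ b ∈ S :=
    ⟨fun a b h => ⟨h.1.symm, h.2.2, h.2.1⟩⟩
  intro u hu v hv
  exact (Relation.ReflTransGen.stdSymm.symm _ _ (h u hu)).trans (h v hv)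

/-- A planar graph is a minor of a graph drawn with straight edges. -/
theorem exists_straight_of_planeDrawing {V : Type*} [Finite V] {G : SimpleGraph V}
    (D : PlaneDrawing G) :
    ∃ (S : Set (ℝ × ℝ)) (_ : Finite S) (G' : SimpleGraph S) (pos : S → ℂ),
      G'.IsStraightDrawing pos ∧ G.IsMinorOf G' := by
  classical
  obtain ⟨n, ⟨e⟩⟩ := Finite.exists_equiv_fin V
  let _ : LinearOrder V := LinearOrder.lift' e e.injective
  have harc := D.isPolygonalArc
  simp only [IsPolygonalArc] at harc
  choose! k p hp0 hpk hp1 hp2 hA using harc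
  have hseg : ∀ {u v}, G.Adj u v → ∀ {i}, i < k u v → ∀ {z},
      z ∈ segment ℝ (p u v i) (p u v (i + 1)) → z ∈ D.arc s(u, v) := by
    intro u v h i hi z hz
    rw [hA u v h]
    exact Set.mem_biUnion (Set.mem_Iio.mpr hi) hz
  have hkpos : ∀ {u v}, G.Adj u v → 0 < k u v := by
    intro u v h
    rcases Nat.eq_zero_or_pos (k u v) with h0 | h0
    · exfalso
      have h1 := hpk u v h
      rw [h0, hp0 u v h] at h1
      exact h.ne (D.pos_injective h1)
    · exact h0
  have hcorner : ∀ {u v}, G.Adj u v → ∀ {i}, i ≤ k u v → p u v i ∈ D.arc s(u, v) := by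
    intro u v h i hi
    have hk0 := hkpos h
    rcases hi.lt_or_eq with hi | rfl
    · exact hseg h hi (left_mem_segment ℝ _ _)
    · obtain ⟨l, hl⟩ : ∃ l, k u v = l + 1 := ⟨k u v - 1, by omega⟩
      rw [hl]
      exact hseg h (by omega) (right_mem_segment ℝ _ _)
  -- a vertex on an edge is one of the two outer corners
  have hend : ∀ {u v w}, G.Adj u v → D.pos w ∈ D.arc s(u, v) → ∃ j ≤ k u v,
      D.pos w = p u v j := by
    intro u v w h hw
    rcases Sym2.mem_iff.mp (D.mem_of_pos_mem _ h w hw) with rfl | rfl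
    · exact ⟨0, Nat.zero_le _, (hp0 _ _ h).symm⟩
    · exact ⟨k u w, le_rfl, (hpk _ _ h).symm⟩
  have hsym : ∀ {u v u' v' : V}, u < v → u' < v' → (u, v) ≠ (u', v') → s(u, v) ≠ s(u', v') := by
    intro u v u' v' h h' hne heq
    rcases Sym2.eq_iff.mp heq with ⟨rfl, rfl⟩ | ⟨rfl, rfl⟩
    · exact hne rfl
    · exact lt_asymm h h'
  -- Every corner of every edge becomes a vertex, so that all edges are straight. Each edge is
  -- traversed from its smaller end to its larger one.
  let T : Set (ℝ × ℝ) := Set.range D.pos ∪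
    {z | ∃ u v, u < v ∧ G.Adj u v ∧ ∃ i ≤ k u v, z = p u v i}
  have hTfin : T.Finite := by
    have hfin : (⋃ u, ⋃ v, ⋃ i ∈ Set.Iic (k u v), {p u v i}).Finite :=
      Set.finite_iUnion fun u => Set.finite_iUnion fun v =>
        (Set.finite_Iic _).biUnion fun i _ => Set.finite_singleton _
    refine ((Set.finite_range D.pos).union hfin).subset ?_
    rintro z (h | ⟨u, v, _, _, i, hi, rfl⟩)
    · exact Or.inl h
    · exact Or.inr (Set.mem_iUnion.mpr ⟨u, Set.mem_iUnion.mpr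
        ⟨v, Set.mem_biUnion (Set.mem_Iic.mpr hi) rfl⟩⟩)
  have hTp : ∀ {u v i}, u < v → G.Adj u v → i ≤ k u v → p u v i ∈ T :=
    fun {u v i} h1 h2 h3 => Or.inr ⟨u, v, h1, h2, i, h3, rfl⟩
  have hTpos : ∀ v, D.pos v ∈ T := fun v => Or.inl ⟨v, rfl⟩
  let G' : SimpleGraph T :=
    { Adj := fun x y => ∃ u v, u < v ∧ G.Adj u v ∧ ∃ i < k u v,
        (x.1 = p u v i ∧ y.1 = p u v (i + 1)) ∨ (x.1 = p u v (i + 1) ∧ y.1 = p u v i)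
      symm := ⟨by
        rintro x y ⟨u, v, h1, h2, i, hi, h⟩
        exact ⟨u, v, h1, h2, i, hi, h.symm.imp And.symm And.symm⟩⟩
      loopless := ⟨by
        rintro x ⟨u, v, h1, h2, i, hi, ⟨h3, h4⟩ | ⟨h3, h4⟩⟩
        · exact hp1 u v h2 i hi (h3.symm.trans h4)
        · exact hp1 u v h2 i hi (h4.symm.trans h3)⟩ }
  let f := Complex.equivRealProdLm.symm
  let pos : T → ℂ := fun x => f x.1
  have hfseg : ∀ {a b z : ℝ × ℝ}, f z ∈ segment ℝ (f a) (f b) ↔ z ∈ segment ℝ a b := by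
    intro a b z
    have : segment ℝ (f a) (f b) = f '' segment ℝ a b :=
      (image_segment ℝ f.toLinearMap.toAffineMap a b).symm
    rw [this]
    exact f.injective.mem_set_image
  -- points of the drawing on a segment
  have hpt : ∀ {u v}, u < v → G.Adj u v → ∀ {i}, i < k u v → ∀ {w},
      D.pos w ∈ segment ℝ (p u v i) (p u v (i + 1)) →
      D.pos w = p u v i ∨ D.pos w = p u v (i + 1) := by
    intro u v h1 h2 i hi w hw
    obtain ⟨j, hj, hwj⟩ := hend h2 (hseg h2 hi hw)
    rw [hwj] at hw ⊢
    exact polygonal_corner_mem (hp1 u v h2) (hp2 u v h2) hi hj hw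
  have hendpts : ∀ {x y : T} {u v i}, (x.1 = p u v i ∧ y.1 = p u v (i + 1)) ∨
      (x.1 = p u v (i + 1) ∧ y.1 = p u v i) → ∀ {z : ℝ × ℝ},
      (z ∈ segment ℝ x.1 y.1 ↔ z ∈ segment ℝ (p u v i) (p u v (i + 1))) ∧
      ((z = p u v i ∨ z = p u v (i + 1)) ↔ (z = x.1 ∨ z = y.1)) := by
    rintro x y u v i (⟨h1, h2⟩ | ⟨h1, h2⟩) z
    · rw [h1, h2]; exact ⟨Iff.rfl, Iff.rfl⟩
    · rw [h1, h2, segment_symm]; exact ⟨Iff.rfl, or_comm⟩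
  refine ⟨T, hTfin, G', pos, ⟨?_, ?_, ?_⟩, ?_⟩
  · intro x y h
    exact Subtype.ext (f.injective h)
  · rintro x y w ⟨u, v, huv, hadj, i, hi, hxy⟩ hw
    have hw' := (hendpts hxy).1.mp (hfseg.mp hw)
    suffices h : w.1 = p u v i ∨ w.1 = p u v (i + 1) by
      exact ((hendpts hxy).2.mp h).imp Subtype.ext Subtype.ext
    obtain ⟨z, hz⟩ := w
    simp only at hw' ⊢
    rcases hz with ⟨w, rfl⟩ | ⟨u', v', huv', hadj', j, hj, rfl⟩
    · exact hpt huv hadj hi hw'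
    · by_cases heq : (u, v) = (u', v')
      · obtain ⟨rfl, rfl⟩ := Prod.ext_iff.mp heq
        exact polygonal_corner_mem (hp1 _ _ hadj) (hp2 _ _ hadj) hi hj hw'
      · obtain ⟨w, _, _, h⟩ := D.inter_subset _ hadj _ hadj' (hsym huv huv' heq) _
          (hseg hadj hi hw') (hcorner hadj' hj)
        rw [h] at hw' ⊢
        exact hpt huv hadj hi hw'
  · rintro x y x' y' ⟨u, v, huv, hadj, i, hi, hxy⟩ ⟨u', v', huv', hadj', j, hj, hxy'⟩ hne z hz hz'
    obtain ⟨z, rfl⟩ := f.surjective z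
    have hz := (hendpts hxy).1.mp (hfseg.mp hz)
    have hz' := (hendpts hxy').1.mp (hfseg.mp hz')
    suffices h : (z = p u v i ∨ z = p u v (i + 1)) ∧
        (z = p u' v' j ∨ z = p u' v' (j + 1)) by
      have h1 := (hendpts hxy).2.mp h.1
      have h2 := (hendpts hxy').2.mp h.2
      have hzT : z ∈ T := by
        rcases h1 with h1 | h1 <;> rw [h1]
        exacts [x.2, y.2]
      refine ⟨⟨z, hzT⟩, h1.imp Subtype.ext Subtype.ext, h2.imp Subtype.ext Subtype.ext, rfl⟩
    by_cases heq : (u, v) = (u', v')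
    · obtain ⟨rfl, rfl⟩ := Prod.ext_iff.mp heq
      simp only at hxy hxy' hz hz' hi hj huv' hadj' ⊢
      rcases lt_trichotomy i j with hij | rfl | hij
      · obtain ⟨rfl, rfl⟩ := hp2 _ _ hadj i j hij hj z hz hz'
        exact ⟨Or.inr rfl, Or.inl rfl⟩
      · exfalso
        apply hne
        rw [Sym2.eq_iff]
        rcases hxy with ⟨h1, h2⟩ | ⟨h1, h2⟩ <;> rcases hxy' with ⟨h3, h4⟩ | ⟨h3, h4⟩
        · exact Or.inl ⟨Subtype.ext (h1.trans h3.symm), Subtype.ext (h2.trans h4.symm)⟩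
        · exact Or.inr ⟨Subtype.ext (h1.trans h4.symm), Subtype.ext (h2.trans h3.symm)⟩
        · exact Or.inr ⟨Subtype.ext (h1.trans h4.symm), Subtype.ext (h2.trans h3.symm)⟩
        · exact Or.inl ⟨Subtype.ext (h1.trans h3.symm), Subtype.ext (h2.trans h4.symm)⟩
      · obtain ⟨rfl, rfl⟩ := hp2 _ _ hadj j i hij hi z hz' hz
        exact ⟨Or.inl rfl, Or.inr rfl⟩
    · obtain ⟨w, _, _, rfl⟩ := D.inter_subset _ hadj _ hadj' (hsym huv huv' heq) _
        (hseg hadj hi hz) (hseg hadj' hj hz')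
      exact ⟨hpt huv hadj hi hz, hpt huv' hadj' hj hz'⟩
  · have hinner : ∀ {u v}, u < v → G.Adj u v → ∀ {i}, i < k u v → ∀ {w},
        p u v i = D.pos w → w = u := by
      intro u v huv hadj i hi w hw
      have h1 := D.mem_of_pos_mem _ hadj w (hw ▸ hcorner hadj hi.le)
      rcases Sym2.mem_iff.mp h1 with rfl | rfl
      · rfl
      · exfalso
        refine polygonal_corner_ne_last (hp1 _ _ hadj) (hp2 _ _ hadj) hi ?_
        rw [hw, hpk _ _ hadj]
    -- The corners of an edge other than its last one go to the branch set of its smaller end, so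
    -- exactly the last segment leads to the branch set of the other end.
    refine ⟨fun v => {x | x.1 = D.pos v ∨ ∃ v', v < v' ∧ G.Adj v v' ∧ ∃ i < k v v',
      x.1 = p v v' i}, ?_, ?_, ?_⟩
    · intro v v' hne
      rw [Set.disjoint_left]
      rintro x (h | ⟨u, hu, hadj, i, hi, h⟩) (h' | ⟨u', hu', hadj', j, hj, h'⟩)
      · exact hne (D.pos_injective (h.symm.trans h'))
      · exact hne (hinner hu' hadj' hj (h'.symm.trans h))
      · exact hne (hinner hu hadj hi (h.symm.trans h')).symm
      · have hne' : (v, u) ≠ (v', u') := fun h => hne (Prod.ext_iff.mp h).1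
        obtain ⟨w, _, _, hw⟩ := D.inter_subset _ hadj _ hadj' (hsym hu hu' hne') x.1
          (h ▸ hcorner hadj hi.le) (h' ▸ hcorner hadj' hj.le)
        exact hne ((hinner hu hadj hi (h.symm.trans hw)).symm.trans
          (hinner hu' hadj' hj (h'.symm.trans hw)))
    · intro v
      refine ConnOn.of_center (⟨D.pos v, hTpos v⟩ : T) ?_
      rintro ⟨z, hz⟩ (h | ⟨u, hu, hadj, i, hi, h⟩)
      · simp only at h
        subst h
        exact Relation.ReflTransGen.refl
      · simp only at h
        subst h
        induction i with
        | zero =>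
          have h0 := hp0 _ _ hadj
          have : (⟨p v u 0, hz⟩ : T) = ⟨D.pos v, hTpos v⟩ := Subtype.ext h0
          rw [this]
        | succ i ih =>
          refine (ih (by omega) (hTp hu hadj (by omega))).tail ⟨?_, ?_, ?_⟩
          · exact ⟨v, u, hu, hadj, i, by omega, Or.inl ⟨rfl, rfl⟩⟩
          · exact Or.inr ⟨u, hu, hadj, i, by omega, rfl⟩
          · exact Or.inr ⟨u, hu, hadj, i + 1, hi, rfl⟩
    · have key : ∀ {v v'}, v < v' → G.Adj v v' → ∃ a b : T,
          (a.1 = D.pos v ∨ ∃ v', v < v' ∧ G.Adj v v' ∧ ∃ i < k v v', a.1 = p v v' i) ∧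
          b.1 = D.pos v' ∧ G'.Adj a b := by
        intro v v' hv hadj
        obtain ⟨l, hl⟩ : ∃ l, k v v' = l + 1 := ⟨k v v' - 1, by have := hkpos hadj; omega⟩
        refine ⟨⟨p v v' l, hTp hv hadj (by omega)⟩, ⟨D.pos v', hTpos v'⟩,
          Or.inr ⟨v', hv, hadj, l, by omega, rfl⟩, rfl, ⟨v, v', hv, hadj, l, by omega,
          Or.inl ⟨rfl, ?_⟩⟩⟩
        simp only
        rw [← hpk _ _ hadj, hl]
      intro v v' hadj
      rcases lt_or_gt_of_ne hadj.ne with h | h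
      · obtain ⟨a, b, ha, hb, hab⟩ := key h hadj
        exact ⟨a, ha, b, Or.inl hb, hab⟩
      · obtain ⟨a, b, ha, hb, hab⟩ := key h hadj.symm
        exact ⟨b, Or.inl hb, a, ha, hab.symm⟩

end SimpleGraph

open SimpleGraph in
/-- The minors of a finite planar graph have abstract duals. -/
theorem IsPlanar.hasAbstractDual_of_isMinorOf {V W : Type*} [Finite V] [Fintype W]
    {G : SimpleGraph V} (hG : IsPlanar G) {Q : SimpleGraph W} (hQ : Q.IsMinorOf G) :
    Q.HasAbstractDual := by
  obtain ⟨D⟩ := hG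
  obtain ⟨S, hS, G', pos, hG', hmin⟩ := exists_straight_of_planeDrawing D
  have := Fintype.ofFinite S
  exact HasAbstractDual.of_isMinorOf (fun H hH => (hG'.mono hH).hasAbstractDual) (hQ.trans hmin)

/-! ### The excluded minors `K₃,₃` and `K₅` in use. -/

open SimpleGraph

namespace SimpleGraph

variable {V : Type*} {G : SimpleGraph V}

theorem ConnOn.singleton (v : V) : G.ConnOn {v} := by
  rintro a rfl b rfl
  exact Relation.ReflTransGen.refl

theorem ConnOn.union {S T : Set V} (hS : G.ConnOn S) (hT : G.ConnOn T) {a b : V} (ha : a ∈ S)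
    (hb : b ∈ T) (hab : G.Adj a b) : G.ConnOn (S ∪ T) := by
  refine ConnOn.of_center a ?_
  rintro x (hx | hx)
  · exact Relation.ReflTransGen.mono (fun u v h => ⟨h.1, Or.inl h.2.1, Or.inl h.2.2⟩) _ _
      (hS a ha x hx)
  · exact (Relation.ReflTransGen.single ⟨hab, Or.inl ha, Or.inr hb⟩).trans
      (Relation.ReflTransGen.mono (fun u v h => ⟨h.1, Or.inr h.2.1, Or.inr h.2.2⟩) _ _
        (hT b hb x hx))

theorem ConnOn.star (y : V) {Z : Set V} (hZ : ∀ z ∈ Z, G.Adj y z) : G.ConnOn (insert y Z) := by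
  refine ConnOn.of_center y ?_
  rintro x (rfl | hx)
  · exact Relation.ReflTransGen.refl
  · exact Relation.ReflTransGen.single ⟨hZ x hx, Or.inl rfl, Or.inr hx⟩

theorem ConnOn.insert {S : Set V} (hS : G.ConnOn S) {a b : V} (ha : a ∈ S) (hab : G.Adj a b) :
    G.ConnOn (insert b S) := by
  rw [← Set.union_singleton]
  exact hS.union (ConnOn.singleton b) ha rfl hab

/-- `x` is a vertex outside `P` with a neighbour in `P`. -/
def Touches (G : SimpleGraph V) (P : Set V) (x : V) : Prop := x ∉ P ∧ ∃ a ∈ P, G.Adj x a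

theorem touches_singleton {w x : V} : G.Touches {w} x ↔ G.Adj x w := by
  refine ⟨?_, fun h => ⟨fun h' => h.ne h', w, rfl, h⟩⟩
  rintro ⟨_, a, rfl, h⟩
  exact h

end SimpleGraph

namespace IsPlanar

variable {V : Type*} [Finite V] {G : SimpleGraph V}

/-- A planar graph has no minor `K₃,₃`. -/
theorem card_le_two (hG : IsPlanar G) {P₁ P₂ P₃ : Set V} (c₁ : G.ConnOn P₁) (c₂ : G.ConnOn P₂)
    (c₃ : G.ConnOn P₃) (d₁₂ : Disjoint P₁ P₂) (d₁₃ : Disjoint P₁ P₃) (d₂₃ : Disjoint P₂ P₃)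
    (X : Finset V) (h₁ : ∀ x ∈ X, G.Touches P₁ x) (h₂ : ∀ x ∈ X, G.Touches P₂ x)
    (h₃ : ∀ x ∈ X, G.Touches P₃ x) : #X ≤ 2 := by
  by_contra hcon
  obtain ⟨Y, hYX, hY⟩ := Finset.exists_subset_card_eq (show 3 ≤ #X by omega)
  let P : Fin 3 → Set V := ![P₁, P₂, P₃]
  have hPc : ∀ i, G.ConnOn (P i) := by
    intro i; fin_cases i
    exacts [c₁, c₂, c₃]
  have hPt : ∀ i, ∀ x ∈ Y, G.Touches (P i) x := by
    intro i x hx; fin_cases i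
    exacts [h₁ x (hYX hx), h₂ x (hYX hx), h₃ x (hYX hx)]
  have hPd : ∀ i j, i ≠ j → Disjoint (P i) (P j) := by
    intro i j hij
    fin_cases i <;> fin_cases j
    exacts [absurd rfl hij, d₁₂, d₁₃, d₁₂.symm, absurd rfl hij, d₂₃, d₁₃.symm, d₂₃.symm,
      absurd rfl hij]
  have hmin : (completeBipartiteGraph Y (Fin 3)).IsMinorOf G := by
    refine ⟨Sum.elim (fun y => {y.1}) P, ?_, ?_, ?_⟩
    · rintro (y | i) (y' | j) hne
      · simp only [Sum.elim_inl, Set.disjoint_singleton]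
        exact fun h => hne (congrArg Sum.inl (Subtype.ext h))
      · simpa using (hPt j y.1 y.2).1
      · simpa using (hPt i y'.1 y'.2).1
      · exact hPd i j fun h => hne (congrArg Sum.inr h)
    · rintro (y | i)
      · exact ConnOn.singleton _
      · exact hPc i
    · rintro (y | i) (y' | j) hadj
      · simp at hadj
      · obtain ⟨a, ha, hya⟩ := (hPt j y.1 y.2).2
        exact ⟨y.1, rfl, a, ha, hya⟩
      · obtain ⟨a, ha, hya⟩ := (hPt i y'.1 y'.2).2
        exact ⟨a, ha, y'.1, rfl, hya.symm⟩
      · simp at hadj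
  have h1 := (hG.hasAbstractDual_of_isMinorOf hmin).card_darts_le_of_triangleFree
    (by simp [hY]) (by
      rintro (a | a) (b | b) (d | d) h1 h2 h3 <;> simp at h1 h2 h3)
  have h2 : Nat.card {d : (Y ⊕ Fin 3) × (Y ⊕ Fin 3) //
      (completeBipartiteGraph Y (Fin 3)).Adj d.1 d.2} = 18 := by
    let e : {d : (Y ⊕ Fin 3) × (Y ⊕ Fin 3) // (completeBipartiteGraph Y (Fin 3)).Adj d.1 d.2} ≃
        (Y × Fin 3) ⊕ (Y × Fin 3) :=
      { toFun := fun d => match d with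
          | ⟨(Sum.inl y, Sum.inr i), _⟩ => Sum.inl (y, i)
          | ⟨(Sum.inr i, Sum.inl y), _⟩ => Sum.inr (y, i)
          | ⟨(Sum.inl y, Sum.inl y'), h⟩ => absurd h (by simp)
          | ⟨(Sum.inr y, Sum.inr y'), h⟩ => absurd h (by simp)
        invFun := fun s => match s with
          | Sum.inl (y, i) => ⟨(Sum.inl y, Sum.inr i), by simp⟩
          | Sum.inr (y, i) => ⟨(Sum.inr i, Sum.inl y), by simp⟩
        left_inv := by
          rintro ⟨⟨y | i, y' | i'⟩, h⟩
          · simp at h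
          · rfl
          · rfl
          · simp at h
        right_inv := by
          rintro (⟨y, i⟩ | ⟨y, i⟩) <;> rfl }
    rw [Nat.card_congr e]
    simp [hY]
  -- `K₃,₃` has 18 darts, but a triangle-free graph on six vertices with a dual has at most 16.
  rw [h2, Fintype.card_sum, Fintype.card_coe, hY, Fintype.card_fin] at h1
  omega

/-- A planar graph has no minor `K₅`. -/
theorem not_K5 (hG : IsPlanar G) (B : Fin 5 → Set V) (hc : ∀ i, G.ConnOn (B i))
    (hd : ∀ i j, i < j → Disjoint (B i) (B j))
    (ha : ∀ i j, i < j → ∃ a ∈ B i, ∃ b ∈ B j, G.Adj a b) : False := by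
  have hmin : (⊤ : SimpleGraph (Fin 5)).IsMinorOf G := by
    refine ⟨B, ?_, hc, ?_⟩
    · intro i j hij
      rcases lt_or_gt_of_ne hij with h | h
      · exact hd i j h
      · exact (hd j i h).symm
    · intro i j hij
      rcases lt_or_gt_of_ne hij.ne with h | h
      · exact ha i j h
      · obtain ⟨a, ha, b, hb, hab⟩ := ha j i h
        exact ⟨b, hb, a, ha, hab.symm⟩
  have h1 := (hG.hasAbstractDual_of_isMinorOf hmin).card_darts_le (by simp)
  have h2 : Nat.card {d : Fin 5 × Fin 5 // (⊤ : SimpleGraph (Fin 5)).Adj d.1 d.2} = 20 := by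
    rw [Nat.card_eq_fintype_card]
    decide
  -- `K₅` has 20 darts, but a graph on five vertices with a dual has at most 18.
  rw [h2, Fintype.card_fin] at h1
  omega

/-- If `y` reaches all vertices of `X` by walks of length at most two that avoid two disjoint
connected sets adjacent to all of `X`, then `X` has at most two elements. -/
theorem card_le_two_of_reach (hG : IsPlanar G) {P₁ P₂ : Set V} (c₁ : G.ConnOn P₁)
    (c₂ : G.ConnOn P₂) (d₁₂ : Disjoint P₁ P₂) (X : Finset V) (h₁ : ∀ x ∈ X, G.Touches P₁ x)
    (h₂ : ∀ x ∈ X, G.Touches P₂ x) {y : V} (hy₁ : y ∉ P₁) (hy₂ : y ∉ P₂) (hyX : y ∉ X)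
    (h : ∀ x ∈ X, G.Adj y x ∨ ∃ z, z ∉ P₁ ∧ z ∉ P₂ ∧ z ∉ X ∧ G.Adj y z ∧ G.Adj z x) :
    #X ≤ 2 := by
  let Z : Set V := {z | z ∉ P₁ ∧ z ∉ P₂ ∧ z ∉ X ∧ G.Adj y z}
  refine hG.card_le_two (P₃ := insert y Z) c₁ c₂ (ConnOn.star y fun z hz => hz.2.2.2) d₁₂ ?_ ?_ X
    h₁ h₂ ?_
  · rw [Set.disjoint_right]
    rintro z (rfl | hz)
    exacts [hy₁, hz.1]
  · rw [Set.disjoint_right]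
    rintro z (rfl | hz)
    exacts [hy₂, hz.2.1]
  · intro x hx
    refine ⟨?_, ?_⟩
    · rintro (rfl | hz)
      exacts [hyX hx, hz.2.2.1 hx]
    · rcases h x hx with h' | ⟨z, hz₁, hz₂, hzX, hyz, hzx⟩
      · exact ⟨y, Or.inl rfl, h'.symm⟩
      · exact ⟨z, Or.inr ⟨hz₁, hz₂, hzX, hyz⟩, hzx.symm⟩

/-- Suppose that `X` contains `x`, `y`, `z`, and let `a`, `b`, `c` be further common neighbours of
the three pairs. If two of these coincide, that vertex together with `w` and `h` makes a `K₃,₃`.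
Otherwise `{x, a}`, `{y, b}`, `{z, c}`, `{w}` and `h` with `P` form a `K₅`, where `P` supplies the
link between `w` and `h`. -/
theorem fiber_le_two (hG : IsPlanar G) (htri : ∀ a b d, G.Adj a b → G.Adj b d → ¬ G.Adj a d)
    {w h : V} (hwh : w ≠ h) {P : Set V} (hP : G.ConnOn P) (hwP : G.Touches P w)
    (hhP : G.Touches P h) (X : Finset V) (hw : ∀ x ∈ X, G.Adj w x) (hh : ∀ x ∈ X, G.Adj h x)
    (hXP : ∀ x ∈ X, x ∉ P)
    (hX : ∀ x ∈ X, ∀ y ∈ X, x ≠ y → ∃ a, a ≠ w ∧ a ≠ h ∧ a ∉ P ∧ G.Adj a x ∧ G.Adj a y) :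
    #X ≤ 2 := by
  classical
  by_contra hcon
  obtain ⟨x, hx, y, hy, z, hz, hxy, hxz, hyz⟩ := Finset.two_lt_card.mp (not_le.mp hcon)
  obtain ⟨a, haw, hah, haP, hax, hay⟩ := hX x hx y hy hxy
  obtain ⟨b, hbw, hbh, hbP, hby, hbz⟩ := hX y hy z hz hyz
  obtain ⟨c, hcw, hch, hcP, hcx, hcz⟩ := hX x hx z hz hxz
  have hthree : ∀ a, a ≠ w → a ≠ h → G.Adj a x → G.Adj a y → ¬ G.Adj a z := by
    intro a haw hah hax hay haz
    have h3 : #({x, y, z} : Finset V) = 3 := Finset.card_eq_three.mpr ⟨x, y, z, hxy, hxz, hyz, rfl⟩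
    have := hG.card_le_two (ConnOn.singleton w) (ConnOn.singleton h) (ConnOn.singleton a)
      (by simpa using hwh) (by simpa using haw.symm) (by simpa using hah.symm) {x, y, z}
      (by simp [touches_singleton, (hw x hx).symm, (hw y hy).symm, (hw z hz).symm])
      (by simp [touches_singleton, (hh x hx).symm, (hh y hy).symm, (hh z hz).symm])
      (by simp [touches_singleton, hax.symm, hay.symm, haz.symm])
    omega
  have hnoadj : ∀ u ∈ X, ∀ v ∈ X, ¬ G.Adj u v := fun u hu v hv =>
    htri u w v (hw u hu).symm (hw v hv)
  have hab : a ≠ b := by rintro rfl; exact hthree a haw hah hax hay hbz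
  have hac : a ≠ c := by rintro rfl; exact hthree a haw hah hax hay hcz
  have hbc : b ≠ c := by rintro rfl; exact hthree b hbw hbh hcx hby hbz
  have haX : a ∉ X := fun h' => hnoadj a h' x hx hax
  have hbX : b ∉ X := fun h' => hnoadj b h' y hy hby
  have hcX : c ∉ X := fun h' => hnoadj c h' x hx hcx
  have hne : ∀ {u v}, u ∈ X → v ∉ X → u ≠ v := fun hu hv h => hv (h ▸ hu)
  obtain ⟨hwP, p, hp, hwp⟩ := hwP
  obtain ⟨hhP, p', hp', hhp'⟩ := hhP
  refine hG.not_K5 ![{x, a}, {y, b}, {z, c}, {w}, insert h P] ?_ ?_ ?_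
  · intro i
    fin_cases i
    · exact ConnOn.star x (by rintro _ rfl; exact hax.symm)
    · exact ConnOn.star y (by rintro _ rfl; exact hby.symm)
    · exact ConnOn.star z (by rintro _ rfl; exact hcz.symm)
    · exact ConnOn.singleton w
    · exact hP.insert hp' hhp'.symm
  · have hwx := fun v hv => (hw v hv).ne
    have hhx := fun v hv => (hh v hv).ne
    have e1 := hne hx hbX
    have e2 := hne hx hcX
    have e3 := hne hy haX
    have e4 := hne hy hcX
    have e5 := hne hz haX
    have e6 := hne hz hbX
    have f1 := hwx x hx
    have f2 := hwx y hy
    have f3 := hwx z hz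
    have g1 := hhx x hx
    have g2 := hhx y hy
    have g3 := hhx z hz
    have p1 := hXP x hx
    have p2 := hXP y hy
    have p3 := hXP z hz
    intro i j hij
    fin_cases i <;> fin_cases j <;> simp at hij <;>
      simp [Set.disjoint_left] <;> grind
  · intro i j hij
    fin_cases i <;> fin_cases j <;> simp at hij
    · exact ⟨a, by simp, y, by simp, hay⟩
    · exact ⟨x, by simp, c, by simp, hcx.symm⟩
    · exact ⟨x, by simp, w, by simp, (hw x hx).symm⟩
    · exact ⟨x, by simp, h, by simp, (hh x hx).symm⟩
    · exact ⟨b, by simp, z, by simp, hbz⟩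
    · exact ⟨y, by simp, w, by simp, (hw y hy).symm⟩
    · exact ⟨y, by simp, h, by simp, (hh y hy).symm⟩
    · exact ⟨z, by simp, w, by simp, (hw z hz).symm⟩
    · exact ⟨z, by simp, h, by simp, (hh z hz).symm⟩
    · exact ⟨w, by simp, p, by simp [hp], hwp⟩

/-- Four or more neighbours of `w`, any two of which have another common neighbour, have a common
neighbour different from `w`. -/
theorem exists_hub (hG : IsPlanar G) (htri : ∀ a b d, G.Adj a b → G.Adj b d → ¬ G.Adj a d)
    {w : V} (X : Finset V) (hw : ∀ x ∈ X, G.Adj w x)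
    (hX : ∀ x ∈ X, ∀ y ∈ X, x ≠ y → ∃ a, a ≠ w ∧ G.Adj a x ∧ G.Adj a y) (h4 : 4 ≤ #X) :
    ∃ h, h ≠ w ∧ ∀ x ∈ X, G.Adj h x := by
  classical
  have hnoadj : ∀ u ∈ X, ∀ v ∈ X, ¬ G.Adj u v := fun u hu v hv =>
    htri u w v (hw u hu).symm (hw v hv)
  -- If no vertex other than `w` is adjacent to three elements of `X`, then the second common
  -- neighbours of the six pairs among four elements are distinct. Contracting each onto one element
  -- of its pair and adding `w` makes a `K₅`.
  have hthree : ∃ h, h ≠ w ∧ 3 ≤ #{x ∈ X | G.Adj h x} := by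
    by_contra! hcon
    have hno : ∀ a, a ≠ w → ∀ x ∈ X, ∀ y ∈ X, ∀ z ∈ X, x ≠ y → x ≠ z → y ≠ z →
        G.Adj a x → G.Adj a y → ¬ G.Adj a z := by
      intro a haw x hx y hy z hz hxy hxz hyz hax hay haz
      have h3 : #({x, y, z} : Finset V) = 3 :=
        Finset.card_eq_three.mpr ⟨x, y, z, hxy, hxz, hyz, rfl⟩
      have hsub : ({x, y, z} : Finset V) ⊆ {x ∈ X | G.Adj a x} := by
        intro v hv
        simp only [mem_insert, mem_singleton] at hv
        rw [mem_filter]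
        rcases hv with rfl | rfl | rfl
        exacts [⟨hx, hax⟩, ⟨hy, hay⟩, ⟨hz, haz⟩]
      have := Finset.card_le_card hsub
      have := hcon a haw
      omega
    obtain ⟨Y, hYX, hY⟩ := Finset.exists_subset_card_eq h4
    obtain ⟨x, y, z, t, hxy, hxz, hxt, hyz, hyt, hzt, rfl⟩ := Finset.card_eq_four.mp hY
    have hx : x ∈ X := hYX (by simp)
    have hy : y ∈ X := hYX (by simp)
    have hz : z ∈ X := hYX (by simp)
    have ht : t ∈ X := hYX (by simp)
    obtain ⟨a, haw, hax, hay⟩ := hX x hx y hy hxy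
    obtain ⟨b, hbw, hbx, hbz⟩ := hX x hx z hz hxz
    obtain ⟨c, hcw, hcx, hct⟩ := hX x hx t ht hxt
    obtain ⟨d, hdw, hdy, hdz⟩ := hX y hy z hz hyz
    obtain ⟨e, hew, hey, het⟩ := hX y hy t ht hyt
    obtain ⟨f, hfw, hfz, hft⟩ := hX z hz t ht hzt
    have hnX : ∀ a, ∀ x ∈ X, G.Adj a x → a ∉ X := fun a x hx hax ha => hnoadj a ha x hx hax
    have a0 := hnX a x hx hax
    have b0 := hnX b x hx hbx
    have c0 := hnX c x hx hcx
    have d0 := hnX d y hy hdy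
    have e0 := hnX e y hy hey
    have f0 := hnX f z hz hfz
    have hwx := (hw x hx).ne
    have hwy := (hw y hy).ne
    have hwz := (hw z hz).ne
    have hwt := (hw t ht).ne
    have a1 := hno a haw x hx y hy z hz hxy hxz hyz hax hay
    have a2 := hno a haw x hx y hy t ht hxy hxt hyt hax hay
    have b2 := hno b hbw x hx z hz t ht hxz hxt hzt hbx hbz
    have b1 : ¬ G.Adj b y := fun h => hno b hbw x hx y hy z hz hxy hxz hyz hbx h hbz
    have c1 : ¬ G.Adj c y := fun h => hno c hcw x hx y hy t ht hxy hxt hyt hcx h hct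
    have c2 : ¬ G.Adj c z := fun h => hno c hcw x hx z hz t ht hxz hxt hzt hcx h hct
    have d2 := hno d hdw y hy z hz t ht hyz hyt hzt hdy hdz
    have e2 : ¬ G.Adj e z := fun h => hno e hew y hy z hz t ht hyz hyt hzt hey h het
    have n : ∀ {u v s : V}, G.Adj u s → ¬ G.Adj v s → u ≠ v := fun h h' e => h' (e ▸ h)
    have n1 := n hay b1
    have n2 := n hay c1
    have n3 := n hbz c2
    have n4 : a ≠ d := (n hdz a1).symm
    have n5 : a ≠ e := (n het a2).symm
    have n6 : a ≠ f := (n hft a2).symm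
    have n7 : b ≠ d := (n hdy b1).symm
    have n8 : b ≠ e := (n hey b1).symm
    have n9 : b ≠ f := (n hft b2).symm
    have n10 : c ≠ d := (n hdy c1).symm
    have n11 : c ≠ e := (n hey c1).symm
    have n12 : c ≠ f := (n hfz c2).symm
    have n13 : d ≠ e := (n het d2).symm
    have n14 : d ≠ f := (n hft d2).symm
    have n15 : e ≠ f := (n hfz e2).symm
    refine hG.not_K5 ![{x, a, b, c}, {y, d, e}, {z, f}, {t}, {w}] ?_ ?_ ?_
    · intro i
      fin_cases i
      · exact ConnOn.star x (by rintro _ (rfl | rfl | rfl); exacts [hax.symm, hbx.symm, hcx.symm])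
      · exact ConnOn.star y (by rintro _ (rfl | rfl); exacts [hdy.symm, hey.symm])
      · exact ConnOn.star z (by rintro _ rfl; exact hfz.symm)
      · exact ConnOn.singleton t
      · exact ConnOn.singleton w
    · intro i j hij
      fin_cases i <;> fin_cases j <;> simp at hij <;>
        simp [Set.disjoint_left] <;> grind
    · intro i j hij
      fin_cases i <;> fin_cases j <;> simp at hij
      · exact ⟨a, by simp, y, by simp, hay⟩
      · exact ⟨b, by simp, z, by simp, hbz⟩
      · exact ⟨c, by simp, t, by simp, hct⟩
      · exact ⟨x, by simp, w, by simp, (hw x hx).symm⟩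
      · exact ⟨d, by simp, z, by simp, hdz⟩
      · exact ⟨e, by simp, t, by simp, het⟩
      · exact ⟨y, by simp, w, by simp, (hw y hy).symm⟩
      · exact ⟨f, by simp, t, by simp, hft⟩
      · exact ⟨z, by simp, w, by simp, (hw z hz).symm⟩
      · exact ⟨t, by simp, w, by simp, (hw t ht).symm⟩
  obtain ⟨h, hhw, h3⟩ := hthree
  refine ⟨h, hhw, ?_⟩
  by_contra! hcon
  obtain ⟨y, hyX, hhy⟩ := hcon
  obtain ⟨x₀, hx₀⟩ := Finset.card_pos.mp (show 0 < #{x ∈ X | G.Adj h x} by omega)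
  rw [mem_filter] at hx₀
  -- An element `y` of `X` not adjacent to `h` would reach the three common neighbours of `w` and
  -- `h` through vertices other than `w` and `h`, which makes a `K₃,₃`.
  have := hG.card_le_two_of_reach (ConnOn.singleton w) (ConnOn.singleton h)
    (by simpa using hhw.symm) {x ∈ X | G.Adj h x}
    (fun x hx => touches_singleton.mpr (hw x (mem_filter.mp hx).1).symm)
    (fun x hx => touches_singleton.mpr (mem_filter.mp hx).2.symm) (y := y)
    (fun h' => (hw y hyX).ne' h')
    (by
      rintro rfl
      exact hnoadj _ hyX _ hx₀.1 hx₀.2)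
    (fun h' => hhy (mem_filter.mp h').2)
    (by
      intro x hx
      rw [mem_filter] at hx
      obtain ⟨a, haw, hay, hax⟩ := hX y hyX x hx.1 (by rintro rfl; exact hhy hx.2)
      refine Or.inr ⟨a, haw, ?_, ?_, hay.symm, hax⟩
      · rintro rfl
        exact hhy hay
      · intro h'
        exact hnoadj a (mem_filter.mp h').1 x hx.1 hax)
  omega

end IsPlanar

/-- `R` is a set of vertices of a triangle-free planar graph, any two of which are adjacent or have
a common neighbour that sees them in different colours. -/
structure IsColoredClique {V C : Type*} (G : SimpleGraph V) (R : Finset V) (col : V → V → C) :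
    Prop where
  planar : IsPlanar G
  tri : ∀ a b d, G.Adj a b → G.Adj b d → ¬ G.Adj a d
  rel : ∀ u ∈ R, ∀ v ∈ R, u ≠ v →
    G.Adj u v ∨ ∃ z, G.Adj z u ∧ G.Adj z v ∧ col z u ≠ col z v

/-! ### Stars and colour classes in a coloured clique. -/

namespace IsColoredClique

variable {V C : Type*} {G : SimpleGraph V} {R : Finset V}
  {col : V → V → C}

theorem exists_ne (hR : IsColoredClique G R col) {u v w : V} (hu : u ∈ R) (hv : v ∈ R)
    (huv : u ≠ v) (hwu : G.Adj w u) (hwv : G.Adj w v) (hcol : col w u = col w v) :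
    ∃ a, a ≠ w ∧ G.Adj a u ∧ G.Adj a v ∧ col a u ≠ col a v := by
  rcases hR.rel u hu v hv huv with h | ⟨z, hzu, hzv, hz⟩
  · exact absurd h (hR.tri u w v hwu.symm hwv)
  · exact ⟨z, by rintro rfl; exact hz hcol, hzu, hzv, hz⟩

variable [Finite V]

/-- Among at least four common neighbours of `w` and `h` in `R`, at most two are seen by `w` and
by `h` in given colours. -/
theorem card_fiber_le_two (hR : IsColoredClique G R col) {w h : V} (hwh : w ≠ h) {T : Finset V}
    (hT : T ⊆ R) (hw : ∀ x ∈ T, G.Adj w x) (hh : ∀ x ∈ T, G.Adj h x) (h4 : 4 ≤ #T) {F : Finset V}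
    (hF : F ⊆ T) (hFw : ∀ x ∈ F, ∀ y ∈ F, col w x = col w y)
    (hFh : ∀ x ∈ F, ∀ y ∈ F, col h x = col h y) : #F ≤ 2 := by
  by_contra hcon
  obtain ⟨X, hXF, hX⟩ := Finset.exists_subset_card_eq (show 3 ≤ #F by omega)
  -- A fourth common neighbour `t` serves as the set that links `w` and `h`. It is no witness for a
  -- pair in `X`, as the graph has no triangles.
  obtain ⟨t, htT, htX⟩ := Finset.exists_mem_notMem_of_card_lt_card (show #X < #T by omega)
  have := hR.planar.fiber_le_two hR.tri hwh (ConnOn.singleton t)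
    (touches_singleton.mpr (hw t htT)) (touches_singleton.mpr (hh t htT)) X
    (fun x hx => hw x (hF (hXF hx))) (fun x hx => hh x (hF (hXF hx)))
    (by rintro x hx rfl; exact htX hx) (by
      intro x hx y hy hxy
      obtain ⟨a, haw, hax, hay, hne⟩ := hR.exists_ne (hT (hF (hXF hx))) (hT (hF (hXF hy))) hxy
        (hw x (hF (hXF hx))) (hw y (hF (hXF hy))) (hFw x (hXF hx) y (hXF hy))
      refine ⟨a, haw, ?_, ?_, hax, hay⟩
      · rintro rfl
        exact hne (hFh x (hXF hx) y (hXF hy))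
      · rintro rfl
        exact hR.tri a w x (hw a htT).symm (hw x (hF (hXF hx))) hax)
  omega

/-- A large colour class at `w` has a second common neighbour. -/
theorem exists_hub (hR : IsColoredClique G R col) {w : V} {T : Finset V} (hT : T ⊆ R)
    (hw : ∀ x ∈ T, G.Adj w x) (hc : ∀ x ∈ T, ∀ y ∈ T, col w x = col w y) (h4 : 4 ≤ #T) :
    ∃ h, h ≠ w ∧ ∀ x ∈ T, G.Adj h x :=
  hR.planar.exists_hub hR.tri T hw (fun x hx y hy hxy => by
    obtain ⟨a, h1, h2, h3, _⟩ := hR.exists_ne (hT hx) (hT hy) hxy (hw x hx) (hw y hy)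
      (hc x hx y hy)
    exact ⟨a, h1, h2, h3⟩) h4

/-- The second common neighbour `h` sees the class in at most `|C|` colours, each at most twice.
Classes with fewer than four elements are covered by `2 ≤ |C|`. -/
theorem card_class_le [Fintype C] [DecidableEq C] (hR : IsColoredClique G R col)
    (hC : 2 ≤ Fintype.card C) {w : V}
    {T : Finset V} (hT : T ⊆ R) (hw : ∀ x ∈ T, G.Adj w x)
    (hc : ∀ x ∈ T, ∀ y ∈ T, col w x = col w y) : #T ≤ 2 * Fintype.card C := by
  by_cases h4 : 4 ≤ #T
  · obtain ⟨h, hhw, hh⟩ := hR.exists_hub hT hw hc h4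
    refine (Finset.card_le_mul_card_image (f := col h) T 2 fun b _ => ?_).trans
      (Nat.mul_le_mul_left 2 (Finset.card_le_univ _))
    refine hR.card_fiber_le_two hhw.symm hT hw hh h4 (filter_subset _ _) ?_ ?_
    · exact fun x hx y hy => hc x (mem_filter.mp hx).1 y (mem_filter.mp hy).1
    · exact fun x hx y hy => (mem_filter.mp hx).2.trans (mem_filter.mp hy).2.symm
  · omega

theorem card_star_le [Fintype C] [DecidableEq C] (hR : IsColoredClique G R col)
    (hC : 2 ≤ Fintype.card C) {w : V}
    {T : Finset V} (hT : T ⊆ R) (hw : ∀ x ∈ T, G.Adj w x) :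
    #T ≤ 2 * Fintype.card C * #(T.image (col w)) :=
  Finset.card_le_mul_card_image T _ fun _ _ =>
    hR.card_class_le hC ((filter_subset _ _).trans hT) (fun x hx => hw x (mem_filter.mp hx).1)
      fun _ hx _ hy => (mem_filter.mp hx).2.trans (mem_filter.mp hy).2.symm

/-- If no other vertex is adjacent to three vertices of `T`, then the colour classes of `T` have
at most three elements. -/
theorem card_star_le_of_no_hub [DecidableEq C] [DecidableRel G.Adj]
    (hR : IsColoredClique G R col) {w : V} {T : Finset V} (hT : T ⊆ R)
    (hw : ∀ x ∈ T, G.Adj w x) (hno : ∀ u, u ≠ w → #{x ∈ T | G.Adj u x} ≤ 2) :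
    #T ≤ 3 * #(T.image (col w)) := by
  refine Finset.card_le_mul_card_image T _ fun b _ => ?_
  by_contra hcon
  obtain ⟨h, hhw, hh⟩ := hR.exists_hub (w := w) (T := {x ∈ T | col w x = b})
    ((filter_subset _ _).trans hT) (fun x hx => hw x (mem_filter.mp hx).1)
    (fun x hx y hy => (mem_filter.mp hx).2.trans (mem_filter.mp hy).2.symm) (by omega)
  have h1 : #{x ∈ T | col w x = b} ≤ #{x ∈ T | G.Adj h x} :=
    Finset.card_le_card fun x hx => mem_filter.mpr ⟨(mem_filter.mp hx).1, hh x hx⟩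
  have := hno h hhw
  omega

/-- A vertex of `R` outside a `K_{2,k}` with `k ≥ 3` is adjacent to one of the two centres. -/
theorem adj_of_three (hR : IsColoredClique G R col) {w h y : V} (hwh : w ≠ h) {X : Finset V}
    (hX : X ⊆ R) (hw : ∀ x ∈ X, G.Adj w x) (hh : ∀ x ∈ X, G.Adj h x) (h3 : 3 ≤ #X) (hy : y ∈ R)
    (hyw : y ≠ w) (hyh : y ≠ h) : G.Adj w y ∨ G.Adj h y := by
  by_contra! hcon
  have hyX : y ∉ X := fun h' => hcon.1 (hw y h')
  have := hR.planar.card_le_two_of_reach (ConnOn.singleton w) (ConnOn.singleton h)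
    (by simpa using hwh) X (fun x hx => touches_singleton.mpr (hw x hx).symm)
    (fun x hx => touches_singleton.mpr (hh x hx).symm) (y := y) hyw hyh hyX (by
      intro x hx
      rcases hR.rel y hy x (hX hx) (by rintro rfl; exact hyX hx) with h' | ⟨z, hzy, hzx, _⟩
      · exact Or.inl h'
      · refine Or.inr ⟨z, ?_, ?_, ?_, hzy.symm, hzx⟩
        · rintro rfl; exact hcon.1 hzy
        · rintro rfl; exact hcon.2 hzy
        · exact fun h' => hR.tri z w x (hw z h').symm (hw x hx) hzx)
  omega

end IsColoredClique

/-! ### The case without three common neighbours. -/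

namespace SimpleGraph

/-- Six vertices of a triangle-free graph contain three pairwise nonadjacent ones. -/
theorem exists_independent_triple {V : Type*} {G : SimpleGraph V}
    (htri : ∀ a b d, G.Adj a b → G.Adj b d → ¬ G.Adj a d) (Y : Finset V) (hY : 6 ≤ #Y) :
    ∃ y₁ ∈ Y, ∃ y₂ ∈ Y, ∃ y₃ ∈ Y, (y₁ ≠ y₂ ∧ ¬ G.Adj y₁ y₂) ∧ (y₁ ≠ y₃ ∧ ¬ G.Adj y₁ y₃) ∧
      (y₂ ≠ y₃ ∧ ¬ G.Adj y₂ y₃) := by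
  classical
  obtain ⟨y, hy⟩ := Finset.card_pos.mp (show 0 < #Y by omega)
  have h1 := Finset.card_erase_of_mem hy
  have h2 := Finset.card_filter_add_card_filter_not (s := Y.erase y)
    (fun x => G.Adj y x)
  by_cases h3 : 3 ≤ #{x ∈ Y.erase y | G.Adj y x}
  · obtain ⟨a, ha, b, hb, c, hc, hab, hac, hbc⟩ :=
      Finset.two_lt_card.mp (show 2 < #{x ∈ Y.erase y | G.Adj y x} by omega)
    obtain ⟨ha, hya⟩ := mem_filter.mp ha
    obtain ⟨hb, hyb⟩ := mem_filter.mp hb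
    obtain ⟨hc, hyc⟩ := mem_filter.mp hc
    exact ⟨a, mem_of_mem_erase ha, b, mem_of_mem_erase hb, c, mem_of_mem_erase hc,
      ⟨hab, htri _ _ _ hya.symm hyb⟩, ⟨hac, htri _ _ _ hya.symm hyc⟩,
      ⟨hbc, htri _ _ _ hyb.symm hyc⟩⟩
  · obtain ⟨a, ha, b, hb, c, hc, hab, hac, hbc⟩ :=
      Finset.two_lt_card.mp (show 2 < #{x ∈ Y.erase y | ¬ G.Adj y x} by omega)
    obtain ⟨ha, hya⟩ := mem_filter.mp ha
    obtain ⟨hb, hyb⟩ := mem_filter.mp hb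
    obtain ⟨hc, hyc⟩ := mem_filter.mp hc
    obtain ⟨hay, haY⟩ := mem_erase.mp ha
    obtain ⟨hby, hbY⟩ := mem_erase.mp hb
    obtain ⟨hcy, hcY⟩ := mem_erase.mp hc
    by_cases h4 : G.Adj a b
    · by_cases h5 : G.Adj b c
      · exact ⟨y, hy, a, haY, c, hcY, ⟨hay.symm, hya⟩, ⟨hcy.symm, hyc⟩,
          ⟨hac, htri _ _ _ h4 h5⟩⟩
      · exact ⟨y, hy, b, hbY, c, hcY, ⟨hby.symm, hyb⟩, ⟨hcy.symm, hyc⟩, ⟨hbc, h5⟩⟩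
    · exact ⟨y, hy, a, haY, b, hbY, ⟨hay.symm, hya⟩, ⟨hby.symm, hyb⟩, ⟨hab, h4⟩⟩

end SimpleGraph

namespace IsColoredClique

variable {V C : Type*} {G : SimpleGraph V} {R : Finset V} {col : V → V → C}

/-- A vertex `y` of `R` outside the neighbourhood of `w` reaches each neighbour of `w` in `R`
through a vertex `z` that is again outside this neighbourhood, since otherwise `w`, `z`, `x` would
be a triangle. So stars of such links are disjoint from the neighbourhood of `w`. -/
theorem exists_link (hR : IsColoredClique G R col) {w y x : V} (hy : y ∈ R) (hyw : ¬ G.Adj w y)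
    (hx : x ∈ R) (hwx : G.Adj w x) :
    ∃ z, (z = y ∨ G.Adj y z) ∧ G.Adj z x ∧ ¬ G.Adj w z ∧ (y ≠ w → z ≠ w) := by
  rcases hR.rel y hy x hx (by rintro rfl; exact hyw hwx) with h | ⟨z, hzy, hzx, _⟩
  · exact ⟨y, Or.inl rfl, h, hyw, id⟩
  · refine ⟨z, Or.inr hzy.symm, hzx, fun h => hR.tri w z x h hzx hwx, fun _ => ?_⟩
    rintro rfl
    exact hyw hzy

variable [DecidableRel G.Adj] [Finite V]

/-- Two nonadjacent vertices of `R` outside the closed neighbourhood of `w` have two common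
neighbours with distinct neighbours in `R` next to `w`, unless some two vertices have three common
neighbours in `R`. -/
theorem exists_two_links (hR : IsColoredClique G R col)
    (hno : ∀ w h, w ≠ h → #{x ∈ R | G.Adj w x ∧ G.Adj h x} ≤ 2) {w y y' : V}
    (h5 : 5 ≤ #{x ∈ R | G.Adj w x}) (hy : y ∈ R) (hyw : y ≠ w) (hay : ¬ G.Adj w y) (hy' : y' ∈ R)
    (hyw' : y' ≠ w) (hay' : ¬ G.Adj w y') (hne : y ≠ y') (hyy' : ¬ G.Adj y y') :
    ∃ a b xa xb, a ≠ b ∧ ¬ G.Adj w a ∧ ¬ G.Adj w b ∧ a ≠ w ∧ b ≠ w ∧ G.Adj a y ∧ G.Adj a y' ∧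
      G.Adj b y ∧ G.Adj b y' ∧ G.Adj w xa ∧ G.Adj w xb ∧ xa ≠ xb ∧ G.Adj a xa ∧ G.Adj b xb := by
  classical
  set X : Finset V := {x ∈ R | G.Adj w x} with hX
  have hXR : ∀ {x}, x ∈ X → x ∈ R := fun h => (mem_filter.mp h).1
  have hXw : ∀ {x}, x ∈ X → G.Adj w x := fun h => (mem_filter.mp h).2
  have hf : ∀ x, x ∈ X → _ := fun x hx => hR.exists_link hy hay (hXR hx) (hXw hx)
  have hg : ∀ x, x ∈ X → _ := fun x hx => hR.exists_link hy' hay' (hXR hx) (hXw hx)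
  have : Nonempty V := ⟨w⟩
  choose! f hf1 hf2 hf3 hf4 using hf
  choose! g hg1 hg2 hg3 hg4 using hg
  let T : Set V := insert y {z | G.Adj y z ∧ ¬ G.Adj w z ∧ z ≠ w ∧ ∃ x ∈ X, f x = z}
  have hfT : ∀ x ∈ X, f x ∈ T := by
    intro x hx
    rcases hf1 x hx with h | h
    · exact Or.inl h
    · exact Or.inr ⟨h, hf3 x hx, hf4 x hx hyw, x, hx, rfl⟩
  have hTw : ∀ z ∈ T, ¬ G.Adj w z ∧ z ≠ w := by
    rintro z (rfl | h)
    exacts [⟨hay, hyw⟩, ⟨h.2.1, h.2.2.1⟩]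
  let K : Set V := insert y' {z | G.Adj y' z ∧ ¬ G.Adj w z ∧ z ≠ w ∧ z ∉ T}
  have hKw : ∀ z ∈ K, ¬ G.Adj w z ∧ z ≠ w := by
    rintro z (rfl | h)
    exacts [⟨hay', hyw'⟩, ⟨h.2.1, h.2.2.1⟩]
  have hy'T : y' ∉ T := by
    rintro (h | h)
    exacts [hne h.symm, hyy' h.1]
  -- The star `T` around `y` and the star `K` of the remaining links around `y'` are disjoint. With
  -- `w` they would make a `K₃,₃` on three neighbours of `w` reached from `y'` outside `T`. So at
  -- least three of the five neighbours are reached from `y'` through `T`, hence through common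
  -- neighbours of `y` and `y'`.
  have hfree : #{x ∈ X | g x ∉ T} ≤ 2 := by
    refine hR.planar.card_le_two (ConnOn.singleton w) (P₂ := T) (P₃ := K)
      (ConnOn.star y fun z hz => hz.1) (ConnOn.star y' fun z hz => hz.1) ?_ ?_ ?_ _ ?_ ?_ ?_
    · rw [Set.disjoint_singleton_left]
      exact fun h => (hTw w h).2 rfl
    · rw [Set.disjoint_singleton_left]
      exact fun h => (hKw w h).2 rfl
    · rw [Set.disjoint_right]
      rintro z (rfl | h)
      exacts [hy'T, h.2.2.2]
    · exact fun x hx => touches_singleton.mpr (hXw (mem_filter.mp hx).1).symm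
    · intro x hx
      have hx := (mem_filter.mp hx).1
      exact ⟨fun h => (hTw x h).1 (hXw hx), f x, hfT x hx, (hf2 x hx).symm⟩
    · intro x hx
      obtain ⟨hx, hgx⟩ := mem_filter.mp hx
      refine ⟨fun h => (hKw x h).1 (hXw hx), g x, ?_, (hg2 x hx).symm⟩
      rcases hg1 x hx with h | h
      · exact Or.inl h
      · exact Or.inr ⟨h, hg3 x hx, hg4 x hx hyw', hgx⟩
  have hsplit := Finset.card_filter_add_card_filter_not (s := X) (fun x => g x ∈ T)
  have hT3 : 3 ≤ #{x ∈ X | g x ∈ T} := by omega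
  have hcommon : ∀ x ∈ X, g x ∈ T → G.Adj (g x) y ∧ G.Adj (g x) y' := by
    intro x hx hgx
    have h1 : G.Adj y' (g x) := by
      rcases hg1 x hx with h | h
      · exact absurd (h ▸ hgx) hy'T
      · exact h
    rcases hgx with h | h
    · rw [h] at h1
      exact absurd h1.symm hyy'
    · exact ⟨h.1.symm, h1.symm⟩
  obtain ⟨x₁, hx₁⟩ := Finset.card_pos.mp (show 0 < #{x ∈ X | g x ∈ T} by omega)
  obtain ⟨hx₁X, hx₁T⟩ := mem_filter.mp hx₁
  have hle := hno w (g x₁) (hg4 x₁ hx₁X hyw').symm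
  -- A single link cannot serve all three, as it would have three common neighbours with `w` in `R`.
  obtain ⟨x₂, hx₂, hx₂'⟩ := Finset.exists_mem_notMem_of_card_lt_card
    (show #{x ∈ R | G.Adj w x ∧ G.Adj (g x₁) x} < #{x ∈ X | g x ∈ T} by omega)
  obtain ⟨hx₂X, hx₂T⟩ := mem_filter.mp hx₂
  have hnadj : ¬ G.Adj (g x₁) x₂ := fun h =>
    hx₂' (mem_filter.mpr ⟨hXR hx₂X, hXw hx₂X, h⟩)
  refine ⟨g x₁, g x₂, x₁, x₂, ?_, hg3 x₁ hx₁X, hg3 x₂ hx₂X, hg4 x₁ hx₁X hyw', hg4 x₂ hx₂X hyw',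
    (hcommon x₁ hx₁X hx₁T).1, (hcommon x₁ hx₁X hx₁T).2, (hcommon x₂ hx₂X hx₂T).1,
    (hcommon x₂ hx₂X hx₂T).2, hXw hx₁X, hXw hx₂X, ?_, hg2 x₁ hx₁X, hg2 x₂ hx₂X⟩
  · intro h
    exact hnadj (h ▸ hg2 x₂ hx₂X)
  · rintro rfl
    exact hnadj (hg2 x₁ hx₁X)

/-- If `w` has five neighbours in `R`, then three vertices of `R` outside the closed neighbourhood
of `w` are not pairwise nonadjacent, unless some two vertices have three common neighbours. -/
theorem not_independent_triple (hR : IsColoredClique G R col)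
    (hno : ∀ w h, w ≠ h → #{x ∈ R | G.Adj w x ∧ G.Adj h x} ≤ 2) {w y₁ y₂ y₃ : V}
    (h5 : 5 ≤ #{x ∈ R | G.Adj w x}) (h₁ : y₁ ∈ R ∧ y₁ ≠ w ∧ ¬ G.Adj w y₁)
    (h₂ : y₂ ∈ R ∧ y₂ ≠ w ∧ ¬ G.Adj w y₂) (h₃ : y₃ ∈ R ∧ y₃ ≠ w ∧ ¬ G.Adj w y₃)
    (h₁₂ : y₁ ≠ y₂ ∧ ¬ G.Adj y₁ y₂) (h₁₃ : y₁ ≠ y₃ ∧ ¬ G.Adj y₁ y₃)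
    (h₂₃ : y₂ ≠ y₃ ∧ ¬ G.Adj y₂ y₃) : False := by
  classical
  obtain ⟨a, b, xa, xb, hab, hwa, hwb, haw, hbw, hay₁, hay₂, hby₁, hby₂, hwxa, hwxb, hxab, haxa,
    hbxb⟩ := hR.exists_two_links hno h5 h₁.1 h₁.2.1 h₁.2.2 h₂.1 h₂.2.1 h₂.2.2 h₁₂.1 h₁₂.2
  -- Each of `a` and `b` is adjacent to at most two of the five neighbours of `w`.
  obtain ⟨x, hx, hax, hbx⟩ : ∃ x ∈ ({x ∈ R | G.Adj w x} : Finset V),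
      ¬ G.Adj a x ∧ ¬ G.Adj b x := by
    by_contra! hcon
    have hsub : ({x ∈ R | G.Adj w x} : Finset V) ⊆
        {x ∈ R | G.Adj w x ∧ G.Adj a x} ∪ {x ∈ R | G.Adj w x ∧ G.Adj b x} := by
      intro x hx
      obtain ⟨hx1, hx2⟩ := mem_filter.mp hx
      rw [mem_union, mem_filter, mem_filter]
      by_cases h : G.Adj a x
      · exact Or.inl ⟨hx1, hx2, h⟩
      · exact Or.inr ⟨hx1, hx2, hcon x hx h⟩
    have h1 := (Finset.card_le_card hsub).trans (Finset.card_union_le _ _)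
    have h2 := hno w a haw.symm
    have h3 := hno w b hbw.symm
    omega
  obtain ⟨hxR, hwx⟩ := mem_filter.mp hx
  have hneN : ∀ {u v : V}, ¬ G.Adj w u → G.Adj w v → u ≠ v := fun h h' e => h (e ▸ h')
  by_cases hc : G.Adj a y₃ ∧ G.Adj b y₃
  · -- `a`, `b` and a star around `x` are all adjacent to the three vertices
    let P : Set V := insert x {z | G.Adj x z ∧ z ≠ y₁ ∧ z ≠ y₂ ∧ z ≠ y₃}
    have hP : ∀ y, (y = y₁ ∨ y = y₂ ∨ y = y₃) → y ∈ R → ¬ G.Adj w y →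
        ¬ G.Adj y y₁ → ¬ G.Adj y y₂ → ¬ G.Adj y y₃ → G.Touches P y := by
      intro y hy hyR hwy n1 n2 n3
      refine ⟨?_, ?_⟩
      · rintro (rfl | h)
        · exact hwy hwx
        · rcases hy with rfl | rfl | rfl
          exacts [h.2.1 rfl, h.2.2.1 rfl, h.2.2.2 rfl]
      · obtain ⟨z, rfl | hz, hzx, _, _⟩ := hR.exists_link hyR hwy hxR hwx
        · exact ⟨x, Or.inl rfl, hzx⟩
        · refine ⟨z, Or.inr ⟨hzx.symm, ?_, ?_, ?_⟩, hz⟩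
          · rintro rfl; exact n1 hz
          · rintro rfl; exact n2 hz
          · rintro rfl; exact n3 hz
    have h3 : #({y₁, y₂, y₃} : Finset V) = 3 :=
      Finset.card_eq_three.mpr ⟨y₁, y₂, y₃, h₁₂.1, h₁₃.1, h₂₃.1, rfl⟩
    have := hR.planar.card_le_two (ConnOn.singleton a) (ConnOn.singleton b) (P₃ := P)
      (ConnOn.star x fun z hz => hz.1) (by simpa using hab) (by
        rw [Set.disjoint_singleton_left]
        rintro (h | h)
        exacts [hneN hwa hwx h, hax h.1.symm]) (by
        rw [Set.disjoint_singleton_left]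
        rintro (h | h)
        exacts [hneN hwb hwx h, hbx h.1.symm]) {y₁, y₂, y₃}
      (by simp [touches_singleton, hay₁.symm, hay₂.symm, hc.1.symm])
      (by simp [touches_singleton, hby₁.symm, hby₂.symm, hc.2.symm]) (by
        intro y hy
        simp only [mem_insert, mem_singleton] at hy
        have i12 := fun h : G.Adj y₂ y₁ => h₁₂.2 h.symm
        have i13 := fun h : G.Adj y₃ y₁ => h₁₃.2 h.symm
        have i23 := fun h : G.Adj y₃ y₂ => h₂₃.2 h.symm
        have hy0 := hy
        rcases hy with rfl | rfl | rfl
        · exact hP _ hy0 h₁.1 h₁.2.2 (G.loopless.irrefl _) h₁₂.2 h₁₃.2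
        · exact hP _ hy0 h₂.1 h₂.2.2 i12 (G.loopless.irrefl _) h₂₃.2
        · exact hP _ hy0 h₃.1 h₃.2.2 i13 i23 (G.loopless.irrefl _))
    omega
  -- Not both `a` and `b` are adjacent to `y₃`, so one of the two links between `y` and `y₃` is
  -- neither `a` nor `b`.
  · have hthird : ∀ y, y ∈ R → y ≠ w → ¬ G.Adj w y → y ≠ y₃ → ¬ G.Adj y y₃ →
        ∃ c, c ≠ a ∧ c ≠ b ∧ ¬ G.Adj w c ∧ G.Adj y c ∧ G.Adj y₃ c := by
      intro y hyR hyw hwy hne hadj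
      obtain ⟨a', b', _, _, hab', hwa', hwb', _, _, ha1, ha2, hb1, hb2, _⟩ :=
        hR.exists_two_links hno h5 hyR hyw hwy h₃.1 h₃.2.1 h₃.2.2 hne hadj
      by_cases e1 : a' = a
      · by_cases e2 : b' = b
        · exact absurd ⟨e1 ▸ ha2, e2 ▸ hb2⟩ hc
        · exact ⟨b', by rintro rfl; exact hab' e1, e2, hwb', hb1.symm, hb2.symm⟩
      · by_cases e2 : a' = b
        · by_cases e3 : b' = a
          · exact absurd ⟨e3 ▸ hb2, e2 ▸ ha2⟩ hc
          · exact ⟨b', e3, by rintro rfl; exact hab' e2, hwb', hb1.symm, hb2.symm⟩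
        · exact ⟨a', e1, e2, hwa', ha1.symm, ha2.symm⟩
    obtain ⟨c, hca, hcb, hwc, hy₁c, hy₃c⟩ := hthird y₁ h₁.1 h₁.2.1 h₁.2.2 h₁₃.1 h₁₃.2
    obtain ⟨e, hea, heb, hwe, hy₂e, hy₃e⟩ := hthird y₂ h₂.1 h₂.2.1 h₂.2.2 h₂₃.1 h₂₃.2
    let Q : Set V := insert y₃ {z | G.Adj y₃ z ∧ z ≠ a ∧ z ≠ b ∧ ¬ G.Adj w z}
    have hQw : ∀ z ∈ Q, ¬ G.Adj w z := by
      rintro z (rfl | h)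
      exacts [h₃.2.2, h.2.2.2]
    have hQconn : G.ConnOn (insert x Q) := by
      obtain ⟨z, hz, hzx, hwz, _⟩ := hR.exists_link h₃.1 h₃.2.2 hxR hwx
      refine (ConnOn.star y₃ fun z hz => hz.1).insert (a := z) ?_ hzx
      rcases hz with rfl | hz
      · exact Or.inl rfl
      · refine Or.inr ⟨hz, ?_, ?_, hwz⟩
        · rintro rfl; exact hax hzx
        · rintro rfl; exact hbx hzx
    have hnotQ : ∀ y, y ≠ y₃ → ¬ G.Adj y y₃ → ¬ G.Adj w y → y ∉ insert x Q := by
      rintro y hy1 hy2 hy3 (rfl | rfl | h)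
      exacts [hy3 hwx, hy1 rfl, hy2 h.1.symm]
    have hxa3 : ∀ {s t : V}, G.Adj s t → G.Adj w t → ¬ G.Adj w s → ¬ G.Adj s x → G.Adj s y₁ →
        (s = a ∨ s = b) → Disjoint ({s, t} : Set V) (insert x Q) := by
      intro s t hst hwt hws hsx hsy hs
      rw [Set.disjoint_left]
      rintro z (rfl | rfl)
      · rintro (h | h | h)
        · exact hneN hws hwx h
        · rw [h] at hsy
          exact h₁₃.2 hsy.symm
        · rcases hs with rfl | rfl
          exacts [h.2.1 rfl, h.2.2.1 rfl]
      · rintro (h | h)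
        · exact hsx (h ▸ hst)
        · exact hQw _ h hwt
    have h3 : #({y₁, y₂, w} : Finset V) = 3 :=
      Finset.card_eq_three.mpr ⟨y₁, y₂, w, h₁₂.1, h₁.2.1, h₂.2.1, rfl⟩
    -- A `K₃,₃` with `y₁`, `y₂`, `w` on one side. The third set reaches `w` through `x`, and `y₁`,
    -- `y₂` through the links `c`, `e` to `y₃`.
    have := hR.planar.card_le_two (P₁ := {a, xa}) (P₂ := {b, xb}) (P₃ := insert x Q)
      (ConnOn.star a (by rintro _ rfl; exact haxa)) (ConnOn.star b (by rintro _ rfl; exact hbxb))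
      hQconn (by
        rw [Set.disjoint_left]
        rintro z (rfl | rfl) (h | h)
        exacts [hab h, hneN hwa hwxb h, hneN hwb hwxa h.symm, hxab h])
      (hxa3 haxa hwxa hwa hax hay₁ (Or.inl rfl)) (hxa3 hbxb hwxb hwb hbx hby₁ (Or.inr rfl))
      {y₁, y₂, w} (by
        intro y hy
        simp only [mem_insert, mem_singleton] at hy
        rcases hy with rfl | rfl | rfl
        · refine ⟨?_, a, by simp, hay₁.symm⟩
          rintro (h | h)
          exacts [hay₁.ne h.symm, hneN h₁.2.2 hwxa h]
        · refine ⟨?_, a, by simp, hay₂.symm⟩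
          rintro (h | h)
          exacts [hay₂.ne h.symm, hneN h₂.2.2 hwxa h]
        · refine ⟨?_, xa, by simp, hwxa⟩
          rintro (h | h)
          exacts [haw h.symm, hwxa.ne h]) (by
        intro y hy
        simp only [mem_insert, mem_singleton] at hy
        rcases hy with rfl | rfl | rfl
        · refine ⟨?_, b, by simp, hby₁.symm⟩
          rintro (h | h)
          exacts [hby₁.ne h.symm, hneN h₁.2.2 hwxb h]
        · refine ⟨?_, b, by simp, hby₂.symm⟩
          rintro (h | h)
          exacts [hby₂.ne h.symm, hneN h₂.2.2 hwxb h]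
        · refine ⟨?_, xb, by simp, hwxb⟩
          rintro (h | h)
          exacts [hbw h.symm, hwxb.ne h]) (by
        intro y hy
        simp only [mem_insert, mem_singleton] at hy
        rcases hy with rfl | rfl | rfl
        · exact ⟨hnotQ _ h₁₃.1 h₁₃.2 h₁.2.2, c, Or.inr (Or.inr ⟨hy₃c, hca, hcb, hwc⟩), hy₁c⟩
        · exact ⟨hnotQ _ h₂₃.1 h₂₃.2 h₂.2.2, e, Or.inr (Or.inr ⟨hy₃e, hea, heb, hwe⟩), hy₂e⟩
        · refine ⟨?_, x, Or.inl rfl, hwx⟩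
          exact hnotQ _ h₃.2.1.symm h₃.2.2 (G.loopless.irrefl _))
    omega

end IsColoredClique

namespace SimpleGraph

theorem isMinorOf_of_injective {V W : Type*} {G : SimpleGraph V}
    {Q : SimpleGraph W} (f : W → V) (hf : Function.Injective f)
    (h : ∀ a b, Q.Adj a b → G.Adj (f a) (f b)) : Q.IsMinorOf G :=
  ⟨fun a => {f a}, fun a b hab => by simpa using fun h => hab (hf h),
    fun a => ConnOn.singleton _, fun a b hab => ⟨f a, rfl, f b, rfl, h a b hab⟩⟩

theorem card_le_card_darts {V : Type*} {T : Finset V} (Q : SimpleGraph T)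
    (D : Finset (V × V))
    (h : ∀ d ∈ D, ∃ (h₁ : d.1 ∈ T) (h₂ : d.2 ∈ T), Q.Adj ⟨d.1, h₁⟩ ⟨d.2, h₂⟩) :
    #D ≤ Nat.card {d : T × T // Q.Adj d.1 d.2} := by
  choose h₁ h₂ h₃ using h
  rw [← Fintype.card_coe, ← Nat.card_eq_fintype_card]
  refine Nat.card_le_card_of_injective
    (fun d : D => (⟨(⟨d.1.1, h₁ _ d.2⟩, ⟨d.1.2, h₂ _ d.2⟩), h₃ _ d.2⟩ :
      {d : T × T // Q.Adj d.1 d.2})) fun d d' hd => ?_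
  simp only [Subtype.mk.injEq, Prod.mk.injEq] at hd
  exact Subtype.ext (Prod.ext hd.1 hd.2)

end SimpleGraph

namespace IsColoredClique

variable {V C : Type*} [Fintype V] [DecidableEq V] {G : SimpleGraph V} {R : Finset V}
  {col : V → V → C} [DecidableRel G.Adj]

/-- The number of edges between `R` and a set of further vertices, together with the edges inside
`R`, is bounded by Euler's inequality. -/
theorem sum_degree_le (hR : IsColoredClique G R col) (h3 : 3 ≤ #R) (S : Finset V)
    (hS : Disjoint R S) :
    ∑ z ∈ R, #{x ∈ R | G.Adj z x} + 2 * ∑ z ∈ S, #{x ∈ R | G.Adj z x} + 8 ≤ 4 * (#R + #S) := by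
  let Q : SimpleGraph (R ∪ S : Finset V) :=
    { Adj := fun a b => G.Adj a.1 b.1
      symm := ⟨fun _ _ h => h.symm⟩
      loopless := ⟨fun a h => G.loopless.irrefl a.1 h⟩ }
  have hmin : Q.IsMinorOf G :=
    isMinorOf_of_injective (fun a => a.1) Subtype.val_injective fun a b h => h
  have hcard : Fintype.card (R ∪ S : Finset V) = #R + #S := by
    rw [Fintype.card_coe, Finset.card_union_of_disjoint hS]
  have h1 := (hR.planar.hasAbstractDual_of_isMinorOf hmin).card_darts_le_of_triangleFree
    (by omega) (fun a b d h1 h2 h3 => hR.tri _ _ _ h1 h2 h3)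
  rw [hcard] at h1
  have hsum : ∀ T : Finset V, ∑ z ∈ T, #{x ∈ R | G.Adj z x} =
      #{d ∈ T ×ˢ R | G.Adj d.1 d.2} := by
    intro T
    rw [Finset.card_filter, Finset.sum_product]
    exact Finset.sum_congr rfl fun z _ => Finset.card_filter _ _
  have hswap : #{d ∈ S ×ˢ R | G.Adj d.1 d.2} = #{d ∈ R ×ˢ S | G.Adj d.1 d.2} := by
    refine Finset.card_bij (fun d _ => d.swap) ?_ ?_ ?_
    · rintro ⟨a, b⟩ h
      simp only [mem_filter, mem_product, Prod.swap_prod_mk] at h ⊢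
      exact ⟨⟨h.1.2, h.1.1⟩, h.2.symm⟩
    · rintro ⟨a, b⟩ _ ⟨a', b'⟩ _ h
      simpa [and_comm] using h
    · rintro ⟨a, b⟩ h
      simp only [mem_filter, mem_product] at h
      exact ⟨(b, a), by simpa using ⟨⟨h.1.2, h.1.1⟩, h.2.symm⟩, rfl⟩
  have h2 : #{d ∈ (R ∪ S) ×ˢ (R ∪ S) | G.Adj d.1 d.2} ≤
      Nat.card {d : (R ∪ S : Finset V) × (R ∪ S : Finset V) // Q.Adj d.1 d.2} := by
    refine card_le_card_darts Q _ fun d hd => ?_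
    obtain ⟨hd, hadj⟩ := mem_filter.mp hd
    exact ⟨(mem_product.mp hd).1, (mem_product.mp hd).2, hadj⟩
  have hdisj := Finset.disjoint_left.mp hS
  have h3 : #{d ∈ R ×ˢ R | G.Adj d.1 d.2} + #{d ∈ S ×ˢ R | G.Adj d.1 d.2} +
      #{d ∈ R ×ˢ S | G.Adj d.1 d.2} ≤ #{d ∈ (R ∪ S) ×ˢ (R ∪ S) | G.Adj d.1 d.2} := by
    rw [← Finset.card_union_of_disjoint, ← Finset.card_union_of_disjoint]
    · refine Finset.card_le_card fun d hd => ?_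
      simp only [mem_union, mem_filter, mem_product] at hd ⊢
      tauto
    · rw [Finset.disjoint_left]
      intro d hd hd'
      simp only [mem_union, mem_filter, mem_product] at hd hd'
      rcases hd with hd | hd
      · exact hdisj hd.1.2 hd'.1.2
      · exact hdisj hd'.1.1 hd.1.1
    · rw [Finset.disjoint_left]
      intro d hd hd'
      simp only [mem_filter, mem_product] at hd hd'
      exact hdisj hd.1.1 hd'.1.1
  rw [hsum, hsum]
  omega

/-- The number of ordered pairs in `R` that are joined by vertices with exactly two neighbours in
`R`. -/
theorem card_two_links_le (hR : IsColoredClique G R col) (h3 : 3 ≤ #R) :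
    #{d ∈ R.offDiag | ∃ z, #{x ∈ R | G.Adj z x} = 2 ∧ z ∉ R ∧ G.Adj z d.1 ∧ G.Adj z d.2} + 12 ≤
      6 * #R := by
  obtain ⟨n, ⟨e⟩⟩ := Finite.exists_equiv_fin V
  let _ : LinearOrder V := LinearOrder.lift' e e.injective
  let Q : SimpleGraph R :=
    { Adj := fun a b => a.1 ≠ b.1 ∧
        ∃ z, #{x ∈ R | G.Adj z x} = 2 ∧ z ∉ R ∧ G.Adj z a.1 ∧ G.Adj z b.1
      symm := ⟨by
        rintro a b ⟨h, z, h1, h2, h3, h4⟩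
        exact ⟨h.symm, z, h1, h2, h4, h3⟩⟩
      loopless := ⟨fun a h => h.1 rfl⟩ }
  have hmin : Q.IsMinorOf G := by
    have hz : ∀ a b : R, Q.Adj a b → ∃ z, #{x ∈ R | G.Adj z x} = 2 ∧ z ∉ R ∧ G.Adj z a.1 ∧
      G.Adj z b.1 := fun a b h => h.2
    have : Nonempty V := by
      obtain ⟨x, _⟩ := Finset.card_pos.mp (show 0 < #R by omega)
      exact ⟨x⟩
    choose! f hf1 hf2 hf3 hf4 using hz
    have hpair : ∀ a b, Q.Adj a b → ({x ∈ R | G.Adj (f a b) x} : Finset V) = {a.1, b.1} := by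
      intro a b h
      symm
      refine Finset.eq_of_subset_of_card_le ?_ ?_
      · intro x hx
        simp only [mem_insert, mem_singleton] at hx
        rw [mem_filter]
        rcases hx with rfl | rfl
        exacts [⟨a.2, hf3 a b h⟩, ⟨b.2, hf4 a b h⟩]
      · rw [hf1 a b h, Finset.card_pair h.1]
    -- Each chosen linking vertex is contracted onto the smaller of its two neighbours in `R`. Its
    -- neighbourhood in `R` is exactly that pair, which makes the branch sets disjoint.
    refine ⟨fun a => insert a.1 {z | ∃ b : R, a.1 < b.1 ∧ Q.Adj a b ∧ z = f a b}, ?_, ?_, ?_⟩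
    · intro a b hab
      rw [Set.disjoint_left]
      rintro z (h | ⟨c, hc, hac, h⟩) (h' | ⟨c', hc', hbc', h'⟩)
      · exact hab (Subtype.ext (h.symm.trans h'))
      · exact hf2 _ _ hbc' (h' ▸ h ▸ a.2)
      · exact hf2 _ _ hac (h ▸ h' ▸ b.2)
      · have h1 := hpair a c hac
        have h2 := hpair b c' hbc'
        rw [← h, h', h2] at h1
        have ha : a.1 ∈ ({b.1, c'.1} : Finset V) := h1 ▸ by simp
        have hb : b.1 ∈ ({a.1, c.1} : Finset V) := h1 ▸ by simp
        simp only [mem_insert, mem_singleton] at ha hb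
        rcases ha with ha | ha
        · exact hab (Subtype.ext ha)
        · rcases hb with hb | hb
          · exact hab (Subtype.ext hb.symm)
          · rw [← ha] at hc'
            rw [← hb] at hc
            exact lt_asymm hc hc'
    · refine fun a => ConnOn.star a.1 ?_
      rintro z ⟨b, _, hab, rfl⟩
      exact (hf3 a b hab).symm
    · intro a b hab
      rcases lt_or_gt_of_ne hab.1 with h | h
      · exact ⟨f a b, Or.inr ⟨b, h, hab, rfl⟩, b.1, Or.inl rfl, hf4 a b hab⟩
      · exact ⟨a.1, Or.inl rfl, f b a, Or.inr ⟨a, h, hab.symm, rfl⟩, (hf4 b a hab.symm).symm⟩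
  have h1 := (hR.planar.hasAbstractDual_of_isMinorOf hmin).card_darts_le
    (by rwa [Fintype.card_coe])
  rw [Fintype.card_coe] at h1
  refine le_trans (Nat.add_le_add_right (card_le_card_darts Q _ fun d hd => ?_) 12) h1
  obtain ⟨hd, h⟩ := mem_filter.mp hd
  obtain ⟨hd1, hd2, hne⟩ := mem_offDiag.mp hd
  exact ⟨hd1, hd2, hne, h⟩

/-- If every vertex has at most four neighbours in `R`, then `R` is small. -/
theorem card_le_of_degree_le_four (hR : IsColoredClique G R col)
    (h4 : ∀ z, #{x ∈ R | G.Adj z x} ≤ 4) : #R ≤ 20 := by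
  by_contra! hcon
  set N : V → Finset V := fun z => {x ∈ R | G.Adj z x} with hN
  let S : Finset V := {z | z ∉ R ∧ 3 ≤ #(N z)}
  have hRS : Disjoint R S :=
    Finset.disjoint_left.mpr fun z hz hz' => (mem_filter.mp hz').2.1 hz
  have h1 := hR.sum_degree_le (by omega) S hRS
  have h2 := hR.card_two_links_le (by omega)
  -- Every ordered pair in `R` is adjacent, or has a common neighbour in `R`, or one outside `R`
  -- with at least three neighbours in `R`, or one outside `R` with exactly two.
  have hsub : R.offDiag ⊆ ({d ∈ R ×ˢ R | G.Adj d.1 d.2} ∪ R.biUnion fun z => (N z).offDiag) ∪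
      (S.biUnion fun z => (N z).offDiag) ∪
      {d ∈ R.offDiag | ∃ z, #{x ∈ R | G.Adj z x} = 2 ∧ z ∉ R ∧ G.Adj z d.1 ∧ G.Adj z d.2} := by
    rintro ⟨u, v⟩ hd
    obtain ⟨hu, hv, huv⟩ := mem_offDiag.mp hd
    simp only [mem_union, mem_biUnion]
    rcases hR.rel u hu v hv huv with h | ⟨z, hzu, hzv, _⟩
    · exact Or.inl (Or.inl (Or.inl (mem_filter.mpr ⟨mem_product.mpr ⟨hu, hv⟩, h⟩)))
    · have hmem : (u, v) ∈ (N z).offDiag :=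
        mem_offDiag.mpr ⟨mem_filter.mpr ⟨hu, hzu⟩, mem_filter.mpr ⟨hv, hzv⟩, huv⟩
      by_cases hz : z ∈ R
      · exact Or.inl (Or.inl (Or.inr ⟨z, hz, hmem⟩))
      by_cases h3 : 3 ≤ #(N z)
      · exact Or.inl (Or.inr ⟨z, mem_filter.mpr ⟨mem_univ _, hz, h3⟩, hmem⟩)
      · refine Or.inr (mem_filter.mpr ⟨hd, z, ?_, hz, hzu, hzv⟩)
        have : 1 < #(N z) := Finset.one_lt_card.mpr
          ⟨u, mem_filter.mpr ⟨hu, hzu⟩, v, mem_filter.mpr ⟨hv, hzv⟩, huv⟩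
        exact le_antisymm (Nat.lt_succ_iff.mp (not_le.mp h3)) this
  have hA : #{d ∈ R ×ˢ R | G.Adj d.1 d.2} = ∑ z ∈ R, #(N z) := by
    rw [Finset.card_filter, Finset.sum_product]
    exact Finset.sum_congr rfl fun z _ => (Finset.card_filter _ _).symm
  -- A vertex with `k` neighbours in `R` serves `k² - k` ordered pairs. For `k = 3` and `k = 4` the
  -- bound `6k - 12` is attained, which is what the weights in Euler's inequality can absorb.
  have hoff : ∀ k ≤ 4, k * k - k ≤ 3 * k ∧ (3 ≤ k → k * k - k + 12 ≤ 6 * k) := by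
    intro k hk
    interval_cases k <;> simp
  have hB : #(R.biUnion fun z => (N z).offDiag) ≤ 3 * ∑ z ∈ R, #(N z) := by
    refine Finset.card_biUnion_le.trans ?_
    rw [Finset.mul_sum]
    refine Finset.sum_le_sum fun z _ => ?_
    rw [Finset.offDiag_card]
    exact (hoff _ (h4 z)).1
  have hC : #(S.biUnion fun z => (N z).offDiag) + 12 * #S ≤ 6 * ∑ z ∈ S, #(N z) := by
    refine (Nat.add_le_add_right Finset.card_biUnion_le _).trans ?_
    rw [Finset.mul_sum, mul_comm, ← smul_eq_mul, ← Finset.sum_const, ← Finset.sum_add_distrib]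
    refine Finset.sum_le_sum fun z hz => ?_
    rw [Finset.offDiag_card]
    exact (hoff _ (h4 z)).2 (mem_filter.mp hz).2.2
  have hD : 3 * #S ≤ ∑ z ∈ S, #(N z) := by
    rw [mul_comm, ← smul_eq_mul]
    exact Finset.card_nsmul_le_sum _ _ _ fun z hz => (mem_filter.mp hz).2.2
  have hE := (Finset.card_le_card hsub).trans (((Finset.card_union_le _ _).trans
    (Nat.add_le_add_right ((Finset.card_union_le _ _).trans
      (Nat.add_le_add_right (Finset.card_union_le _ _) _)) _)))
  rw [hA, Finset.offDiag_card] at hE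
  have hF : 21 * #R ≤ #R * #R := Nat.mul_le_mul_right _ hcon
  simp only [hN] at hB hC hD hE h1 h2 ⊢
  obtain ⟨k, hk⟩ := Nat.exists_eq_add_of_le (show 21 ≤ #R by omega)
  -- Together the estimates give `#R ^ 2 - #R ≤ 22 * #R - 44`, which just fails from `21` on; this
  -- product bound makes the contradiction linear.
  have hG : 21 * #R + k * 21 ≤ #R * #R := by
    rw [hk]; nlinarith
  omega

/-- If no two vertices have three common neighbours in `R`, then `R` is small. -/
theorem card_le_of_no_hub [Fintype C] (hR : IsColoredClique G R col)
    (hno : ∀ w h, w ≠ h → #{x ∈ R | G.Adj w x ∧ G.Adj h x} ≤ 2) :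
    #R ≤ max 20 (3 * Fintype.card C + 6) := by
  classical
  by_cases h4 : ∀ z, #{x ∈ R | G.Adj z x} ≤ 4
  · exact le_max_of_le_left (hR.card_le_of_degree_le_four h4)
  push Not at h4
  obtain ⟨w, hw⟩ := h4
  refine le_max_of_le_right ?_
  have hX : #{x ∈ R | G.Adj w x} ≤ 3 * Fintype.card C := by
    refine (hR.card_star_le_of_no_hub (w := w) (filter_subset _ _)
      (fun x hx => (mem_filter.mp hx).2) fun u hu => ?_).trans
      (Nat.mul_le_mul_left 3 (Finset.card_le_univ _))
    rw [Finset.filter_filter]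
    exact hno w u hu.symm
  have hY : #{x ∈ R | x ≠ w ∧ ¬ G.Adj w x} ≤ 5 := by
    by_contra! h6
    obtain ⟨y₁, h₁, y₂, h₂, y₃, h₃, h₁₂, h₁₃, h₂₃⟩ :=
      exists_independent_triple hR.tri _ h6
    exact hR.not_independent_triple hno hw (mem_filter.mp h₁) (mem_filter.mp h₂)
      (mem_filter.mp h₃) h₁₂ h₁₃ h₂₃
  have hsub : R ⊆ ({x ∈ R | G.Adj w x} ∪ {x ∈ R | x ≠ w ∧ ¬ G.Adj w x}) ∪ {w} := by
    intro x hx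
    simp only [mem_union, mem_filter, mem_singleton]
    tauto
  have := (Finset.card_le_card hsub).trans ((Finset.card_union_le _ _).trans
    (Nat.add_le_add_right (Finset.card_union_le _ _) _))
  rw [Finset.card_singleton] at this
  omega

end IsColoredClique

/-! ### Two poles with at least three common neighbours. -/

namespace SimpleGraph

theorem ConnOn.attach {V : Type*} {G : SimpleGraph V} {K Z : Set V} (hK : G.ConnOn K)
    (hZ : ∀ z ∈ Z, ∃ a ∈ K, G.Adj a z) : G.ConnOn (K ∪ Z) := by
  rcases K.eq_empty_or_nonempty with rfl | ⟨s, hs⟩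
  · rintro u (hu | hu)
    · exact absurd hu (Set.notMem_empty u)
    · obtain ⟨a, ha, _⟩ := hZ u hu
      exact absurd ha (Set.notMem_empty a)
  refine ConnOn.of_center s ?_
  have hin : ∀ a ∈ K, Relation.ReflTransGen (fun a b => G.Adj a b ∧ a ∈ K ∪ Z ∧ b ∈ K ∪ Z) s a :=
    fun a ha => Relation.ReflTransGen.mono
      (fun u v h => ⟨h.1, Or.inl h.2.1, Or.inl h.2.2⟩) _ _ (hK s hs a ha)
  rintro z (hz | hz)
  · exact hin z hz
  · obtain ⟨a, ha, haz⟩ := hZ z hz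
    exact (hin a ha).tail ⟨haz, Or.inl ha, Or.inr hz⟩

/-- Two vertices `w` and `h` with at least three common neighbours in `R`, and the partition of
their neighbours in `R`. -/
structure IsPoles {V : Type*} (G : SimpleGraph V) (R : Finset V) (w h : V)
    (X A B : Finset V) : Prop where
  ne : w ≠ h
  mem_X : ∀ x, x ∈ X ↔ x ∈ R ∧ G.Adj w x ∧ G.Adj h x
  mem_A : ∀ x, x ∈ A ↔ x ∈ R ∧ G.Adj w x ∧ ¬ G.Adj h x
  mem_B : ∀ x, x ∈ B ↔ x ∈ R ∧ ¬ G.Adj w x ∧ G.Adj h x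
  three_le : 3 ≤ #X

namespace IsPoles

variable {V : Type*} {G : SimpleGraph V} {R : Finset V} {w h : V} {X A B : Finset V}

theorem symm (hP : G.IsPoles R w h X A B) : G.IsPoles R h w X B A where
  ne := hP.ne.symm
  mem_X x := by rw [hP.mem_X]; tauto
  mem_A x := by rw [hP.mem_B]; tauto
  mem_B x := by rw [hP.mem_A]; tauto
  three_le := hP.three_le

theorem not_adj (hP : G.IsPoles R w h X A B)
    (htri : ∀ a b d, G.Adj a b → G.Adj b d → ¬ G.Adj a d) : ¬ G.Adj w h := by
  obtain ⟨x, hx⟩ := Finset.card_pos.mp (lt_of_lt_of_le (by norm_num) hP.three_le)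
  have hx := (hP.mem_X x).mp hx
  exact htri w x h hx.2.1 hx.2.2.symm

end IsPoles

end SimpleGraph

namespace IsColoredClique

variable {V C : Type*} {G : SimpleGraph V} {R : Finset V} {col : V → V → C}

/-- A vertex `x` of the clique that is not adjacent to a set `K` around `b` is seen by a common
neighbour `h` in another colour than `b`. -/
theorem col_ne_of_not_touches (hR : IsColoredClique G R col) {w h b x : V} {X : Finset V}
    {K : Set V} (hwX : ∀ y ∈ X, G.Adj w y) (hb : b ∈ R) (hwb : ¬ G.Adj w b) (hhb : G.Adj h b)
    (hK : ∀ z, G.Adj b z → z ≠ w → z ≠ h → z ∉ X → z ∈ K) (hx : x ∈ X) (hxR : x ∈ R)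
    (hhx : G.Adj h x) (hxK : x ∉ K) (hxt : ¬ G.Touches K x) : col h b ≠ col h x := by
  intro hcol
  obtain ⟨z, hzh, hzb, hzx, _⟩ := hR.exists_ne hb hxR (by rintro rfl; exact hwb (hwX _ hx)) hhb hhx
    hcol
  refine hxt ⟨hxK, z, hK z hzb.symm ?_ hzh ?_, hzx.symm⟩
  · rintro rfl
    exact hwb hzb
  · exact fun hz => hR.tri z w x (hwX z hz).symm (hwX x hx) hzx

variable [Finite V]

/-- Three common neighbours touching `K` would make a `K₃,₃` with `w`, `h` and `K`. -/
theorem card_touches_le_two (hR : IsColoredClique G R col) {w h : V} (hwh : w ≠ h) {X : Finset V}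
    [DecidableEq V] {K : Set V} [DecidablePred (G.Touches K)] (hwX : ∀ y ∈ X, G.Adj w y)
    (hhX : ∀ y ∈ X, G.Adj h y) (hK : G.ConnOn K) (hw : w ∉ K) (hh : h ∉ K) :
    #{x ∈ X | G.Touches K x} ≤ 2 :=
  hR.planar.card_le_two (ConnOn.singleton w) (ConnOn.singleton h) hK (by simpa using hwh)
    (by simpa using hw) (by simpa using hh) _
    (fun x hx => touches_singleton.mpr (hwX x (mem_filter.mp hx).1).symm)
    (fun x hx => touches_singleton.mpr (hhX x (mem_filter.mp hx).1).symm)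
    fun x hx => (mem_filter.mp hx).2

/-- A vertex `v` next to one of two centres makes one colour at this centre almost unavailable. -/
theorem card_le_of_side (hR : IsColoredClique G R col) [Fintype C] [DecidableEq C] {w h : V}
    (hwh : w ≠ h) {X : Finset V} (hX : X ⊆ R) (hwX : ∀ y ∈ X, G.Adj w y)
    (hhX : ∀ y ∈ X, G.Adj h y) (h3 : 3 ≤ #X) {B : Finset V} (hB : B ⊆ R) {K : Set V}
    (hBh : ∀ b ∈ B, G.Adj h b) (hBw : ∀ b ∈ B, ¬ G.Adj w b) (hK : G.ConnOn K)
    (hBK : ∀ b ∈ B, b ∈ K) (hwK : w ∉ K) (hhK : h ∉ K) (hXK : ∀ x ∈ X, x ∉ K) :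
    #X ≤ 2 * #(X.image (col w)) * (Fintype.card C - #(B.image (col h))) + 2 := by
  classical
  -- The set grows by all further neighbours of `B`. Then an element of `X` that it does not touch
  -- can be distinguished from an element of `B` only by `h`, so it avoids the colours of `B` at
  -- `h`.
  let K' : Set V := K ∪ {z | z ≠ w ∧ z ≠ h ∧ z ∉ X ∧ ∃ b ∈ B, G.Adj b z}
  have hK' : G.ConnOn K' := hK.attach fun z hz => by
    obtain ⟨_, _, _, b, hb, hbz⟩ := hz
    exact ⟨b, hBK b hb, hbz⟩
  have htouch := hR.card_touches_le_two hwh hwX hhX hK'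
    (by rintro (h' | h'); exacts [hwK h', h'.1 rfl])
    (by rintro (h' | h'); exacts [hhK h', h'.2.1 rfl])
  have hsplit := Finset.card_filter_add_card_filter_not (s := X) (fun x => G.Touches K' x)
  have himg : (({x ∈ X | ¬ G.Touches K' x} : Finset V).image fun x => (col w x, col h x)) ⊆
      X.image (col w) ×ˢ (B.image (col h))ᶜ := by
    intro c hc
    obtain ⟨x, hx, rfl⟩ := mem_image.mp hc
    obtain ⟨hxX, hxt⟩ := mem_filter.mp hx
    refine mem_product.mpr ⟨mem_image_of_mem _ hxX, mem_compl.mpr fun h' => ?_⟩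
    obtain ⟨b, hb, hbx⟩ := mem_image.mp h'
    refine hR.col_ne_of_not_touches hwX (hB hb) (hBw b hb) (hBh b hb) (K := K')
      (fun z hz h1 h2 h3 => Or.inr ⟨h1, h2, h3, b, hb, hz⟩) hxX (hX hxX) (hhX x hxX) ?_ hxt hbx
    rintro (h1 | h1)
    exacts [hXK x hxX h1, h1.2.2.1 hxX]
  have hprod := Finset.card_le_card himg
  rw [Finset.card_product, Finset.card_compl] at hprod
  rw [mul_assoc]
  by_cases h4 : 4 ≤ #X
  · have hfib : #{x ∈ X | ¬ G.Touches K' x} ≤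
        2 * #(({x ∈ X | ¬ G.Touches K' x} : Finset V).image fun x => (col w x, col h x)) :=
      Finset.card_le_mul_card_image _ 2 fun c _ => by
        have hc : ∀ x ∈ ({x ∈ ({x ∈ X | ¬ G.Touches K' x} : Finset V) |
            (col w x, col h x) = c} : Finset V), col w x = c.1 ∧ col h x = c.2 := fun x hx =>
          Prod.ext_iff.mp (mem_filter.mp hx).2
        refine hR.card_fiber_le_two hwh hX hwX hhX h4
          ((filter_subset _ _).trans (filter_subset _ _)) ?_ ?_
        · exact fun x hx y hy => (hc x hx).1.trans (hc y hy).1.symm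
        · exact fun x hx y hy => (hc x hx).2.trans (hc y hy).2.symm
    omega
  -- For `#X = 3` the bound on fibres is not available, but one untouched element already makes the
  -- product on the right positive.
  · have hpos : 0 < #(({x ∈ X | ¬ G.Touches K' x} : Finset V).image
        fun x => (col w x, col h x)) :=
      Finset.card_pos.mpr ((Finset.card_pos.mp (by omega)).image _)
    omega

variable {w h : V} {X A B : Finset V}

theorem subset_of_poles [DecidableEq V] (hR : IsColoredClique G R col)
    (hP : G.IsPoles R w h X A B) : R ⊆ X ∪ A ∪ B ∪ ({w, h} : Finset V) ∩ R := by
  intro y hy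
  simp only [mem_union, mem_inter, mem_insert, mem_singleton, hP.mem_X, hP.mem_A, hP.mem_B]
  by_cases h1 : y = w
  · tauto
  by_cases h2 : y = h
  · tauto
  have := hR.adj_of_three hP.ne (fun x hx => ((hP.mem_X x).mp hx).1)
    (fun x hx => ((hP.mem_X x).mp hx).2.1) (fun x hx => ((hP.mem_X x).mp hx).2.2) hP.three_le
    hy h1 h2
  tauto

/-- If there are vertices of `R` adjacent only to `w` and vertices adjacent only to `h`, then their
colours are almost unavailable for the common neighbours of `w` and `h`. -/
theorem card_common_le (hR : IsColoredClique G R col) [Fintype C] [DecidableEq C]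
    (hP : G.IsPoles R w h X A B) (hA : A.Nonempty) (hB : B.Nonempty) :
    #X ≤ 2 * ((Fintype.card C - #(A.image (col w))) * (Fintype.card C - #(B.image (col h)))) +
      2 := by
  classical
  obtain ⟨a₀, ha₀⟩ := hA
  obtain ⟨b₀, hb₀⟩ := hB
  have hXR : ∀ x ∈ X, x ∈ R := fun x hx => ((hP.mem_X x).mp hx).1
  have hwX : ∀ x ∈ X, G.Adj w x := fun x hx => ((hP.mem_X x).mp hx).2.1
  have hhX : ∀ x ∈ X, G.Adj h x := fun x hx => ((hP.mem_X x).mp hx).2.2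
  have hwh := hP.not_adj hR.tri
  -- The private neighbours of both poles with their further neighbours. This set is connected,
  -- because every `a` in `A` and `b` in `B` are adjacent or have a common neighbour, which cannot
  -- be a pole or lie in `X`.
  let K : Set V := {v | v ∈ A ∨ v ∈ B} ∪
    {z | (z ≠ w ∧ z ≠ h ∧ z ∉ X) ∧ ∃ b, (b ∈ A ∨ b ∈ B) ∧ G.Adj b z}
  have hAK : ∀ a ∈ A, a ∈ K := fun a ha => Or.inl (Or.inl ha)
  have hBK : ∀ b ∈ B, b ∈ K := fun b hb => Or.inl (Or.inr hb)
  have hKA : ∀ a ∈ A, ∀ z, G.Adj a z → z ≠ w → z ≠ h → z ∉ X → z ∈ K :=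
    fun a ha z hz h1 h2 h3 => Or.inr ⟨⟨h1, h2, h3⟩, a, Or.inl ha, hz⟩
  have hKB : ∀ b ∈ B, ∀ z, G.Adj b z → z ≠ h → z ≠ w → z ∉ X → z ∈ K :=
    fun b hb z hz h1 h2 h3 => Or.inr ⟨⟨h2, h1, h3⟩, b, Or.inr hb, hz⟩
  have hwK : w ∉ K := by
    rintro ((h1 | h1) | h1)
    · exact G.loopless.irrefl _ ((hP.mem_A w).mp h1).2.1
    · exact hwh ((hP.mem_B w).mp h1).2.2.symm
    · exact h1.1.1 rfl
  have hhK : h ∉ K := by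
    rintro ((h1 | h1) | h1)
    · exact hwh ((hP.mem_A h).mp h1).2.1
    · exact G.loopless.irrefl _ ((hP.mem_B h).mp h1).2.2
    · exact h1.1.2.1 rfl
  have hXK : ∀ x ∈ X, x ∉ K := by
    rintro x hx ((h1 | h1) | h1)
    · exact ((hP.mem_A x).mp h1).2.2 (hhX x hx)
    · exact ((hP.mem_B x).mp h1).2.1 (hwX x hx)
    · exact h1.1.2.2 hx
  have hpath : ∀ a ∈ A, ∀ b ∈ B,
      Relation.ReflTransGen (fun a b => G.Adj a b ∧ a ∈ K ∧ b ∈ K) a b := by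
    intro a ha b hb
    obtain ⟨haR, hwa, hha⟩ := (hP.mem_A a).mp ha
    obtain ⟨hbR, hwb, hhb⟩ := (hP.mem_B b).mp hb
    rcases hR.rel a haR b hbR (by rintro rfl; exact hwb hwa) with h1 | ⟨z, hza, hzb, _⟩
    · exact Relation.ReflTransGen.single ⟨h1, hAK a ha, hBK b hb⟩
    · have hz : z ∈ K := by
        refine hKA a ha z hza.symm ?_ ?_ ?_
        · rintro rfl; exact hwb hzb
        · rintro rfl; exact hha hza
        · exact fun hz => hR.tri z w a (hwX z hz).symm hwa hza
      exact (Relation.ReflTransGen.single ⟨hza.symm, hAK a ha, hz⟩).tail ⟨hzb, hz, hBK b hb⟩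
  have hKc : G.ConnOn K := by
    have hsymm : Std.Symm (fun a b => G.Adj a b ∧ a ∈ K ∧ b ∈ K) :=
      ⟨fun a b hab => ⟨hab.1.symm, hab.2.2, hab.2.1⟩⟩
    have hcen : ∀ v, v ∈ A ∨ v ∈ B →
        Relation.ReflTransGen (fun a b => G.Adj a b ∧ a ∈ K ∧ b ∈ K) b₀ v := by
      rintro v (hv | hv)
      · exact Relation.ReflTransGen.stdSymm.symm _ _ (hpath v hv b₀ hb₀)
      · exact (Relation.ReflTransGen.stdSymm.symm _ _ (hpath a₀ ha₀ b₀ hb₀)).trans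
          (hpath a₀ ha₀ v hv)
    refine ConnOn.of_center b₀ ?_
    rintro v (hv | hv)
    · exact hcen v hv
    · obtain ⟨_, b, hb, hbv⟩ := id hv
      exact (hcen b hb).tail ⟨hbv, Or.inl hb, Or.inr hv⟩
  have htouch := hR.card_touches_le_two hP.ne hwX hhX hKc hwK hhK
  have hsplit := Finset.card_filter_add_card_filter_not (s := X) (fun x => G.Touches K x)
  -- Here `K` itself links the two poles, so no fourth element of `X` is needed. A witness for two
  -- untouched elements of `X` lies outside `K`.
  have hfib : #{x ∈ X | ¬ G.Touches K x} ≤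
      2 * #(({x ∈ X | ¬ G.Touches K x} : Finset V).image fun x => (col w x, col h x)) :=
    Finset.card_le_mul_card_image _ 2 fun c _ => by
      have hc : ∀ x ∈ ({x ∈ ({x ∈ X | ¬ G.Touches K x} : Finset V) |
          (col w x, col h x) = c} : Finset V), (x ∈ X ∧ ¬ G.Touches K x) ∧
            col w x = c.1 ∧ col h x = c.2 := fun x hx =>
        ⟨mem_filter.mp (mem_filter.mp hx).1, Prod.ext_iff.mp (mem_filter.mp hx).2⟩
      refine hR.planar.fiber_le_two hR.tri hP.ne hKc
        ⟨hwK, a₀, hAK _ ha₀, ((hP.mem_A a₀).mp ha₀).2.1⟩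
        ⟨hhK, b₀, hBK _ hb₀, ((hP.mem_B b₀).mp hb₀).2.2⟩ _ (fun x hx => hwX x (hc x hx).1.1)
        (fun x hx => hhX x (hc x hx).1.1) (fun x hx => hXK x (hc x hx).1.1) ?_
      intro x hx y hy hxy
      obtain ⟨⟨hxX, hxt⟩, hxw, hxh⟩ := hc x hx
      obtain ⟨⟨hyX, _⟩, hyw, hyh⟩ := hc y hy
      obtain ⟨z, hzw, hzx, hzy, hz⟩ := hR.exists_ne (hXR x hxX) (hXR y hyX) hxy (hwX x hxX)
        (hwX y hyX) (hxw.trans hyw.symm)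
      refine ⟨z, hzw, ?_, fun hzK => hxt ⟨hXK x hxX, z, hzK, hzx.symm⟩, hzx, hzy⟩
      rintro rfl
      exact hz (hxh.trans hyh.symm)
  have himg : (({x ∈ X | ¬ G.Touches K x} : Finset V).image fun x => (col w x, col h x)) ⊆
      (A.image (col w))ᶜ ×ˢ (B.image (col h))ᶜ := by
    intro c hc
    obtain ⟨x, hx, rfl⟩ := mem_image.mp hc
    obtain ⟨hxX, hxt⟩ := mem_filter.mp hx
    refine mem_product.mpr ⟨mem_compl.mpr fun h' => ?_, mem_compl.mpr fun h' => ?_⟩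
    · obtain ⟨a, ha, hax⟩ := mem_image.mp h'
      have ha' := (hP.mem_A a).mp ha
      exact hR.col_ne_of_not_touches hhX ha'.1 ha'.2.2 ha'.2.1 (K := K)
        (fun z hz h1 h2 h3 => hKA a ha z hz h2 h1 h3) hxX (hXR x hxX) (hwX x hxX) (hXK x hxX) hxt
        hax
    · obtain ⟨b, hb, hbx⟩ := mem_image.mp h'
      have hb' := (hP.mem_B b).mp hb
      exact hR.col_ne_of_not_touches hwX hb'.1 hb'.2.1 hb'.2.2 (K := K)
        (fun z hz h1 h2 h3 => hKB b hb z hz h2 h1 h3) hxX (hXR x hxX) (hhX x hxX) (hXK x hxX) hxt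
        hbx
  have := Finset.card_le_card himg
  rw [Finset.card_product, Finset.card_compl, Finset.card_compl] at this
  omega

end IsColoredClique

/-! ### The count around two poles. -/

namespace IsColoredClique

variable {V C : Type*} {G : SimpleGraph V} {R : Finset V} {col : V → V → C} [Finite V]
  {w h : V} {X A B : Finset V}

theorem card_le_of_poles [DecidableEq V] (hR : IsColoredClique G R col)
    (hP : G.IsPoles R w h X A B) : #R ≤ #X + #A + #B + #(({w, h} : Finset V) ∩ R) :=
  (Finset.card_le_card (hR.subset_of_poles hP)).trans ((Finset.card_union_le _ _).trans
    (Nat.add_le_add_right ((Finset.card_union_le _ _).trans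
      (Nat.add_le_add_right (Finset.card_union_le _ _) _)) _))

variable [Fintype C]

/-- Apart from the poles, all of `R` lies in the star of `w`, which has at most `2p` elements per
colour. -/
theorem card_le_of_poles_of_empty (hR : IsColoredClique G R col) (hC : 2 ≤ Fintype.card C)
    (hP : G.IsPoles R w h X A ∅) : #R ≤ 2 * Fintype.card C ^ 2 + 2 := by
  classical
  have h1 := hR.card_le_of_poles hP
  have h2 : #(({w, h} : Finset V) ∩ R) ≤ 2 :=
    (Finset.card_le_card inter_subset_left).trans Finset.card_le_two
  have h3 : #(X ∪ A) = #X + #A := by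
    refine Finset.card_union_of_disjoint (Finset.disjoint_left.mpr fun x hx hx' => ?_)
    exact ((hP.mem_A x).mp hx').2.2 ((hP.mem_X x).mp hx).2.2
  have h4 := hR.card_star_le hC (w := w) (T := X ∪ A)
    (fun x hx => (mem_union.mp hx).elim (fun h => ((hP.mem_X x).mp h).1)
      fun h => ((hP.mem_A x).mp h).1)
    (fun x hx => (mem_union.mp hx).elim (fun h => ((hP.mem_X x).mp h).2.1)
      fun h => ((hP.mem_A x).mp h).2.1)
  have h5 : 2 * Fintype.card C * #((X ∪ A).image (col w)) ≤
      2 * Fintype.card C * Fintype.card C := Nat.mul_le_mul_left _ (Finset.card_le_univ _)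
  rw [Finset.card_empty] at h1
  have h6 : 2 * Fintype.card C * Fintype.card C = 2 * Fintype.card C ^ 2 := by ring
  omega

/-- If the private neighbours of a pole used all colours there, only two common neighbours would be
left. -/
theorem card_image_lt_of_poles [DecidableEq C] (hR : IsColoredClique G R col)
    (hP : G.IsPoles R w h X A B) (hA : A.Nonempty) (hB : B.Nonempty) :
    #(A.image (col w)) < Fintype.card C ∧ #(B.image (col h)) < Fintype.card C := by
  have h1 := hR.card_common_le hP hA hB
  have h2 := hP.three_le
  by_contra hcon
  have : (Fintype.card C - #(A.image (col w))) * (Fintype.card C - #(B.image (col h))) = 0 := by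
    rw [Nat.mul_eq_zero]
    omega
  omega

/-- The bound if no vertex is adjacent to three private neighbours of one of the poles. -/
theorem card_le_of_poles_of_no_hub [DecidableRel G.Adj] (hR : IsColoredClique G R col)
    (hC : 3 ≤ Fintype.card C) (hP : G.IsPoles R w h X A B) (hA : A.Nonempty) (hB : B.Nonempty)
    (hnoA : ∀ u, u ≠ w → #{x ∈ A | G.Adj u x} ≤ 2) (hnoB : ∀ u, u ≠ h → #{x ∈ B | G.Adj u x} ≤ 2) :
    #R ≤ 2 * Fintype.card C ^ 2 + 2 := by
  classical
  have h1 := hR.card_le_of_poles hP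
  have h2 : #(({w, h} : Finset V) ∩ R) ≤ 2 :=
    (Finset.card_le_card inter_subset_left).trans Finset.card_le_two
  have h3 := hR.card_common_le hP hA hB
  obtain ⟨hs, ht⟩ := hR.card_image_lt_of_poles hP hA hB
  have h4 := hR.card_star_le_of_no_hub (w := w) (T := A) (fun x hx => ((hP.mem_A x).mp hx).1)
    (fun x hx => ((hP.mem_A x).mp hx).2.1) hnoA
  have h5 := hR.card_star_le_of_no_hub (w := h) (T := B) (fun x hx => ((hP.mem_B x).mp hx).1)
    (fun x hx => ((hP.mem_B x).mp hx).2.2) hnoB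
  have hs0 : 0 < #(A.image (col w)) := Finset.card_pos.mpr (hA.image _)
  have ht0 : 0 < #(B.image (col h)) := Finset.card_pos.mpr (hB.image _)
  generalize #(A.image (col w)) = s at *
  generalize #(B.image (col h)) = t at *
  generalize Fintype.card C = p at *
  obtain ⟨s', rfl⟩ := Nat.exists_eq_add_of_lt hs
  obtain ⟨t', ht'⟩ := Nat.exists_eq_add_of_lt ht
  have e1 : s + s' + 1 - s = s' + 1 := by omega
  have e2 : s + s' + 1 - t = t' + 1 := by omega
  rw [e1, e2] at h3
  -- Classes of private neighbours now have at most three elements, so the total is at most `2(p -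
  -- s)(p - t) + 2 + 3s + 3t + 2`.
  have : 2 * ((s' + 1) * (t' + 1)) + 3 * s + 3 * t + 4 ≤ 2 * (s + s' + 1) ^ 2 + 2 := by
    rcases Nat.eq_zero_or_pos t' with rfl | h
    · obtain rfl : t = s + s' := by omega
      nlinarith
    · have e3 : s + s' = t + t' := by omega
      nlinarith [Nat.mul_le_mul hs0 h, Nat.mul_le_mul hs0 ht0, Nat.mul_le_mul ht0 h]
  omega

/-- Without the summand 2, the right side exceeds the left by `(p - s)(t - q) + q(p - t)`, which
also equals `t(p - q) + s(q - t)`. The first form is at least 2 for `q ≤ t`, the second for `t ≤ q`;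
`p ≥ 3` is needed when `q = t`. -/
theorem poles_inequality {p s t q : ℕ} (hp : 3 ≤ p) (hs : 0 < s) (ht : 0 < t) (hq : 0 < q)
    (hsp : s < p) (htp : t < p) (hqp : q < p) :
    (p - s) * (p - t) + s * (p - q) + t * q + 2 ≤ p ^ 2 := by
  zify [hsp.le, htp.le, hqp.le] at *
  have h1 : (0 : ℤ) ≤ s - 1 := by omega
  have h2 : (0 : ℤ) ≤ t - 1 := by omega
  have h3 : (0 : ℤ) ≤ q - 1 := by omega
  have h4 : (0 : ℤ) ≤ p - 1 - s := by omega
  have h5 : (0 : ℤ) ≤ p - 1 - t := by omega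
  have h6 : (0 : ℤ) ≤ p - 1 - q := by omega
  rcases le_total (q : ℤ) t with h | h
  · nlinarith [mul_nonneg h4 (sub_nonneg.mpr h), mul_nonneg h3 h5]
  · nlinarith [mul_nonneg h1 (sub_nonneg.mpr h), mul_nonneg h6 h2]

/-- The bound if some vertex is adjacent to three private neighbours of one of the poles, and both
poles have three private neighbours. -/
theorem card_le_of_poles_of_hub [DecidableRel G.Adj] (hR : IsColoredClique G R col)
    (hC : 3 ≤ Fintype.card C) (hP : G.IsPoles R w h X A B) (hA : 3 ≤ #A) (hB : 3 ≤ #B) {u : V}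
    (huh : u ≠ h) (hu : 3 ≤ #{x ∈ B | G.Adj u x}) : #R ≤ 2 * Fintype.card C ^ 2 + 2 := by
  classical
  have hA0 : A.Nonempty := Finset.card_pos.mp (by omega)
  have hB0 : B.Nonempty := Finset.card_pos.mp (by omega)
  have hAm := fun x => (hP.mem_A x).mp
  have hBm := fun x => (hP.mem_B x).mp
  have hwh := hP.not_adj hR.tri
  have huw : u ≠ w := by
    rintro rfl
    obtain ⟨b, hb⟩ := Finset.card_pos.mp (show 0 < #{x ∈ B | G.Adj u x} by omega)
    obtain ⟨hb, hub⟩ := mem_filter.mp hb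
    exact (hBm b hb).2.1 hub
  -- Three common neighbours of `u` and `h` force the vertices of `A`, which are not adjacent to
  -- `h`, to be adjacent to `u`. By symmetry `u` is then adjacent to all of `A` and `B`.
  have hspread : ∀ {w h : V} {A B : Finset V}, u ≠ w → u ≠ h → G.IsPoles R w h X A B → 3 ≤ #A →
      3 ≤ #{x ∈ B | G.Adj u x} → ∀ a ∈ A, G.Adj u a := by
    intro w h A B huw huh hP hA hu a ha
    have key : ∀ a ∈ A, a ≠ u → G.Adj u a := fun a ha hau => by
      have ha' := (hP.mem_A a).mp ha
      refine (hR.adj_of_three huh.symm (X := {x ∈ B | G.Adj u x})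
        (fun x hx => ((hP.mem_B x).mp (mem_filter.mp hx).1).1)
        (fun x hx => ((hP.mem_B x).mp (mem_filter.mp hx).1).2.2)
        (fun x hx => (mem_filter.mp hx).2) hu ha'.1 ?_ hau).resolve_left ha'.2.2
      rintro rfl
      exact hP.not_adj hR.tri ha'.2.1
    refine key a ha ?_
    rintro rfl
    obtain ⟨a', ha', hne⟩ := Finset.exists_mem_ne (show 1 < #A by omega) a
    exact hR.tri w a a' ((hP.mem_A a).mp ha).2.1 (key a' ha' hne) ((hP.mem_A a').mp ha').2.1
  have huA := hspread huw huh hP hA hu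
  have huB := hspread huh huw hP.symm hB (by
    rwa [Finset.filter_true_of_mem huA])
  -- A pole `h` in `R` would have to be adjacent to `w` or `u`, and either edge would close a
  -- triangle. So the poles do not count, which pays for the additive constants 2 in the bounds for
  -- `X`, `A` and `B`.
  have hpole : ∀ {w h : V} {A B : Finset V}, u ≠ w → u ≠ h → G.IsPoles R w h X A B → 3 ≤ #A →
      (∀ a ∈ A, G.Adj u a) → (∀ b ∈ B, G.Adj u b) → 3 ≤ #B → h ∉ R := by
    intro w h A B huw huh hP hA huA huB hB hh
    obtain ⟨b, hb⟩ := Finset.card_pos.mp (show 0 < #B by omega)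
    have hb' := (hP.mem_B b).mp hb
    rcases hR.adj_of_three huw.symm (X := A) (fun x hx => ((hP.mem_A x).mp hx).1)
      (fun x hx => ((hP.mem_A x).mp hx).2.1) huA hA hh hP.ne.symm huh.symm with h1 | h1
    · exact hP.not_adj hR.tri h1
    · exact hR.tri u h b h1 hb'.2.2 (huB b hb)
  have hhR := hpole huw huh hP hA huA huB hB
  have hwR := hpole huh huw hP.symm hB huB huA hA
  have h0 : ({w, h} : Finset V) ∩ R = ∅ := by
    ext x
    simp only [mem_inter, mem_insert, mem_singleton, notMem_empty, iff_false]
    rintro ⟨rfl | rfl, h'⟩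
    exacts [hwR h', hhR h']
  have h1 := hR.card_le_of_poles hP
  rw [h0, Finset.card_empty] at h1
  have h3 := hR.card_common_le hP hA0 hB0
  obtain ⟨hs, ht⟩ := hR.card_image_lt_of_poles hP hA0 hB0
  have hs0 : 0 < #(A.image (col w)) := Finset.card_pos.mpr (hA0.image _)
  have ht0 : 0 < #(B.image (col h)) := Finset.card_pos.mpr (hB0.image _)
  have hq0 : 0 < #(B.image (col u)) := Finset.card_pos.mpr (hB0.image _)
  -- `A` is the set of common neighbours for the poles `w` and `u`. The star of `h` on `B` lies
  -- beside it, so the `q` colours of `B` at `u` are nearly lost for `A`: `|A| ≤ 2s(p - q) + 2`.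
  have h4 := hR.card_le_of_side huw.symm (fun x hx => (hAm x hx).1) (fun x hx => (hAm x hx).2.1)
    huA hA (B := B) (fun x hx => (hBm x hx).1) (K := insert h {b | b ∈ B}) huB
    (fun b hb => (hBm b hb).2.1) (ConnOn.star h fun b hb => (hBm b hb).2.2)
    (fun b hb => Or.inr hb) (by
      rintro (h' | h')
      exacts [hP.ne h', hwh (hBm _ h').2.2.symm]) (by
      rintro (h' | h')
      exacts [huh h', G.loopless.irrefl _ (huB _ h')]) (by
      rintro x hx (h' | h')
      · exact hwh (h' ▸ (hAm x hx).2.1)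
      · exact (hAm x hx).2.2 (hBm x h').2.2)
  have h5 : #B ≤ 2 * (#(B.image (col h)) * #(B.image (col u))) + 2 := by
    by_cases hB4 : 4 ≤ #B
    · have : #B ≤ 2 * #(B.image fun x => (col h x, col u x)) :=
        Finset.card_le_mul_card_image _ 2 fun c _ => by
          have hc : ∀ x ∈ ({x ∈ B | (col h x, col u x) = c} : Finset V),
              col h x = c.1 ∧ col u x = c.2 := fun x hx => Prod.ext_iff.mp (mem_filter.mp hx).2
          refine hR.card_fiber_le_two huh.symm (fun x hx => (hBm x hx).1)
            (fun x hx => (hBm x hx).2.2) huB hB4 (filter_subset _ _) ?_ ?_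
          · exact fun x hx y hy => (hc x hx).1.trans (hc y hy).1.symm
          · exact fun x hx y hy => (hc x hx).2.trans (hc y hy).2.symm
      have hsub : (B.image fun x => (col h x, col u x)) ⊆ B.image (col h) ×ˢ B.image (col u) := by
        intro c hc
        obtain ⟨x, hx, rfl⟩ := mem_image.mp hc
        exact mem_product.mpr ⟨mem_image_of_mem _ hx, mem_image_of_mem _ hx⟩
      have hle := Finset.card_le_card hsub
      rw [Finset.card_product] at hle
      omega
    · have := Nat.mul_le_mul ht0 hq0
      omega
  rw [mul_assoc] at h4
  have hq : #(B.image (col u)) < Fintype.card C := by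
    by_contra hcon
    have e : Fintype.card C - #(B.image (col u)) = 0 := by omega
    rw [e] at h4
    omega
  have := poles_inequality hC hs0 ht0 hq0 hs ht hq
  omega

/-- The bound if one of the poles has at most two private neighbours. -/
theorem card_le_of_poles_of_card_le_two (hR : IsColoredClique G R col)
    (hC : 3 ≤ Fintype.card C) (hP : G.IsPoles R w h X A B) (hA : A.Nonempty) (hB : B.Nonempty)
    (hA2 : #A ≤ 2) : #R ≤ 2 * Fintype.card C ^ 2 + 2 := by
  classical
  by_contra! hcon
  have hAm := fun x => (hP.mem_A x).mp
  have hBm := fun x => (hP.mem_B x).mp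
  have hXm := fun x => (hP.mem_X x).mp
  have hwh := hP.not_adj hR.tri
  have h1 := hR.card_le_of_poles hP
  have h2 : #(({w, h} : Finset V) ∩ R) ≤ 2 :=
    (Finset.card_le_card inter_subset_left).trans Finset.card_le_two
  have h3 := hR.card_common_le hP hA hB
  obtain ⟨hs, ht⟩ := hR.card_image_lt_of_poles hP hA hB
  have h4 := hR.card_star_le (by omega) (w := h) (T := B) (fun x hx => (hBm x hx).1)
    (fun x hx => (hBm x hx).2.2)
  have hs0 : 0 < #(A.image (col w)) := Finset.card_pos.mpr (hA.image _)
  set p := Fintype.card C with hp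
  have h3' : #X ≤ 2 * ((p - 1) * (p - #(B.image (col h)))) + 2 :=
    h3.trans (Nat.add_le_add_right (Nat.mul_le_mul_left 2
      (Nat.mul_le_mul_right _ (by omega))) _)
  -- For `t ≤ p - 2` the bounds for `X`, `B`, `A` and the poles add up to at most `2p² + 2`.
  have ht' : #(B.image (col h)) = p - 1 := by
    by_contra hne
    generalize #(B.image (col h)) = t at *
    obtain ⟨k, hk⟩ := Nat.exists_eq_add_of_le (show t + 2 ≤ p by omega)
    obtain ⟨q, hq⟩ := Nat.exists_eq_add_of_le (show 1 ≤ p by omega)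
    have e1 : p - t = k + 2 := by omega
    have e2 : p - 1 = q := by omega
    rw [e1, e2] at h3'
    have : 2 * (q * (k + 2)) + 2 + 2 * p * t + 4 ≤ 2 * p ^ 2 + 2 := by
      have e3 : q = t + 1 + k := by omega
      rw [hk, e3]
      nlinarith
    omega
  obtain ⟨q, hq⟩ := Nat.exists_eq_add_of_le (show 1 ≤ p by omega)
  have hq' : p - 1 = q := by omega
  rw [ht', hq'] at h3' h4
  have e1 : p - q = 1 := by omega
  rw [e1] at h3'
  have e2 : p ^ 2 = p * q + p := by rw [sq, hq]; ring
  have e3 : 2 * p * q = 2 * (p * q) := by ring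
  -- With `t = p - 1` the bounds add up to `2p² + 4`, so a counterexample loses at most one vertex
  -- in all of them together.
  have hBcard : 2 * (p * q) ≤ #B + 1 := by omega
  have hthree : 3 ≤ #A + #(({w, h} : Finset V) ∩ R) := by omega
  -- The other `q - 1` classes hold at most `2p` vertices each, which leaves at least `2p - 1` for
  -- this one.
  have hclass : ∀ b ∈ B, 4 ≤ #{x ∈ B | col h x = col h b} := by
    intro b hb
    have hle := hR.card_star_le (by omega) (w := h) (T := {x ∈ B | ¬ col h x = col h b})
      (fun x hx => (hBm x (mem_filter.mp hx).1).1) (fun x hx => (hBm x (mem_filter.mp hx).1).2.2)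
    have hsub : ({x ∈ B | ¬ col h x = col h b} : Finset V).image (col h) ⊆
        (B.image (col h)).erase (col h b) := by
      intro c hc
      obtain ⟨x, hx, rfl⟩ := mem_image.mp hc
      obtain ⟨hx, hne⟩ := mem_filter.mp hx
      exact mem_erase.mpr ⟨hne, mem_image_of_mem _ hx⟩
    have hcard := Finset.card_le_card hsub
    rw [Finset.card_erase_of_mem (mem_image_of_mem _ hb), ht', hq'] at hcard
    have hle' := hle.trans (Nat.mul_le_mul_left _ hcard)
    have hsplit := Finset.card_filter_add_card_filter_not (s := B) (fun x => col h x = col h b)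
    obtain ⟨k, hk⟩ := Nat.exists_eq_add_of_le (show 1 ≤ q by omega)
    have e4 : q - 1 = k := by omega
    rw [e4] at hle'
    have e5 : p * q = p + p * k := by rw [hk]; ring
    have e6 : 2 * p * k = 2 * (p * k) := by ring
    rw [← hp] at hle'
    omega
  have hhub : ∀ b, b ∈ B → ∃ u, u ≠ h ∧ ∀ x ∈ ({x ∈ B | col h x = col h b} : Finset V),
      G.Adj u x := fun b hb =>
    hR.exists_hub (fun x hx => (hBm x (mem_filter.mp hx).1).1)
      (fun x hx => (hBm x (mem_filter.mp hx).1).2.2)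
      (fun x hx y hy => (mem_filter.mp hx).2.trans (mem_filter.mp hy).2.symm) (hclass b hb)
  have : Nonempty V := ⟨w⟩
  choose! u huh hu using hhub
  have hub : ∀ b ∈ B, G.Adj (u b) b := fun b hb => hu b hb b (mem_filter.mpr ⟨hb, rfl⟩)
  have huw : ∀ b ∈ B, u b ≠ w := fun b hb h' => (hBm b hb).2.1 (h' ▸ hub b hb)
  have hnadj : ∀ b ∈ B, ¬ G.Adj h (u b) := fun b hb h' =>
    hR.tri h (u b) b h' (hub b hb) (hBm b hb).2.2
  have hv : ∀ b ∈ B, ∀ v ∈ R, ¬ G.Adj h v → v ≠ h → v ≠ u b → G.Adj (u b) v := by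
    intro b hb v hvR hhv hvh hvu
    refine (hR.adj_of_three (huh b hb).symm (X := {x ∈ B | col h x = col h b})
      (fun x hx => (hBm x (mem_filter.mp hx).1).1)
      (fun x hx => (hBm x (mem_filter.mp hx).1).2.2) (hu b hb) ?_ hvR hvh hvu).resolve_left hhv
    have := hclass b hb
    omega
  have hAh : ∀ a ∈ A, a ≠ h := by
    rintro a ha rfl
    exact hwh (hAm _ ha).2.1
  obtain ⟨b₀, hb₀⟩ := id hB
  -- All colour classes of `B` share one hub, and some `v` in `R` is adjacent to it but not to `h`.
  -- For `|A| = 2`, two distinct hubs would make a `K₃,₃`, and `v` is taken from `A`. For `|A| = 1`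
  -- the pole `w` must lie in `R`; then every hub is the only vertex of `A`, and `v = w`.
  have hone : ∃ v ∈ R, ¬ G.Adj h v ∧ v ≠ h ∧ ∀ b ∈ B, u b = u b₀ ∧ G.Adj (u b) v := by
    by_cases hA1 : 1 < #A
    · obtain ⟨a, ha, a', ha', haa'⟩ := Finset.one_lt_card.mp hA1
      have huA : ∀ b ∈ B, ∀ a ∈ A, G.Adj (u b) a := by
        intro b hb a ha
        refine hv b hb a (hAm a ha).1 (hAm a ha).2.2 (hAh a ha) ?_
        rintro rfl
        obtain ⟨a', ha', hne⟩ := Finset.exists_mem_ne hA1 (u b)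
        exact hR.tri w (u b) a' (hAm _ ha).2.1
          (hv b hb a' (hAm a' ha').1 (hAm a' ha').2.2 (hAh a' ha') hne) (hAm _ ha').2.1
      refine ⟨a, (hAm a ha).1, (hAm a ha).2.2, hAh a ha, fun b hb => ⟨?_, huA b hb a ha⟩⟩
      by_contra hne
      obtain ⟨x, hx⟩ := Finset.card_pos.mp (lt_of_lt_of_le (by norm_num) hP.three_le)
      have hx := hXm x hx
      have hbb : b ≠ b₀ := by
        rintro rfl
        exact hne rfl
      have hcard : #({a, a', h} : Finset V) = 3 :=
        Finset.card_eq_three.mpr ⟨a, a', h, haa', hAh a ha, hAh a' ha', rfl⟩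
      have huB : ∀ b ∈ B, ∀ b' ∈ B, u b ≠ b' := fun b hb b' hb' h' =>
        hnadj b hb (h' ▸ (hBm b' hb').2.2)
      have hux : ∀ b ∈ B, u b ≠ x := fun b hb h' => hnadj b hb (h' ▸ hx.2.2)
      have hbw : ∀ b ∈ B, b ≠ w := by
        rintro b hb rfl
        exact hwh (hBm _ hb).2.2.symm
      have hbx : ∀ b ∈ B, b ≠ x := by
        rintro b hb rfl
        exact (hBm _ hb).2.1 hx.2.1
      have hAtouch : ∀ b ∈ B, ∀ a ∈ A, G.Touches {u b, b} a := by
        refine fun b hb a ha => ⟨?_, u b, by simp, (huA b hb a ha).symm⟩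
        rintro (h' | h')
        · exact hnadj b hb (by
            have := huA b hb a ha
            rw [h'] at this
            exact absurd this (G.loopless.irrefl _))
        · exact (hBm b hb).2.1 (h' ▸ (hAm a ha).2.1)
      have hhtouch : ∀ b ∈ B, G.Touches {u b, b} h := by
        refine fun b hb => ⟨?_, b, by simp, (hBm b hb).2.2⟩
        rintro (h' | h')
        · exact huh b hb h'.symm
        · exact (hBm b hb).2.2.ne h'
      have hAw : ∀ a ∈ A, G.Touches {w, x} a := by
        refine fun a ha => ⟨?_, w, by simp, (hAm a ha).2.1.symm⟩
        rintro (h' | h')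
        · exact (hAm a ha).2.1.ne h'.symm
        · exact (hAm a ha).2.2 (h' ▸ hx.2.2)
      have hhw : G.Touches {w, x} h := by
        refine ⟨?_, x, by simp, hx.2.2⟩
        rintro (h' | h')
        · exact hP.ne h'.symm
        · exact hx.2.2.ne h'
      have hpair : ∀ b ∈ B, G.ConnOn {u b, b} := fun b hb =>
        ConnOn.star (u b) fun z hz => by rw [Set.mem_singleton_iff.mp hz]; exact hub b hb
      have hdis : ∀ b ∈ B, Disjoint ({u b, b} : Set V) {w, x} := by
        intro b hb
        rw [Set.disjoint_left]
        rintro z (rfl | rfl) (h' | h')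
        exacts [huw b hb h', hux b hb h', hbw z hb h', hbx z hb h']
      -- The `K₃,₃` has the two vertices of `A` and `h` on one side, and on the other the two hubs,
      -- each with a vertex of `B`, and `w` with a common neighbour `x` of the poles.
      have := hR.planar.card_le_two (hpair b hb) (hpair b₀ hb₀)
        (ConnOn.star w (Z := {x}) (by rintro _ rfl; exact hx.2.1)) (by
          rw [Set.disjoint_left]
          rintro z (rfl | rfl) (h' | h')
          exacts [hne h', huB b hb b₀ hb₀ h', huB b₀ hb₀ z hb h'.symm, hbb h']) (hdis b hb)
        (hdis b₀ hb₀) {a, a', h}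
        (by simpa using ⟨hAtouch b hb a ha, hAtouch b hb a' ha', hhtouch b hb⟩)
        (by simpa using ⟨hAtouch b₀ hb₀ a ha, hAtouch b₀ hb₀ a' ha', hhtouch b₀ hb₀⟩)
        (by simpa using ⟨hAw a ha, hAw a' ha', hhw⟩)
      omega
    · have hwR : w ∈ R := by
        by_contra hwR
        have hsub : ({w, h} : Finset V) ∩ R ⊆ ({h} : Finset V) := by
          intro x hx
          simp only [mem_inter, mem_insert, mem_singleton] at hx ⊢
          rcases hx with ⟨rfl | rfl, h'⟩
          exacts [absurd h' hwR, rfl]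
        have := Finset.card_le_card hsub
        rw [Finset.card_singleton] at this
        omega
      obtain ⟨a, ha⟩ := hA
      have hua : ∀ b ∈ B, u b = a ∧ G.Adj (u b) w := by
        intro b hb
        have huw' := hv b hb w hwR (fun h' => hwh h'.symm) hP.ne (huw b hb).symm
        refine ⟨?_, huw'⟩
        by_contra hne
        exact hR.tri w (u b) a huw'.symm
          (hv b hb a (hAm a ha).1 (hAm a ha).2.2 (hAh a ha) (Ne.symm hne)) (hAm a ha).2.1
      exact ⟨w, hwR, fun h' => hwh h'.symm, hP.ne, fun b hb =>
        ⟨(hua b hb).1.trans (hua b₀ hb₀).1.symm, (hua b hb).2⟩⟩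
  obtain ⟨v, hvR, hhv, hvh, hall⟩ := hone
  -- The vertex `v` costs one colour at the hub, so `|B| ≤ 2(p - 1)² + 2`. This is too small for `p
  -- ≥ 3`.
  have h6 := hR.card_le_of_side (huh b₀ hb₀).symm (fun x hx => (hBm x hx).1)
    (fun x hx => (hBm x hx).2.2) (fun x hx => (hall x hx).1 ▸ hub x hx) (by
      have := hclass b₀ hb₀
      have := Finset.card_le_card (Finset.filter_subset (fun x => col h x = col h b₀) B)
      omega) (B := {v}) (by simpa using hvR) (K := {v}) (by simpa using (hall b₀ hb₀).2)
    (by simpa using hhv) (ConnOn.singleton v) (by simp) (by simpa using hvh.symm)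
    (by simpa using (hall b₀ hb₀).2.ne) (by
      rintro x hx rfl
      exact hhv (hBm _ hx).2.2)
  rw [Finset.image_singleton, Finset.card_singleton, ht', ← hp, hq'] at h6
  have e7 : p * q = q + q * q := by rw [hq]; ring
  have e8 : 2 * q * q = 2 * (q * q) := by ring
  omega

/-- A coloured clique in a triangle-free planar graph has at most `2p² + 2` elements, where `p` is
the number of colours. -/
theorem card_le (hR : IsColoredClique G R col) (hC : 3 ≤ Fintype.card C) :
    #R ≤ 2 * Fintype.card C ^ 2 + 2 := by
  classical
  have := Fintype.ofFinite V
  by_cases hno : ∀ w h, w ≠ h → #{x ∈ R | G.Adj w x ∧ G.Adj h x} ≤ 2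
  -- At `p = 3` the value `2p² + 2` is exactly 20.
  · refine (hR.card_le_of_no_hub hno).trans (max_le ?_ ?_) <;> nlinarith
  push Not at hno
  obtain ⟨w, h, hne, h3⟩ := hno
  have hP : G.IsPoles R w h {x ∈ R | G.Adj w x ∧ G.Adj h x} {x ∈ R | G.Adj w x ∧ ¬ G.Adj h x}
      {x ∈ R | ¬ G.Adj w x ∧ G.Adj h x} :=
    { ne := hne
      mem_X := by simp
      mem_A := by simp
      mem_B := by simp
      three_le := h3 }
  generalize ({x ∈ R | G.Adj w x ∧ G.Adj h x} : Finset V) = X at hP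
  generalize ({x ∈ R | G.Adj w x ∧ ¬ G.Adj h x} : Finset V) = A at hP
  generalize ({x ∈ R | ¬ G.Adj w x ∧ G.Adj h x} : Finset V) = B at hP
  rcases A.eq_empty_or_nonempty with rfl | hA
  · exact hR.card_le_of_poles_of_empty (by omega) hP.symm
  rcases B.eq_empty_or_nonempty with rfl | hB
  · exact hR.card_le_of_poles_of_empty (by omega) hP
  by_cases hA2 : #A ≤ 2
  · exact hR.card_le_of_poles_of_card_le_two hC hP hA hB hA2
  by_cases hB2 : #B ≤ 2
  · exact hR.card_le_of_poles_of_card_le_two hC hP.symm hB hA hB2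
  by_cases hnA : ∀ u, u ≠ w → #{x ∈ A | G.Adj u x} ≤ 2
  · by_cases hnB : ∀ u, u ≠ h → #{x ∈ B | G.Adj u x} ≤ 2
    · exact hR.card_le_of_poles_of_no_hub hC hP hA hB hnA hnB
    · push Not at hnB
      obtain ⟨u, huh, hu⟩ := hnB
      exact hR.card_le_of_poles_of_hub hC hP (by omega) (by omega) huh hu
  · push Not at hnA
    obtain ⟨u, huw, hu⟩ := hnA
    exact hR.card_le_of_poles_of_hub hC hP.symm (by omega) (by omega) huw hu

end IsColoredClique

/-! ### From relative cliques to coloured cliques. -/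

namespace NMGraph

variable {n m : ℕ} {V W : Type u}

/-- The ways in which a vertex sees a neighbour: along or against an arc, or along an edge. -/
abbrev Color (n m : ℕ) : Type := (Fin n × Bool) ⊕ Fin m

/-- The colour of a link seen from its other end. -/
def Color.flip : Color n m → Color n m
  | .inl (i, b) => .inl (i, !b)
  | .inr j => .inr j

theorem Color.flip_flip (c : Color n m) : c.flip.flip = c := by
  rcases c with ⟨i, b⟩ | j <;> simp [Color.flip]

theorem card_color (n m : ℕ) : Fintype.card (Color n m) = 2 * n + m := by
  simp [mul_comm]

/-- `u` sees its neighbour `v` in colour `c`. -/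
def Sees (G : NMGraph n m V) : Color n m → V → V → Prop
  | .inl (i, true), u, v => G.arc i u v
  | .inl (i, false), u, v => G.arc i v u
  | .inr j, u, v => G.edge j u v

variable {G : NMGraph n m V} {H : NMGraph n m W}

theorem Sees.flip {c : Color n m} {u v : V} (h : G.Sees c u v) : G.Sees c.flip v u := by
  rcases c with ⟨i, _ | _⟩ | j
  exacts [h, h, G.edge_symm j u v h]

theorem Sees.unique {c c' : Color n m} {u v : V} (h : G.Sees c u v) (h' : G.Sees c' u v) :
    c = c' := by
  rcases c with ⟨i, _ | _⟩ | j <;> rcases c' with ⟨i', _ | _⟩ | j'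
  · rw [G.arc_unique i i' v u h h']
  · exact absurd h' (G.arc_asymm i i' v u h)
  · exact absurd (G.edge_symm _ _ _ h') (G.arc_not_edge i j' v u h)
  · exact absurd h' (G.arc_asymm i i' u v h)
  · rw [G.arc_unique i i' u v h h']
  · exact absurd h' (G.arc_not_edge i j' u v h)
  · exact absurd (G.edge_symm _ _ _ h) (G.arc_not_edge i' j v u h')
  · exact absurd h (G.arc_not_edge i' j u v h')
  · rw [G.edge_unique j j' u v h h']

theorem und_adj_iff {u v : V} : G.und.Adj u v ↔ ∃ c, G.Sees c u v := by
  constructor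
  · rintro (⟨i, h | h⟩ | ⟨j, h⟩)
    exacts [⟨.inl (i, true), h⟩, ⟨.inl (i, false), h⟩, ⟨.inr j, h⟩]
  · rintro ⟨⟨i, _ | _⟩ | j, h⟩
    exacts [Or.inl ⟨i, Or.inr h⟩, Or.inl ⟨i, Or.inl h⟩, Or.inr ⟨j, h⟩]

theorem Sees.ne {c : Color n m} {u v : V} (h : G.Sees c u v) : u ≠ v :=
  (und_adj_iff.mpr ⟨c, h⟩).ne

theorem IsHom.sees {f : V → W} (hf : G.IsHom H f) {c : Color n m} {u v : V}
    (h : G.Sees c u v) : H.Sees c (f u) (f v) := by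
  rcases c with ⟨i, _ | _⟩ | j
  exacts [hf.1 i v u h, hf.1 i u v h, hf.2 j u v h]

/-- The image of an `(n,m)`-graph under a vertex map that is compatible with its links. -/
def map (G : NMGraph n m V) (f : V → W) (hne : ∀ c x y, G.Sees c x y → f x ≠ f y)
    (hun : ∀ c c' x y x' y', G.Sees c x y → G.Sees c' x' y' → f x = f x' → f y = f y' → c = c') :
    NMGraph n m W where
  arc i a b := ∃ x y, f x = a ∧ f y = b ∧ G.arc i x y
  edge j a b := ∃ x y, f x = a ∧ f y = b ∧ G.edge j x y
  edge_symm := by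
    rintro j _ _ ⟨x, y, rfl, rfl, h⟩
    exact ⟨y, x, rfl, rfl, G.edge_symm j x y h⟩
  arc_irrefl := by
    rintro i _ ⟨x, y, rfl, hy, h⟩
    exact hne (.inl (i, true)) x y h hy.symm
  edge_irrefl := by
    rintro j _ ⟨x, y, rfl, hy, h⟩
    exact hne (.inr j) x y h hy.symm
  arc_unique := by
    rintro i i' _ _ ⟨x, y, rfl, rfl, h⟩ ⟨x', y', hx, hy, h'⟩
    simpa using hun (.inl (i, true)) (.inl (i', true)) x y x' y' h h' hx.symm hy.symm
  arc_asymm := by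
    rintro i i' _ _ ⟨x, y, rfl, rfl, h⟩ ⟨x', y', hx, hy, h'⟩
    simpa using hun (.inl (i, true)) (.inl (i', false)) x y y' x' h h' hy.symm hx.symm
  edge_unique := by
    rintro j j' _ _ ⟨x, y, rfl, rfl, h⟩ ⟨x', y', hx, hy, h'⟩
    simpa using hun (.inr j) (.inr j') x y x' y' h h' hx.symm hy.symm
  arc_not_edge := by
    rintro i j _ _ ⟨x, y, rfl, rfl, h⟩ ⟨x', y', hx, hy, h'⟩
    simpa using hun (.inl (i, true)) (.inr j) x y x' y' h h' hx.symm hy.symm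

theorem isHom_map (f : V → W) (hne : ∀ c x y, G.Sees c x y → f x ≠ f y)
    (hun : ∀ c c' x y x' y', G.Sees c x y → G.Sees c' x' y' → f x = f x' → f y = f y' → c = c') :
    G.IsHom (G.map f hne hun) f :=
  ⟨fun _ u v h => ⟨u, v, rfl, rfl, h⟩, fun _ u v h => ⟨u, v, rfl, rfl, h⟩⟩

/-- Two vertices of a relative clique are adjacent or seen in different colours by a common
neighbour, since they could be identified otherwise. -/
theorem IsRelativeClique.adj_or_sees [Finite V] {R : Set V} (hR : G.IsRelativeClique R) {u v : V}
    (hu : u ∈ R) (hv : v ∈ R) (huv : u ≠ v) :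
    G.und.Adj u v ∨ ∃ z c c', G.Sees c z u ∧ G.Sees c' z v ∧ c ≠ c' := by
  classical
  by_contra! hcon
  obtain ⟨hadj, hcon⟩ := hcon
  let f : V → V := fun x => if x = v then u else x
  have hf : ∀ x y, f x = f y → x = y ∨ (x = u ∧ y = v) ∨ (x = v ∧ y = u) := by
    intro x y
    simp only [f]
    split_ifs with h1 h2 h2
    · exact fun _ => Or.inl (h1.trans h2.symm)
    · exact fun h => Or.inr (Or.inr ⟨h1, h.symm⟩)
    · exact fun h => Or.inr (Or.inl ⟨h, h2⟩)
    · exact Or.inl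
  have hone : ∀ c c' z x y, G.Sees c z x → G.Sees c' z y → f x = f y → c = c' := by
    intro c c' z x y h h' hxy
    rcases hf x y hxy with rfl | ⟨rfl, rfl⟩ | ⟨rfl, rfl⟩
    · exact h.unique h'
    · exact hcon z c c' h h'
    · exact (hcon z c' c h' h).symm
  have hne : ∀ c x y, G.Sees c x y → f x ≠ f y := by
    intro c x y h hxy
    rcases hf x y hxy with rfl | ⟨rfl, rfl⟩ | ⟨rfl, rfl⟩
    · exact h.ne rfl
    · exact hadj (und_adj_iff.mpr ⟨c, h⟩)
    · exact hadj (und_adj_iff.mpr ⟨c, h⟩).symm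
  have hun : ∀ c c' x y x' y', G.Sees c x y → G.Sees c' x' y' → f x = f x' → f y = f y' →
      c = c' := by
    intro c c' x y x' y' h h' hx hy
    by_cases hyy : y = y'
    · subst hyy
      rw [← c.flip_flip, ← c'.flip_flip, hone _ _ y x x' h.flip h'.flip hx]
    by_cases hxx : x = x'
    · subst hxx
      exact hone _ _ x y y' h h' hy
    -- If both ends of the two links differ but are merged, then the first link would join `u` and
    -- `v` or be a loop.
    have hxy := und_adj_iff.mpr ⟨c, h⟩
    rcases hf x x' hx with h1 | ⟨h1, _⟩ | ⟨h1, _⟩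
    · exact absurd h1 hxx
    all_goals
      rcases hf y y' hy with h3 | ⟨h3, _⟩ | ⟨h3, _⟩
      · exact absurd h3 hyy
      all_goals
        rw [h1, h3] at hxy
        first
          | exact absurd rfl hxy.ne
          | exact absurd hxy hadj
          | exact absurd hxy.symm hadj
  have himg := hR V (G.map f hne hun) f (isHom_map f hne hun)
  have hinj := Set.injOn_of_ncard_image_eq himg (Set.toFinite R)
  refine huv (hinj hu hv ?_)
  simp [f]

/-- The colour in which a vertex sees another one, if they are adjacent. -/
noncomputable def col [Nonempty (Color n m)] (G : NMGraph n m V) (u v : V) : Color n m :=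
  Classical.epsilon fun c => G.Sees c u v

theorem Sees.col_eq [Nonempty (Color n m)] {c : Color n m} {u v : V} (h : G.Sees c u v) :
    G.col u v = c :=
  (Classical.epsilon_spec (p := fun c => G.Sees c u v) ⟨c, h⟩).unique h

theorem IsRelativeClique.ncard_le [Finite V] (hnm : 3 ≤ 2 * n + m)
    (hG : TriangleFreePlanar V G.und) {R : Set V} (hR : G.IsRelativeClique R) :
    R.ncard ≤ 2 * (2 * n + m) ^ 2 + 2 := by
  classical
  have : Nonempty (Color n m) := Fintype.card_pos_iff.mp (by rw [card_color]; omega)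
  have hfin := Set.toFinite R
  rw [Set.ncard_eq_toFinset_card R hfin, ← card_color n m]
  refine IsColoredClique.card_le (G := G.und) (col := G.col) ⟨hG.2, ?_, ?_⟩ (by rwa [card_color])
  · intro a b d h1 h2 h3
    exact hG.1 {a, b, d} (is3Clique_triple_iff.mpr ⟨h1, h3, h2⟩)
  · intro u hu v hv huv
    rw [Set.Finite.mem_toFinset] at hu hv
    refine (hR.adj_or_sees hu hv huv).imp_right ?_
    rintro ⟨z, c, c', h, h', hne⟩
    exact ⟨z, und_adj_iff.mpr ⟨c, h⟩, und_adj_iff.mpr ⟨c', h'⟩, by rwa [h.col_eq, h'.col_eq]⟩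

theorem relativeCliqueNumber_le [Finite V] (hnm : 3 ≤ 2 * n + m)
    (hG : TriangleFreePlanar V G.und) :
    G.relativeCliqueNumber ≤ 2 * (2 * n + m) ^ 2 + 2 := by
  refine csSup_le' ?_
  rintro k ⟨R, hR, rfl⟩
  exact hR.ncard_le hnm hG

end NMGraph

/-- A graph whose edges can be drawn as straight segments is planar. -/
theorem IsPlanar.of_segment {V : Type u} {G : SimpleGraph V} (pos : V → ℝ × ℝ)
    (hpos : Function.Injective pos)
    (hmem : ∀ u v w, G.Adj u v → pos w ∈ segment ℝ (pos u) (pos v) → w = u ∨ w = v)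
    (hinter : ∀ u v u' v', G.Adj u v → G.Adj u' v' → s(u, v) ≠ s(u', v') →
      ∀ z ∈ segment ℝ (pos u) (pos v), z ∈ segment ℝ (pos u') (pos v') →
        ∃ w, (w = u ∨ w = v) ∧ (w = u' ∨ w = v') ∧ z = pos w) : IsPlanar G :=
  ⟨{ pos := pos
     pos_injective := hpos
     arc := Sym2.lift ⟨fun u v => segment ℝ (pos u) (pos v), fun u v => segment_symm ℝ _ _⟩
     isPolygonalArc := by
       intro u v huv
       refine ⟨1, fun i => if i = 0 then pos u else pos v, by simp, by simp, ?_, ?_, ?_⟩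
       · intro i hi
         obtain rfl : i = 0 := by omega
         simpa using fun h => huv.ne (hpos h)
       · intro i j hij hj
         omega
       · simp
     mem_of_pos_mem := by
       intro e
       induction e with
       | h u v =>
         intro he w hw
         rw [Sym2.mem_iff]
         exact hmem u v w he hw
     inter_subset := by
       intro e he e' he' hne z hz hz'
       induction e with
       | h u v =>
         induction e' with
         | h u' v' =>
           obtain ⟨w, h1, h2, h3⟩ := hinter u v u' v' he he' hne z hz hz'
           exact ⟨w, Sym2.mem_iff.mpr h1, Sym2.mem_iff.mpr h2, h3⟩ }⟩

/-! ### The extremal graph. -/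

namespace NMGraph

/-- The vertices of the extremal graph: two poles, leaves adjacent to both of them, in pairs, and a
vertex in the middle of each pair. -/
inductive PoleVertex (K : Type u) : Type u
  | top
  | bot
  | mid (k : K)
  | leaf (k : K) (s : Bool)

namespace PoleVertex

variable {n m : ℕ} {K : Type u}

instance [Finite K] : Finite (PoleVertex K) := by
  refine Finite.of_surjective (α := Bool ⊕ K ⊕ K × Bool) (fun
    | .inl true => top
    | .inl false => bot
    | .inr (.inl k) => mid k
    | .inr (.inr (k, s)) => leaf k s) ?_
  rintro (_ | _ | k | ⟨k, s⟩)
  exacts [⟨.inl true, rfl⟩, ⟨.inl false, rfl⟩, ⟨.inr (.inl k), rfl⟩, ⟨.inr (.inr (k, s)), rfl⟩]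

/-- The colour in which a pole or a middle vertex sees a leaf. -/
def label [DecidableEq K] (α β : K → Color n m) (γ : Bool → Color n m) :
    PoleVertex K → PoleVertex K → Option (Color n m)
  | top, leaf k _ => some (α k)
  | bot, leaf k _ => some (β k)
  | mid k, leaf k' s => if k = k' then some (γ s) else none
  | leaf k _, top => some (α k).flip
  | leaf k _, bot => some (β k).flip
  | leaf k s, mid k' => if k' = k then some (γ s).flip else none
  | _, _ => none

theorem label_symm [DecidableEq K] (α β : K → Color n m) (γ : Bool → Color n m)
    (u v : PoleVertex K) : label α β γ v u = (label α β γ u v).map Color.flip := by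
  rcases u with _ | _ | k | ⟨k, s⟩ <;> rcases v with _ | _ | k' | ⟨k', s'⟩ <;>
    simp only [label, Option.map_some, Option.map_none, Color.flip_flip] <;> split_ifs <;>
    simp [Color.flip_flip]

theorem label_self [DecidableEq K] (α β : K → Color n m) (γ : Bool → Color n m)
    (u : PoleVertex K) : label α β γ u u = none := by
  rcases u with _ | _ | k | ⟨k, s⟩ <;> rfl

end PoleVertex

variable {n m : ℕ} {V : Type u}

/-- The `(n,m)`-graph with given colours of its links. -/
def ofLabel (l : V → V → Option (Color n m)) (hsymm : ∀ u v, l v u = (l u v).map Color.flip)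
    (hself : ∀ u, l u u = none) : NMGraph n m V where
  arc i u v := l u v = some (.inl (i, true))
  edge j u v := l u v = some (.inr j)
  edge_symm j u v h := by rw [hsymm, h]; rfl
  arc_irrefl i v h := by rw [hself] at h; cases h
  edge_irrefl j v h := by rw [hself] at h; cases h
  arc_unique i i' u v h h' := by rw [h] at h'; simpa using h'
  arc_asymm i i' u v h h' := by rw [hsymm, h] at h'; simp [Color.flip] at h'
  edge_unique j j' u v h h' := by rw [h] at h'; simpa using h'
  arc_not_edge i j u v h h' := by rw [h] at h'; simp at h'

theorem ofLabel_sees {l : V → V → Option (Color n m)}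
    {hsymm : ∀ u v, l v u = (l u v).map Color.flip} {hself : ∀ u, l u u = none} {c : Color n m}
    {u v : V} : (ofLabel l hsymm hself).Sees c u v ↔ l u v = some c := by
  rcases c with ⟨i, _ | _⟩ | j
  · change l v u = _ ↔ _
    rw [hsymm, Option.map_eq_some_iff]
    constructor
    · rintro ⟨c, h, hc⟩
      rw [h, ← c.flip_flip, hc]
      rfl
    · exact fun h => ⟨_, h, rfl⟩
  · exact Iff.rfl
  · exact Iff.rfl

namespace PoleVertex

variable {K : Type u} [DecidableEq K] (α β : K → Color n m) (γ : Bool → Color n m)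

/-- The extremal graph. -/
def graph : NMGraph n m (PoleVertex K) :=
  ofLabel (label α β γ) (label_symm α β γ) (label_self α β γ)

/-- The edges of the extremal graph. -/
inductive IsLink : PoleVertex K → PoleVertex K → Prop
  | top (k : K) (s : Bool) : IsLink top (leaf k s)
  | bot (k : K) (s : Bool) : IsLink bot (leaf k s)
  | mid (k : K) (s : Bool) : IsLink (mid k) (leaf k s)

theorem isLink_of_adj {u v : PoleVertex K} (h : (graph α β γ).und.Adj u v) :
    IsLink u v ∨ IsLink v u := by
  obtain ⟨c, h⟩ := und_adj_iff.mp h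
  have h : label α β γ u v = some c := ofLabel_sees.mp h
  rcases u with _ | _ | k | ⟨k, s⟩ <;> rcases v with _ | _ | k' | ⟨k', s'⟩ <;>
    simp only [label, reduceCtorEq] at h
  · exact Or.inl (.top _ _)
  · exact Or.inl (.bot _ _)
  · split_ifs at h with hk
    subst hk
    exact Or.inl (.mid _ _)
  · exact Or.inr (.top _ _)
  · exact Or.inr (.bot _ _)
  · split_ifs at h with hk
    subst hk
    exact Or.inr (.mid _ _)

theorem cliqueFree : (graph α β γ).und.CliqueFree 3 := by
  classical
  intro S hS
  obtain ⟨a, b, c, hab, hac, hbc, _⟩ := is3Clique_iff.mp hS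
  rcases isLink_of_adj α β γ hab with h1 | h1 <;> rcases isLink_of_adj α β γ hac with h2 | h2 <;>
    rcases isLink_of_adj α β γ hbc with h3 | h3 <;> cases h1 <;> cases h2 <;> cases h3

section

variable {K : Type u}

/-- The drawing of the extremal graph: the poles on the vertical axis, everything else on the
horizontal axis. -/
noncomputable def pos (ι : K → ℕ) : PoleVertex K → ℝ × ℝ
  | top => (0, 1)
  | bot => (0, -1)
  | mid k => (2 * ι k + 1 / 2, 0)
  | leaf k s => ((2 * ι k + s.toNat : ℕ), 0)

/-- The equation of the segment for a link. -/
def OnLink (ι : K → ℕ) (z : ℝ × ℝ) : PoleVertex K → PoleVertex K → Prop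
  | top, leaf k s => z.1 = (1 - z.2) * (2 * ι k + s.toNat : ℕ) ∧ 0 ≤ z.2
  | bot, leaf k s => z.1 = (1 + z.2) * (2 * ι k + s.toNat : ℕ) ∧ z.2 ≤ 0
  | mid _, leaf k s => z.2 = 0 ∧ |z.1 - (2 * ι k + s.toNat : ℕ)| ≤ 1 / 2 ∧
      |z.1 - (2 * ι k + 1 / 2)| ≤ 1 / 2
  | _, _ => False

theorem onLink_of_mem_segment (ι : K → ℕ) {u v : PoleVertex K} (h : IsLink u v) {z : ℝ × ℝ}
    (hz : z ∈ segment ℝ (pos ι u) (pos ι v)) : OnLink ι z u v := by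
  obtain ⟨a, b, ha, hb, hab, rfl⟩ := hz
  obtain rfl : a = 1 - b := by linarith
  cases h with
  | top k s => simp [OnLink, pos]; linarith
  | bot k s => simp [OnLink, pos]; linarith
  | mid k s =>
    refine ⟨by simp [pos], ?_, ?_⟩ <;> rw [abs_le] <;> cases s <;> simp [pos] <;>
      constructor <;> nlinarith

theorem leaf_inj {ι : K → ℕ} (hι : Function.Injective ι) {k k' : K} {s s' : Bool}
    (h : 2 * ι k + s.toNat = 2 * ι k' + s'.toNat) : leaf k s = leaf k' s' := by
  have hs := Bool.toNat_le s
  have hs' := Bool.toNat_le s'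
  obtain rfl : k = k' := hι (by omega)
  have : s.toNat = s'.toNat := by omega
  cases s <;> cases s' <;> simp_all

theorem nat_eq_of_abs_sub_le {a b : ℕ} (h : |(a : ℝ) - b| ≤ 1 / 2) : a = b := by
  rw [abs_le] at h
  have h1 : (a : ℝ) < b + 1 := by linarith
  have h2 : (b : ℝ) < a + 1 := by linarith
  norm_cast at h1 h2
  omega

theorem nat_add_half_ne (a b : ℕ) : (2 * a + 1 / 2 : ℝ) ≠ b := by
  intro h
  have h1 : (4 * a + 1 : ℝ) = 2 * b := by linarith
  norm_cast at h1
  omega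

theorem pos_injective {ι : K → ℕ} (hι : Function.Injective ι) : Function.Injective (pos ι) := by
  intro u v h
  have h1 : (pos ι u).1 = (pos ι v).1 := congrArg Prod.fst h
  have h2 : (pos ι u).2 = (pos ι v).2 := congrArg Prod.snd h
  clear h
  rcases u with _ | _ | k | ⟨k, s⟩ <;> rcases v with _ | _ | k' | ⟨k', s'⟩ <;>
    first
      | rfl
      | (exfalso; norm_num [pos] at h2; done)
      | skip
  · rw [hι (show ι k = ι k' by
      simp only [pos] at h1
      exact_mod_cast (by linarith : (ι k : ℝ) = ι k'))]
  · exact absurd h1 (nat_add_half_ne _ _)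
  · exact absurd h1.symm (nat_add_half_ne _ _)
  · exact leaf_inj hι (Nat.cast_injective (R := ℝ) h1)

theorem eq_or_eq_of_onLink {ι : K → ℕ} (hι : Function.Injective ι) {u v w : PoleVertex K}
    (h : IsLink u v) (hw : OnLink ι (pos ι w) u v) : w = u ∨ w = v := by
  cases h with
  | top k s =>
    rcases w with _ | _ | k' | ⟨k', s'⟩ <;> simp only [OnLink, pos] at hw
    · exact Or.inl rfl
    · linarith [hw.2]
    · rw [sub_zero, one_mul] at hw
      exact absurd hw.1 (nat_add_half_ne _ _)
    · rw [sub_zero, one_mul] at hw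
      exact Or.inr (leaf_inj hι (by exact_mod_cast hw.1))
  | bot k s =>
    rcases w with _ | _ | k' | ⟨k', s'⟩ <;> simp only [OnLink, pos] at hw
    · linarith [hw.2]
    · exact Or.inl rfl
    · rw [add_zero, one_mul] at hw
      exact absurd hw.1 (nat_add_half_ne _ _)
    · rw [add_zero, one_mul] at hw
      exact Or.inr (leaf_inj hι (by exact_mod_cast hw.1))
  | mid k s =>
    rcases w with _ | _ | k' | ⟨k', s'⟩ <;> simp only [OnLink, pos] at hw
    · linarith [hw.1]
    · linarith [hw.1]
    · refine Or.inl (congrArg mid (hι ?_))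
      refine nat_eq_of_abs_sub_le ?_
      have := hw.2.2
      rw [abs_le] at this ⊢
      constructor <;> linarith
    · exact Or.inr (leaf_inj hι (nat_eq_of_abs_sub_le hw.2.1))

theorem exists_of_onLink {ι : K → ℕ} (hι : Function.Injective ι) {u v u' v' : PoleVertex K}
    (h : IsLink u v) (h' : IsLink u' v') (hne : ¬ (u = u' ∧ v = v')) {z : ℝ × ℝ}
    (hz : OnLink ι z u v) (hz' : OnLink ι z u' v') :
    ∃ w, (w = u ∨ w = v) ∧ (w = u' ∨ w = v') ∧ z = pos ι w := by
  have hleaf : ∀ {k k' : K} {s s' : Bool}, z.2 = 0 → z.1 = (2 * ι k + s.toNat : ℕ) →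
      |z.1 - (2 * ι k' + s'.toNat : ℕ)| ≤ 1 / 2 →
      leaf k s = leaf k' s' ∧ z = pos ι (leaf k s) := by
    intro k k' s s' h2 h1 h3
    rw [h1] at h3
    exact ⟨leaf_inj hι (nat_eq_of_abs_sub_le h3), Prod.ext h1 h2⟩
  have habs : ∀ {x : ℝ} {N : ℕ}, x = N → |x - N| ≤ 1 / 2 := by
    rintro x N rfl
    norm_num
  cases h with
  | top k s =>
    cases h' with
    | top k' s' =>
      have hmul : (1 - z.2) *
          (((2 * ι k + s.toNat : ℕ) : ℝ) - (2 * ι k' + s'.toNat : ℕ)) = 0 := by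
        linarith [hz.1, hz'.1]
      rcases mul_eq_zero.mp hmul with h1 | h1
      · refine ⟨top, Or.inl rfl, Or.inl rfl, Prod.ext ?_ ?_⟩
        · rw [hz.1, h1, zero_mul, pos]
        · rw [pos]; linarith
      · exact absurd ⟨rfl, leaf_inj hι (by exact_mod_cast sub_eq_zero.mp h1)⟩ hne
    | bot k' s' =>
      have h2 : z.2 = 0 := le_antisymm hz'.2 hz.2
      have h1 := hz.1
      have h1' := hz'.1
      rw [h2, sub_zero, one_mul] at h1
      rw [h2, add_zero, one_mul] at h1'
      obtain ⟨he, hp⟩ := hleaf h2 h1 (habs h1')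
      exact ⟨_, Or.inr rfl, Or.inr he, hp⟩
    | mid k' s' =>
      have h1 := hz.1
      rw [hz'.1, sub_zero, one_mul] at h1
      obtain ⟨he, hp⟩ := hleaf hz'.1 h1 hz'.2.1
      exact ⟨_, Or.inr rfl, Or.inr he, hp⟩
  | bot k s =>
    cases h' with
    | top k' s' =>
      have h2 : z.2 = 0 := le_antisymm hz.2 hz'.2
      have h1 := hz.1
      have h1' := hz'.1
      rw [h2, sub_zero, one_mul] at h1'
      rw [h2, add_zero, one_mul] at h1
      obtain ⟨he, hp⟩ := hleaf h2 h1 (habs h1')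
      exact ⟨_, Or.inr rfl, Or.inr he, hp⟩
    | bot k' s' =>
      have hmul : (1 + z.2) *
          (((2 * ι k + s.toNat : ℕ) : ℝ) - (2 * ι k' + s'.toNat : ℕ)) = 0 := by
        linarith [hz.1, hz'.1]
      rcases mul_eq_zero.mp hmul with h1 | h1
      · refine ⟨bot, Or.inl rfl, Or.inl rfl, Prod.ext ?_ ?_⟩
        · rw [hz.1, h1, zero_mul, pos]
        · rw [pos]; linarith
      · exact absurd ⟨rfl, leaf_inj hι (by exact_mod_cast sub_eq_zero.mp h1)⟩ hne
    | mid k' s' =>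
      have h1 := hz.1
      rw [hz'.1, add_zero, one_mul] at h1
      obtain ⟨he, hp⟩ := hleaf hz'.1 h1 hz'.2.1
      exact ⟨_, Or.inr rfl, Or.inr he, hp⟩
  | mid k s =>
    cases h' with
    | top k' s' =>
      have h1 := hz'.1
      rw [hz.1, sub_zero, one_mul] at h1
      obtain ⟨he, hp⟩ := hleaf hz.1 h1 hz.2.1
      exact ⟨_, Or.inr he, Or.inr rfl, hp⟩
    | bot k' s' =>
      have h1 := hz'.1
      rw [hz.1, add_zero, one_mul] at h1
      obtain ⟨he, hp⟩ := hleaf hz.1 h1 hz.2.1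
      exact ⟨_, Or.inr he, Or.inr rfl, hp⟩
    | mid k' s' =>
      obtain ⟨h0, h1, h2⟩ := hz
      obtain ⟨_, h1', h2'⟩ := hz'
      rw [abs_le] at h1 h2 h1' h2'
      obtain rfl : k = k' := by
        have e1 : (2 * ι k : ℝ) < 2 * ι k' + 2 := by linarith
        have e2 : (2 * ι k' : ℝ) < 2 * ι k + 2 := by linarith
        norm_cast at e1 e2
        exact hι (by omega)
      refine ⟨mid k, Or.inl rfl, Or.inl rfl, Prod.ext ?_ h0⟩
      rw [pos]
      cases s <;> cases s' <;> simp at h1 h1' hne ⊢ <;> linarith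

/-- The poles and the leaves. -/
def clique (K : Type u) : Set (PoleVertex K) :=
  {top, bot} ∪ Set.range fun x : K × Bool => leaf x.1 x.2

theorem ncard_clique [Finite K] : (clique K).ncard = 2 * Nat.card K + 2 := by
  rw [clique, Set.ncard_union_eq, Set.ncard_pair, Set.ncard_range_of_injective, Nat.card_prod]
  · simp
    ring
  · rintro ⟨k, s⟩ ⟨k', s'⟩ h
    simpa using h
  · simp
  · rw [Set.disjoint_left]
    rintro _ (rfl | rfl) ⟨x, hx⟩ <;> cases hx

end

theorem isPlanar [Finite K] : IsPlanar (graph α β γ).und := by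
  obtain ⟨N, ⟨e⟩⟩ := Finite.exists_equiv_fin K
  let ι : K → ℕ := fun k => e k
  have hι : Function.Injective ι := fun k k' h => e.injective (Fin.ext h)
  have horient : ∀ u v, (graph α β γ).und.Adj u v → ∃ a b, IsLink a b ∧ s(u, v) = s(a, b) ∧
      segment ℝ (pos ι u) (pos ι v) = segment ℝ (pos ι a) (pos ι b) ∧
      ∀ w, (w = u ∨ w = v) ↔ (w = a ∨ w = b) := by
    intro u v h
    rcases isLink_of_adj α β γ h with h | h
    · exact ⟨u, v, h, rfl, rfl, fun _ => Iff.rfl⟩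
    · exact ⟨v, u, h, Sym2.eq_swap, segment_symm _ _ _, fun _ => or_comm⟩
  refine IsPlanar.of_segment (pos ι) (pos_injective hι) ?_ ?_
  · intro u v w h hw
    obtain ⟨a, b, hab, _, hseg, hiff⟩ := horient u v h
    rw [hseg] at hw
    exact (hiff w).mpr (eq_or_eq_of_onLink hι hab (onLink_of_mem_segment ι hab hw))
  · intro u v u' v' h h' hne z hz hz'
    obtain ⟨a, b, hab, he, hseg, hiff⟩ := horient u v h
    obtain ⟨a', b', hab', he', hseg', hiff'⟩ := horient u' v' h'
    rw [hseg] at hz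
    rw [hseg'] at hz'
    obtain ⟨w, h1, h2, h3⟩ := exists_of_onLink hι hab hab' (by
      rintro ⟨rfl, rfl⟩
      exact hne (he.trans he'.symm)) (onLink_of_mem_segment ι hab hz)
      (onLink_of_mem_segment ι hab' hz')
    exact ⟨w, (hiff w).mpr h1, (hiff' w).mpr h2, h3⟩

/-- A homomorphism preserves the colours in which a vertex sees its neighbours. So poles stay apart
because of a leaf that they see in different colours, leaves of different pairs because of their
colours at the poles, the two leaves of a pair because of their middle vertex, and a pole and a leaf
because they are adjacent. -/
theorem isRelativeClique (hinj : ∀ k k', α k = α k' → β k = β k' → k = k')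
    (hγ : Function.Injective γ) (hαβ : ∃ k, α k ≠ β k) :
    (graph α β γ).IsRelativeClique (clique K) := by
  intro W H f hf
  refine Set.InjOn.ncard_image ?_
  have htop : ∀ k s, H.Sees (α k) (f top) (f (leaf k s)) := fun k s =>
    hf.sees (ofLabel_sees.mpr rfl)
  have hbot : ∀ k s, H.Sees (β k) (f bot) (f (leaf k s)) := fun k s =>
    hf.sees (ofLabel_sees.mpr rfl)
  have hmid : ∀ k s, H.Sees (γ s) (f (mid k)) (f (leaf k s)) := fun k s =>
    hf.sees (ofLabel_sees.mpr (if_pos rfl))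
  have hpoles : f top ≠ f bot := by
    intro h
    obtain ⟨k, hk⟩ := hαβ
    have h1 := htop k true
    rw [h] at h1
    exact hk (h1.unique (hbot k true))
  rintro _ ((rfl | rfl) | ⟨⟨k, s⟩, rfl⟩) _ ((rfl | rfl) | ⟨⟨k', s'⟩, rfl⟩) h
  · rfl
  · exact absurd h hpoles
  · exact absurd h (htop k' s').ne
  · exact absurd h.symm hpoles
  · rfl
  · exact absurd h (hbot k' s').ne
  · exact absurd h.symm (htop k s).ne
  · exact absurd h.symm (hbot k s).ne
  · have h1 := htop k s
    have h2 := hbot k s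
    have h3 := hmid k s
    dsimp only at h
    rw [h] at h1 h2 h3
    obtain rfl := hinj k k' (h1.unique (htop k' s')) (h2.unique (hbot k' s'))
    rw [hγ (h3.unique (hmid k s'))]

end PoleVertex

end NMGraph

theorem mainTheorem1 (n m : ℕ) (hnm : 3 ≤ 2 * n + m) :
    IsGreatest (relativeCliqueNumbers.{u} n m TriangleFreePlanar)
      (2 * (2 * n + m) ^ 2 + 2) := by
  constructor
  · have hcard : 1 < Fintype.card (NMGraph.Color n m) := by
      rw [NMGraph.card_color]
      omega
    obtain ⟨c, c', hc⟩ := Fintype.exists_pair_of_one_lt_card hcard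
    -- One pair of leaves for each of the `p²` pairs of colours at the two poles.
    let K := ULift.{u} (NMGraph.Color n m × NMGraph.Color n m)
    let γ : Bool → NMGraph.Color n m := fun s => if s then c else c'
    let G := NMGraph.PoleVertex.graph (K := K) (fun k => k.down.1) (fun k => k.down.2) γ
    have hG : TriangleFreePlanar _ G.und :=
      ⟨NMGraph.PoleVertex.cliqueFree _ _ _, NMGraph.PoleVertex.isPlanar _ _ _⟩
    refine ⟨NMGraph.PoleVertex K, inferInstance, G, hG, ?_⟩
    refine le_antisymm (NMGraph.relativeCliqueNumber_le hnm hG) (le_csSup ?_ ?_)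
    -- The supremum of an unbounded set of naturals is 0 by convention, so boundedness has to be
    -- supplied.
    · refine ⟨2 * (2 * n + m) ^ 2 + 2, ?_⟩
      rintro k ⟨R, hR, rfl⟩
      exact hR.ncard_le hnm hG
    · refine ⟨NMGraph.PoleVertex.clique K, ?_, ?_⟩
      · refine NMGraph.PoleVertex.isRelativeClique _ _ _ ?_ ?_ ⟨⟨(c, c')⟩, hc⟩
        · exact fun k k' h h' => ULift.ext _ _ (Prod.ext h h')
        · rintro (_ | _) (_ | _) h
          exacts [rfl, absurd h.symm hc, absurd h hc, rfl]
      · rw [NMGraph.PoleVertex.ncard_clique, Nat.card_ulift, Nat.card_prod,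
          Nat.card_eq_fintype_card, NMGraph.card_color]
        ring
  · rintro k ⟨V, _, G, hG, rfl⟩
    exact NMGraph.relativeCliqueNumber_le hnm hG
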